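/- Let $\mathbb K$ be a field of characteristic $0$ and let $X$ be a finite set. An $X$-marked uni-trivalent diagram is a finite graph with vertices of valence $1$ and $3$, whose trivalent (internal) vertices carry a cyclic orientation and whose univalent vertices (legs) are marked by elements of $X$; its degree is half the number of its vertices. Let $\mathcal B(X)$ be the completed graded space of such diagrams modulo the $AS$ and $IHX$ relations, with disjoint union as product, let $\mathcal A(\emptyset)=\mathcal B(\emptyset)$, and let $\mathcal A^\circ(\emptyset)$ be defined like $\mathcal A(\emptyset)$ but with diagrams that may also have components that are closed circles without vertices. A strut ${}_x\!\frown_y$ is a single edge with ends marked $x$ and $y$, and $\mathcal B^+(X)\subset\mathcal B(X)$ is the completed span of the diagrams in which every component has an internal vertex. For $A,B\in\mathcal B(X)$ let $\langle A,B\rangle_X$ be bilinear with value, on diagrams, the sum of all ways of gluing all $x$-marked legs of $A$ to all $x$-marked legs of $B$, for every $x\in X$ (it is $0$ if the numbers of legs do not match). For an integer $m\ge 0$, let $O_m$ be the relation that a disjoint closed circle equals multiplication by $-2m$, and let $P_{m+1}$ be the relation that, in any diagram with $2m+2$ stubs, the sum over all ways of pairing up the stubs is $0$. The negative-dimensional formal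 integral of $G\in\mathcal B(X)$ is $$\int^{(m)}G\,dX=\Big\langle \prod_{x\in X}\frac1{m!}\Big(\tfrac12\,{}_x\!\frown_x\Big)^m,\;G\Big\rangle_X\in\mathcal A^\circ(\emptyset)/(O_m,P_{m+1}).$$ Let $\Lambda=(l_{xy})_{x,y\in X}$ be an invertible symmetric matrix over $\mathbb K$ with inverse $(l^{xy})$, let $P\in\mathcal B^+(X)$, and let $G=P\exp\big(\frac12\sum_{x,y}l_{xy}\,{}_x\!\frown_y\big)$ be the corresponding perturbed non-degenerate Gaussian. Its formal Gaussian integral is $$\int^{FG}G\,dX=\Big\langle \exp\Big(-\tfrac12\sum_{x,y}l^{xy}\,{}_x\!\frown_y\Big),\;P\Big\rangle_X .$$ Then $\int^{FG}G\,dX$ lies in $\mathcal A(\emptyset)$; the natural map $\mathcal A_{\le m}(\emptyset)\to\mathcal A^\circ_{\le m}(\emptyset)/(O_m,P_{m+1})$ of the parts of degree $\le m$ is an isomorphism; and in every degree $\le m$ $$\int^{(m)}G\,dX=(-1)^{m|X|}(\det\Lambda)^m\int^{FG}G\,dX\qquad\text{in }\mathcal A^\circ_{\le m}(\emptyset)/(O_m,P_{m+1})\cong\mathcal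 A_{\le m}(\emptyset).$$ -/

import Mathlib

universe u

noncomputable section

/-- The transposition of `a` and `b` (with classical decidability). -/
def pswap {α : Type*} (a b : α) : Equiv.Perm α := @Equiv.swap α (Classical.decEq α) a b

theorem pswap_eq {α : Type*} [DecidableEq α] (a b : α) : pswap a b = Equiv.swap a b := by
  unfold pswap
  congr!

theorem pswap_map {α β : Type*} {f : α → β} (hf : Function.Injective f) (a b x : α) :
    f (pswap a b x) = pswap (f a) (f b) (f x) := by
  classical
  rw [pswap_eq, pswap_eq]
  exact hf.map_swap a b x

theorem pswap_of_ne {α : Type*} {a b x : α} (h1 : x ≠ a) (h2 : x ≠ b) : pswap a b x = x := by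
  classical
  rw [pswap_eq]
  exact Equiv.swap_apply_of_ne_of_ne h1 h2

theorem pswap_pswap {α : Type*} (a b x : α) : pswap a b (pswap a b x) = x := by
  classical
  rw [pswap_eq, Equiv.swap_apply_self]

theorem pswap_eq_iff {α : Type*} {a b x y : α} : pswap a b x = y ↔ x = pswap a b y := by
  classical
  rw [pswap_eq, Equiv.swap_apply_eq_iff]

/-- A uni-trivalent diagram with univalent vertices marked by `X`, described by its half-edges.
The cycles of `σ` are the vertices, with their cyclic orientation; the two-element orbits of `τ`
are the edges.  A fixed point of `σ` is a univalent vertex (a leg) and carries a mark, a 3-cycle of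
`σ` is an oriented trivalent vertex.  A 2-cycle of `σ` is not a vertex of the diagram, but an
auxiliary subdivision point of an edge or of a closed circle; diagrams are considered up
to homeomorphism, that is up to isomorphism and subdivision (see `JDiag.Step`).  So a closed circle
(a component without vertices) is a component that has only subdivision points. -/
structure JDiag (X : Type u) where
  H : Type
  fin : Finite H
  σ : Equiv.Perm H
  τ : Equiv.Perm H
  mark : H → Option X
  τ_invol : ∀ h, τ (τ h) = h
  τ_ne : ∀ h, τ h ≠ h
  valence : ∀ h, σ (σ h) = h ∨ σ (σ (σ h)) = h
  mark_iff : ∀ h, (mark h).isSome ↔ σ h = h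

namespace JDiag

variable {X : Type u}

/-- The half-edge `h` ends in a univalent vertex. -/
def IsLeg (D : JDiag X) (h : D.H) : Prop := (D.mark h).isSome

/-- The half-edge `h` ends in a trivalent vertex. -/
def IsTri (D : JDiag X) (h : D.H) : Prop := D.σ h ≠ h ∧ D.σ (D.σ h) ≠ h

/-- The half-edge `h` ends in a subdivision point. -/
def IsBi (D : JDiag X) (h : D.H) : Prop := D.σ h ≠ h ∧ D.σ (D.σ h) = h

/-- The half-edges `h` and `k` belong to the same connected component. -/
def SameComp (D : JDiag X) : D.H → D.H → Prop :=
  Relation.EqvGen fun h k => k = D.σ h ∨ k = D.τ h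

/-- No component is a closed circle. -/
def CircleFree (D : JDiag X) : Prop := ∀ h, ∃ k, D.SameComp h k ∧ ¬ D.IsBi k

/-- Every component has a trivalent (internal) vertex. -/
def Strutless (D : JDiag X) : Prop := ∀ h, ∃ k, D.SameComp h k ∧ D.IsTri k

/-- The number of univalent vertices. -/
def numLegs (D : JDiag X) : ℕ := Nat.card {h // D.IsLeg h}

/-- The number of trivalent vertices. -/
def numTri (D : JDiag X) : ℕ := Nat.card {h // D.IsTri h} / 3

/-- The degree: half the number of vertices (which is always even). -/
def degree (D : JDiag X) : ℕ := (D.numLegs + D.numTri) / 2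

/-- Isomorphism of diagrams. -/
structure Iso (D E : JDiag X) where
  e : D.H ≃ E.H
  σ_comm : ∀ h, e (D.σ h) = E.σ (e h)
  τ_comm : ∀ h, e (D.τ h) = E.τ (e h)
  mark_comm : ∀ h, E.mark (e h) = D.mark h

/-- Subdivision of the edge `{h, τ h}`: the new subdivision point has the half-edges `inr false`
and `inr true`, and the edge is replaced by `{h, inr false}` and `{inr true, τ h}`. -/
def subdiv (D : JDiag X) (h : D.H) : JDiag X where
  H := D.H ⊕ Bool
  fin := by have := D.fin; infer_instance
  σ := Equiv.Perm.sumCongr D.σ Equiv.boolNot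
  τ := pswap (Sum.inl (D.τ h)) (Sum.inr false) *
    Equiv.Perm.sumCongr D.τ Equiv.boolNot * pswap (Sum.inl (D.τ h)) (Sum.inr false)
  mark := Sum.elim D.mark (fun _ => none)
  τ_invol := by
    intro x
    simp only [Equiv.Perm.mul_apply, pswap_pswap]
    rw [pswap_eq_iff]
    generalize pswap (Sum.inl (D.τ h)) (Sum.inr false) x = y
    rcases y with y | y <;> simp [D.τ_invol]
  τ_ne := by
    intro x
    simp only [Equiv.Perm.mul_apply]
    rw [Ne, pswap_eq_iff]
    generalize pswap (Sum.inl (D.τ h)) (Sum.inr false) x = y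
    rcases y with y | y <;> simp [D.τ_ne]
  valence := by
    rintro (x | x)
    · simpa using D.valence x
    · simp
  mark_iff := by
    rintro (x | x)
    · simpa using D.mark_iff x
    · simp

/-- Elementary homeomorphisms: isomorphisms, and subdivisions of an edge. -/
inductive Step : JDiag X → JDiag X → Prop
  | iso {D E : JDiag X} (e : Iso D E) : Step D E
  | subdiv (D : JDiag X) (h : D.H) : Step D (D.subdiv h)

/-- Disjoint union. -/
def union (D E : JDiag X) : JDiag X where
  H := D.H ⊕ E.H
  fin := by have := D.fin; have := E.fin; infer_instance
  σ := Equiv.Perm.sumCongr D.σ E.σ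
  τ := Equiv.Perm.sumCongr D.τ E.τ
  mark := Sum.elim D.mark E.mark
  τ_invol := by rintro (x | x) <;> simp [D.τ_invol, E.τ_invol]
  τ_ne := by rintro (x | x) <;> simp [D.τ_ne, E.τ_ne]
  valence := by
    rintro (x | x)
    · simpa using D.valence x
    · simpa using E.valence x
  mark_iff := by
    rintro (x | x)
    · simpa using D.mark_iff x
    · simpa using E.mark_iff x

/-- The empty diagram. -/
def empty (X : Type u) : JDiag X where
  H := Empty
  fin := inferInstance
  σ := 1
  τ := 1
  mark := fun h => h.elim
  τ_invol := fun h => h.elim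
  τ_ne := fun h => h.elim
  valence := fun h => h.elim
  mark_iff := fun h => h.elim

/-- The strut: a single edge without internal vertices, whose ends are marked `x` and `y`. -/
def strut (x y : X) : JDiag X where
  H := Bool
  fin := inferInstance
  σ := 1
  τ := Equiv.boolNot
  mark := fun b => if b then some y else some x
  τ_invol := by simp
  τ_ne := by simp
  valence := by simp
  mark_iff := by simp

/-- The closed circle (with one subdivision point). -/
def circle (X : Type u) : JDiag X where
  H := Bool
  fin := inferInstance
  σ := Equiv.boolNot
  τ := Equiv.boolNot
  mark := fun _ => none
  τ_invol := by simp
  τ_ne := by simp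
  valence := by simp
  mark_iff := by simp

/-- Rearranging the half-edges at the vertices by a permutation `ρ`: the vertices become the cycles
of `ρ σ ρ⁻¹`, and the edges stay. -/
def rearrange (D : JDiag X) (ρ : Equiv.Perm D.H) (hρ : ∀ h, D.mark (ρ h) = D.mark h) : JDiag X where
  H := D.H
  fin := D.fin
  σ := ρ * D.σ * ρ⁻¹
  τ := D.τ
  mark := D.mark
  τ_invol := D.τ_invol
  τ_ne := D.τ_ne
  valence := by
    intro h
    have := D.valence (ρ⁻¹ h)
    simpa [Equiv.Perm.mul_apply, ← Equiv.Perm.eq_inv_iff_eq] using this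
  mark_iff := by
    intro h
    have h1 := D.mark_iff (ρ⁻¹ h)
    have h2 := hρ (ρ⁻¹ h)
    rw [← h2, Equiv.Perm.coe_inv, Equiv.apply_symm_apply] at h1
    rw [h1]
    simp [Equiv.Perm.mul_apply, ← Equiv.Perm.eq_inv_iff_eq]

theorem IsTri.mark_eq {D : JDiag X} {h : D.H} (ht : D.IsTri h) : D.mark h = none := by
  have := D.mark_iff h
  rcases hm : D.mark h with _ | x
  · rfl
  · exact absurd (this.1 (by simp [hm])) ht.1

theorem IsTri.map {D : JDiag X} {h : D.H} (ht : D.IsTri h) : D.IsTri (D.σ h) := by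
  have := ht
  simp only [IsTri, ne_eq, EmbeddingLike.apply_eq_iff_eq] at this ⊢
  exact this

theorem mark_pswap (D : JDiag X) {a b : D.H} (ha : D.mark a = none)
    (hb : D.mark b = none) (k : D.H) : D.mark (pswap a b k) = D.mark k := by
  classical
  rw [pswap_eq, Equiv.swap_apply_def]
  split_ifs with h1 h2 <;> simp_all

/-- Reversal of the orientation of the trivalent vertex at the half-edge `h`. -/
def flip (D : JDiag X) (h : D.H) (ht : D.IsTri h) : JDiag X :=
  D.rearrange (pswap (D.σ h) (D.σ (D.σ h))) (D.mark_pswap ht.map.mark_eq ht.map.map.mark_eq)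

/-- For an edge `{h, k}`, `k = τ h`, joining two trivalent vertices `(h, a, b)` and `(k, c, d)`: the
cyclic permutation `a ↦ b ↦ c ↦ a`. -/
def ihxPerm (D : JDiag X) (h : D.H) : Equiv.Perm D.H :=
  pswap (D.σ h) (D.σ (D.σ h)) * pswap (D.σ (D.σ h)) (D.σ (D.τ h))

theorem ihx_mark (D : JDiag X) {h : D.H} (ht : D.IsTri h) (hk : D.IsTri (D.τ h)) (x : D.H) :
    D.mark (D.ihxPerm h x) = D.mark x := by
  rw [ihxPerm, Equiv.Perm.mul_apply, D.mark_pswap ht.map.mark_eq ht.map.map.mark_eq,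
    D.mark_pswap ht.map.map.mark_eq hk.map.mark_eq]

/-- The edge at `h` joins two different trivalent vertices. -/
structure IsIHXEdge (D : JDiag X) (h : D.H) : Prop where
  tri : D.IsTri h
  tri' : D.IsTri (D.τ h)
  ne₁ : D.τ h ≠ D.σ h
  ne₂ : D.τ h ≠ D.σ (D.σ h)

/-- The second term of the IHX relation, with vertices `(h, b, c)` and `(k, a, d)`. -/
def ihx₁ (D : JDiag X) (h : D.H) (hh : D.IsIHXEdge h) : JDiag X :=
  D.rearrange (D.ihxPerm h) (D.ihx_mark hh.tri hh.tri')

/-- The third term of the IHX relation, with vertices `(h, c, a)` and `(k, b, d)`. -/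
def ihx₂ (D : JDiag X) (h : D.H) (hh : D.IsIHXEdge h) : JDiag X :=
  D.rearrange (D.ihxPerm h * D.ihxPerm h) fun x => by
    rw [Equiv.Perm.mul_apply, D.ihx_mark hh.tri hh.tri', D.ihx_mark hh.tri hh.tri']

/-- `π` is a perfect matching of the legs of `D`. -/
def IsMatching (D : JDiag X) (π : Equiv.Perm D.H) : Prop :=
  (∀ h, π (π h) = h) ∧ ∀ h, π h = h ↔ ¬ D.IsLeg h

theorem mark_none {D : JDiag X} {h : D.H} (hl : D.σ h ≠ h) : ¬ D.IsLeg h :=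
  fun h' => hl ((D.mark_iff h).1 h')

/-- The closed diagram obtained by gluing the legs of `D` in pairs, according to the perfect
matching `π`: two matched legs become a subdivision point. -/
def close (D : JDiag X) (π : Equiv.Perm D.H) (hπ : D.IsMatching π) : JDiag Empty where
  H := D.H
  fin := D.fin
  σ := D.σ * π
  τ := D.τ
  mark := fun _ => none
  τ_invol := D.τ_invol
  τ_ne := D.τ_ne
  valence := by
    intro h
    simp only [Equiv.Perm.mul_apply]
    by_cases hl : D.IsLeg h
    · left
      have h1 : D.IsLeg (π h) := by
        by_contra hc
        have h2 := (hπ.2 _).2 hc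
        rw [hπ.1] at h2
        exact (hπ.2 h).1 h2.symm hl
      rw [(D.mark_iff _).1 h1, hπ.1, (D.mark_iff _).1 hl]
    · have e1 := (hπ.2 h).2 hl
      have e2 : D.σ h ≠ h := fun hc => hl ((D.mark_iff _).2 hc)
      have e3 : π (D.σ h) = D.σ h := (hπ.2 _).2 (mark_none (by simpa using e2))
      have e4 : π (D.σ (D.σ h)) = D.σ (D.σ h) := (hπ.2 _).2 (mark_none (by simpa using e2))
      rw [e1, e3, e4]
      exact D.valence h
  mark_iff := by
    intro h
    simp only [Option.isSome_none, Bool.false_eq_true, Equiv.Perm.mul_apply, false_iff]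
    intro hc
    by_cases hl : D.IsLeg h
    · have h1 : D.IsLeg (π h) := by
        by_contra hc
        have h2 := (hπ.2 _).2 hc
        rw [hπ.1] at h2
        exact (hπ.2 h).1 h2.symm hl
      rw [(D.mark_iff _).1 h1] at hc
      exact (hπ.2 h).1 hc hl
    · rw [(hπ.2 h).2 hl] at hc
      exact hl ((D.mark_iff _).2 hc)

/-- A matching of the legs of a disjoint union that glues each leg of one part to a leg of the other
part that has the same mark. -/
def IsGluing (D E : JDiag X) (π : Equiv.Perm (D.H ⊕ E.H)) : Prop :=
  ∀ h : D.H ⊕ E.H, (D.union E).IsLeg h →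
    (D.union E).mark (π h) = (D.union E).mark h ∧ Sum.isLeft (π h) = !Sum.isLeft h

/-! Compatibility of the constructions with isomorphisms and subdivisions. -/

/-- Isomorphic diagrams have isomorphic disjoint unions with a third one. -/
def Iso.unionLeft {D D' : JDiag X} (i : Iso D D') (E : JDiag X) :
    Iso (D.union E) (D'.union E) where
  e := Equiv.sumCongr i.e (Equiv.refl _)
  σ_comm := by
    rintro (h | h)
    · exact congrArg Sum.inl (i.σ_comm h)
    · rfl
  τ_comm := by
    rintro (h | h)
    · exact congrArg Sum.inl (i.τ_comm h)
    · rfl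
  mark_comm := by
    rintro (h | h)
    · exact i.mark_comm h
    · rfl

/-- Disjoint union is commutative. -/
def unionComm (D E : JDiag X) : Iso (D.union E) (E.union D) where
  e := Equiv.sumComm _ _
  σ_comm := by rintro (h | h) <;> rfl
  τ_comm := by rintro (h | h) <;> rfl
  mark_comm := by rintro (h | h) <;> rfl

/-- Disjoint union is associative. -/
def unionAssoc (D E F : JDiag X) : Iso ((D.union E).union F) (D.union (E.union F)) where
  e := Equiv.sumAssoc _ _ _
  σ_comm := by rintro ((h | h) | h) <;> rfl
  τ_comm := by rintro ((h | h) | h) <;> rfl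
  mark_comm := by rintro ((h | h) | h) <;> rfl

/-- The empty diagram is neutral. -/
def unionEmpty (D : JDiag X) : Iso (D.union (empty X)) D where
  e := Equiv.sumEmpty _ Empty
  σ_comm := by
    rintro (h | h)
    · rfl
    · exact h.elim
  τ_comm := by
    rintro (h | h)
    · rfl
    · exact h.elim
  mark_comm := by
    rintro (h | h)
    · rfl
    · exact h.elim

/-- The evident bijection. -/
def sumBoolEquiv (α β : Type) : (α ⊕ Bool) ⊕ β ≃ (α ⊕ β) ⊕ Bool where
  toFun := Sum.elim (Sum.elim (fun a => Sum.inl (Sum.inl a)) Sum.inr) (fun b => Sum.inl (Sum.inr b))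
  invFun := Sum.elim (Sum.elim (fun a => Sum.inl (Sum.inl a)) Sum.inr) (fun b => Sum.inl (Sum.inr b))
  left_inv := by rintro ((h | h) | h) <;> rfl
  right_inv := by rintro ((h | h) | h) <;> rfl

/-- Subdivision commutes with disjoint union. -/
def unionSubdiv (D E : JDiag X) (k : D.H) :
    Iso ((D.subdiv k).union E) ((D.union E).subdiv (Sum.inl k)) where
  e := sumBoolEquiv _ _
  σ_comm := by rintro ((h | h) | h) <;> rfl
  τ_comm := by
    have key : ∀ (a b x : D.H ⊕ Bool), sumBoolEquiv D.H E.H (Sum.inl (pswap a b x)) =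
        pswap (sumBoolEquiv D.H E.H (Sum.inl a)) (sumBoolEquiv D.H E.H (Sum.inl b))
          (sumBoolEquiv D.H E.H (Sum.inl x)) := fun a b x =>
      pswap_map (f := fun x => sumBoolEquiv D.H E.H (Sum.inl x))
        ((sumBoolEquiv D.H E.H).injective.comp Sum.inl_injective) a b x
    have key2 : ∀ x : D.H ⊕ Bool, sumBoolEquiv D.H E.H
        (Sum.inl (Equiv.Perm.sumCongr D.τ Equiv.boolNot x)) =
        Equiv.Perm.sumCongr (Equiv.Perm.sumCongr D.τ E.τ) Equiv.boolNot
          (sumBoolEquiv D.H E.H (Sum.inl x)) := by rintro (x | x) <;> rfl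
    rintro (x | y)
    · exact (key _ _ _).trans (congrArg _ ((key2 _).trans (congrArg _ (key _ _ _))))
    · change Sum.inl (Sum.inr (E.τ y)) = pswap (Sum.inl (Sum.inl (D.τ k))) (Sum.inr false)
        (Equiv.Perm.sumCongr (Equiv.Perm.sumCongr D.τ E.τ) Equiv.boolNot
          (pswap (Sum.inl (Sum.inl (D.τ k))) (Sum.inr false) (Sum.inl (Sum.inr y))))
      have fix : ∀ z : E.H, pswap (Sum.inl (Sum.inl (D.τ k)) : (D.H ⊕ E.H) ⊕ Bool) (Sum.inr false)
          (Sum.inl (Sum.inr z)) = Sum.inl (Sum.inr z) :=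
        fun z => pswap_of_ne (by simp) (by simp)
      rw [fix]
      exact (fix _).symm
  mark_comm := by rintro ((h | h) | h) <;> rfl

/-- Uni-trivalent diagrams up to homeomorphism. -/
def Cls (X : Type u) : Type (max 1 u) := Quot (Step (X := X))

/-- The homeomorphism class of a diagram. -/
def cls (D : JDiag X) : Cls X := Quot.mk _ D

theorem cls_iso {D E : JDiag X} (i : Iso D E) : cls D = cls E := Quot.sound (Step.iso i)

theorem cls_subdiv (D : JDiag X) (h : D.H) : cls (D.subdiv h) = cls D :=
  (Quot.sound (Step.subdiv D h)).symm

theorem cls_union_left {D D' : JDiag X} (s : Step D D') (E : JDiag X) :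
    cls (D.union E) = cls (D'.union E) := by
  cases s with
  | iso i => exact cls_iso (i.unionLeft E)
  | subdiv h => exact ((cls_iso (unionSubdiv D E h)).trans (cls_subdiv (D.union E) (Sum.inl h))).symm

theorem cls_union_right (E : JDiag X) {D D' : JDiag X} (s : Step D D') :
    cls (E.union D) = cls (E.union D') := by
  rw [cls_iso (unionComm E D), cls_iso (unionComm E D'), cls_union_left s]

/-- Homeomorphism classes of diagrams form a commutative monoid under disjoint union. -/
instance : CommMonoid (Cls X) where
  mul := Quot.lift₂ (fun D E => cls (D.union E)) (fun E _ _ s => cls_union_right E s)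
    (fun _ _ E s => cls_union_left s E)
  one := cls (empty X)
  mul_assoc := by
    rintro ⟨D⟩ ⟨E⟩ ⟨F⟩
    exact cls_iso (unionAssoc D E F)
  one_mul := by
    rintro ⟨D⟩
    exact (cls_iso (unionComm _ D)).trans (cls_iso (unionEmpty D))
  mul_one := by
    rintro ⟨D⟩
    exact cls_iso (unionEmpty D)
  mul_comm := by
    rintro ⟨D⟩ ⟨E⟩
    exact cls_iso (unionComm D E)

theorem cls_mul (D E : JDiag X) : cls D * cls E = cls (D.union E) := rfl

variable (𝕜 : Type*) [Field 𝕜]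

/-- The `AS` and `IHX` relators. -/
inductive IsRelator : MonoidAlgebra 𝕜 (Cls X) → Prop
  | as (D : JDiag X) (h : D.H) (ht : D.IsTri h) :
      IsRelator (MonoidAlgebra.single (cls D) 1 + MonoidAlgebra.single (cls (D.flip h ht)) 1)
  | ihx (D : JDiag X) (h : D.H) (hh : D.IsIHXEdge h) :
      IsRelator (MonoidAlgebra.single (cls D) 1 + MonoidAlgebra.single (cls (D.ihx₁ h hh)) 1 +
        MonoidAlgebra.single (cls (D.ihx₂ h hh)) 1)

/-- The algebra (under disjoint union) of `X`-marked uni-trivalent diagrams, closed circles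
allowed, modulo `AS` and `IHX`.  A relator involves diagrams with one and the same number of closed
circles only, so the space is the direct sum of its parts with a given number of circles,
and the span of the diagrams without circles is the usual space of diagrams without circles modulo
`AS` and `IHX`. -/
abbrev Space (X : Type u) : Type _ :=
  MonoidAlgebra 𝕜 (Cls X) ⧸ Ideal.span {r : MonoidAlgebra 𝕜 (Cls X) | IsRelator 𝕜 r}

/-- The element of `Space 𝕜 X` given by a diagram. -/
def el (D : JDiag X) : Space 𝕜 X := Ideal.Quotient.mk _ (MonoidAlgebra.single (cls D) 1)

/-- The sum over all perfect matchings `π` of the legs of `D` that satisfy `p`, of the closed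
diagram obtained by gluing along `π`. -/
def closeSum (D : JDiag X) (p : Equiv.Perm D.H → Prop) : Space 𝕜 Empty :=
  ∑ᶠ π : {π : Equiv.Perm D.H // D.IsMatching π ∧ p π}, el 𝕜 (D.close π.1 π.2.1)

/-- The sum of all ways of gluing all the legs of `D` to all the legs of `E`, respecting the
marks (zero if there is no such way). -/
def glueSum (D E : JDiag X) : Space 𝕜 Empty := closeSum 𝕜 (D.union E) (IsGluing D E)

/-! The gluing sum depends only on the homeomorphism classes and respects `AS` and `IHX`. -/

theorem el_iso {D E : JDiag X} (i : Iso D E) : el 𝕜 D = el 𝕜 E := by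
  unfold el
  rw [cls_iso i]

theorem el_subdiv (D : JDiag X) (k : D.H) : el 𝕜 (D.subdiv k) = el 𝕜 D := by
  unfold el
  rw [cls_subdiv]

theorem closeSum_iso {D E : JDiag X} (i : Iso D E) {p : Equiv.Perm D.H → Prop}
    {q : Equiv.Perm E.H → Prop} (hpq : ∀ π, p π ↔ q (i.e.permCongr π)) :
    closeSum 𝕜 D p = closeSum 𝕜 E q := by
  have hm : ∀ π, (D.IsMatching π ∧ p π) ↔ (E.IsMatching (i.e.permCongr π) ∧ q (i.e.permCongr π)) := by
    intro π
    rw [hpq]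
    refine and_congr_left fun _ => ?_
    have hl : ∀ h, E.IsLeg (i.e h) ↔ D.IsLeg h := fun h => by simp [IsLeg, i.mark_comm]
    unfold IsMatching
    constructor
    · rintro ⟨h1, h2⟩
      refine ⟨fun h => by simp [h1], fun h => ?_⟩
      obtain ⟨h, rfl⟩ := i.e.surjective h
      simp [hl, h2]
    · rintro ⟨h1, h2⟩
      refine ⟨fun h => by simpa using h1 (i.e h), fun h => ?_⟩
      have := h2 (i.e h)
      rw [hl] at this
      simpa using this
  refine finsum_eq_of_bijective (Equiv.subtypeEquiv i.e.permCongr hm)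
    (Equiv.bijective _) fun π => ?_
  have key : ∀ h : D.H, i.e (D.σ (π.1 h)) = E.σ (i.e (π.1 (i.e.symm (i.e h)))) := fun h => by
    rw [i.e.symm_apply_apply, i.σ_comm]
  exact el_iso 𝕜 ⟨i.e, key, i.τ_comm, fun h => rfl⟩

theorem closeSum_subdiv (D : JDiag X) (k : D.H) {p : Equiv.Perm D.H → Prop}
    {q : Equiv.Perm (D.H ⊕ Bool) → Prop} (hpq : ∀ π, p π ↔ q (Equiv.Perm.sumCongr π 1)) :
    closeSum 𝕜 D p = closeSum 𝕜 (D.subdiv k) q := by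
  have hleg : ∀ h, (D.subdiv k).IsLeg (Sum.inl h) ↔ D.IsLeg h := fun h => Iff.rfl
  have hm : ∀ π, D.IsMatching π ↔ (D.subdiv k).IsMatching (Equiv.Perm.sumCongr π 1) := by
    intro π
    constructor
    · rintro ⟨h1, h2⟩
      refine ⟨?_, ?_⟩
      · rintro (h | h)
        · exact congrArg Sum.inl (h1 h)
        · rfl
      · rintro (h | h)
        · exact Sum.inl_injective.eq_iff.trans (h2 h)
        · exact iff_of_true rfl (by simp [IsLeg, subdiv])
    · rintro ⟨h1, h2⟩
      exact ⟨fun h => Sum.inl_injective (h1 (Sum.inl h)),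
        fun h => Sum.inl_injective.eq_iff.symm.trans (h2 (Sum.inl h))⟩
  refine finsum_eq_of_bijective
    (fun π => ⟨Equiv.Perm.sumCongr π.1 1, (hm _).1 π.2.1, (hpq _).1 π.2.2⟩) ⟨?_, ?_⟩ fun π => ?_
  · intro π π' h
    have h := congrArg Subtype.val h
    apply Subtype.ext
    ext x
    exact Sum.inl_injective (DFunLike.congr_fun h (Sum.inl x))
  · rintro ⟨π, h1, h2⟩
    have hf : ∀ b, π (Sum.inr b) = Sum.inr b := fun b =>
      (h1.2 (Sum.inr b)).2 (by simp [IsLeg, subdiv])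
    have := D.fin
    have hr : π ∈ (Equiv.Perm.sumCongrHom D.H Bool).range := by
      apply Equiv.Perm.mem_sumCongrHom_range_of_perm_mapsTo_inl
      rintro _ ⟨a, rfl⟩
      rcases hx : π (Sum.inl a) with b | b
      · exact ⟨b, rfl⟩
      · rw [← hf b] at hx
        exact absurd (π.injective hx) (by simp)
    obtain ⟨⟨π₁, π₂⟩, rfl⟩ := hr
    have h3 : π₂ = 1 := by
      refine Equiv.ext fun b => ?_
      exact Sum.inr_injective (hf b)
    subst h3
    exact ⟨⟨π₁, (hm _).2 h1, (hpq _).2 h2⟩, rfl⟩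
  · refine (el_subdiv 𝕜 (D.close π.1 π.2.1) k).symm.trans ?_
    refine el_iso 𝕜 ⟨Equiv.refl _, ?_, fun h => rfl, ?_⟩
    · rintro (h | h) <;> rfl
    · rintro (h | h) <;> rfl

theorem IsMatching.leg {D : JDiag X} {π : Equiv.Perm D.H} (hπ : D.IsMatching π) {h : D.H}
    (hl : D.IsLeg h) : D.IsLeg (π h) := by
  by_contra hc
  have h2 := (hπ.2 _).2 hc
  rw [hπ.1] at h2
  exact (hπ.2 h).1 h2.symm hl

theorem rearrange_comm {D : JDiag X} {ρ π : Equiv.Perm D.H}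
    (hfix : ∀ h, D.IsLeg h → ρ h = h) (hπ : D.IsMatching π) (h : D.H) :
    ρ⁻¹ (π h) = π (ρ⁻¹ h) := by
  rw [Equiv.Perm.inv_eq_iff_eq]
  by_cases hl : D.IsLeg h
  · have h2 : ρ⁻¹ h = h := by rw [Equiv.Perm.inv_eq_iff_eq, hfix h hl]
    rw [h2, hfix _ (hπ.leg hl)]
  · obtain ⟨k, rfl⟩ := ρ.surjective h
    have h1 : ¬ D.IsLeg k := fun hc => hl (by rwa [hfix _ hc])
    rw [(hπ.2 _).2 hl, Equiv.Perm.coe_inv, Equiv.symm_apply_apply, (hπ.2 _).2 h1]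

theorem el_close_rearrange (D : JDiag X) (ρ : Equiv.Perm D.H) (hρ : ∀ h, D.mark (ρ h) = D.mark h)
    (hfix : ∀ h, D.IsLeg h → ρ h = h) (π : Equiv.Perm D.H) (hπ : D.IsMatching π)
    (hπ' : (D.rearrange ρ hρ).IsMatching π) :
    el 𝕜 ((D.rearrange ρ hρ).close π hπ') =
      el 𝕜 ((D.close π hπ).rearrange ρ (fun _ => rfl)) :=
  el_iso 𝕜 ⟨Equiv.refl _, fun h => congrArg (fun x => ρ (D.σ x)) (rearrange_comm hfix hπ h),
    fun _ => rfl, fun _ => rfl⟩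

theorem rearrange_congr (D : JDiag X) {ρ ρ' : Equiv.Perm D.H} (e : ρ = ρ')
    (hρ : ∀ h, D.mark (ρ h) = D.mark h) (hρ' : ∀ h, D.mark (ρ' h) = D.mark h) :
    D.rearrange ρ hρ = D.rearrange ρ' hρ' := by
  subst e
  rfl

theorem IsTri.not_leg {D : JDiag X} {h : D.H} (ht : D.IsTri h) : ¬ D.IsLeg h := mark_none ht.1

theorem close_σ {D : JDiag X} {π : Equiv.Perm D.H} (hπ : D.IsMatching π) {h : D.H}
    (ht : D.IsTri h) : (D.close π hπ).σ h = D.σ h := congrArg D.σ ((hπ.2 h).2 ht.not_leg)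

theorem IsTri.close {D : JDiag X} {π : Equiv.Perm D.H} (hπ : D.IsMatching π) {h : D.H}
    (ht : D.IsTri h) : (D.close π hπ).IsTri h := by
  refine ⟨fun hc => ht.1 ((close_σ hπ ht).symm.trans hc), fun hc => ht.2 ?_⟩
  refine Eq.trans ?_ hc
  refine ((congrArg (D.close π hπ).σ (close_σ hπ ht)).trans ?_).symm
  exact close_σ hπ ht.map

theorem pswap_fix {D : JDiag X} {a b : D.H} (ha : D.IsTri a) (hb : D.IsTri b) (h : D.H)
    (hl : D.IsLeg h) : pswap a b h = h :=
  pswap_of_ne (fun e => ha.not_leg (e ▸ hl)) (fun e => hb.not_leg (e ▸ hl))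

theorem close_σσ {D : JDiag X} {π : Equiv.Perm D.H} (hπ : D.IsMatching π) {h : D.H}
    (ht : D.IsTri h) : (D.close π hπ).σ ((D.close π hπ).σ h) = D.σ (D.σ h) :=
  (congrArg (D.close π hπ).σ (close_σ hπ ht)).trans (close_σ hπ ht.map)

theorem close_flip (D : JDiag X) (h : D.H) (ht : D.IsTri h) (π : Equiv.Perm D.H)
    (hπ : D.IsMatching π) :
    el 𝕜 ((D.flip h ht).close π hπ) = el 𝕜 ((D.close π hπ).flip h (ht.close hπ)) := by
  refine (el_close_rearrange 𝕜 D _ _ (pswap_fix ht.map ht.map.map) π hπ _).trans ?_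
  refine congrArg (el 𝕜) (rearrange_congr _ ?_ _ _)
  exact (congrArg₂ pswap (close_σ hπ ht) (close_σσ hπ ht)).symm

theorem IsIHXEdge.close {D : JDiag X} {π : Equiv.Perm D.H} (hπ : D.IsMatching π) {h : D.H}
    (hh : D.IsIHXEdge h) : (D.close π hπ).IsIHXEdge h where
  tri := hh.tri.close hπ
  tri' := hh.tri'.close hπ
  ne₁ := fun e => hh.ne₁ (e.trans (close_σ hπ hh.tri))
  ne₂ := fun e => hh.ne₂ (e.trans (close_σσ hπ hh.tri))

theorem ihxPerm_fix {D : JDiag X} {h : D.H} (hh : D.IsIHXEdge h) (k : D.H) (hl : D.IsLeg k) :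
    D.ihxPerm h k = k := by
  rw [ihxPerm, Equiv.Perm.mul_apply, pswap_fix hh.tri.map.map hh.tri'.map k hl,
    pswap_fix hh.tri.map hh.tri.map.map k hl]

theorem close_ihxPerm {D : JDiag X} {π : Equiv.Perm D.H} (hπ : D.IsMatching π) {h : D.H}
    (hh : D.IsIHXEdge h) : (D.close π hπ).ihxPerm h = D.ihxPerm h :=
  congrArg₂ (fun x y : Equiv.Perm D.H => x * y)
    (congrArg₂ pswap (close_σ hπ hh.tri) (close_σσ hπ hh.tri))
    (congrArg₂ pswap (close_σσ hπ hh.tri) (close_σ hπ hh.tri'))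

theorem close_ihx₁ (D : JDiag X) (h : D.H) (hh : D.IsIHXEdge h) (π : Equiv.Perm D.H)
    (hπ : D.IsMatching π) :
    el 𝕜 ((D.ihx₁ h hh).close π hπ) = el 𝕜 ((D.close π hπ).ihx₁ h (hh.close hπ)) := by
  refine (el_close_rearrange 𝕜 D _ _ (ihxPerm_fix hh) π hπ _).trans ?_
  refine congrArg (el 𝕜) (rearrange_congr _ ?_ _ _)
  exact (close_ihxPerm hπ hh).symm

theorem close_ihx₂ (D : JDiag X) (h : D.H) (hh : D.IsIHXEdge h) (π : Equiv.Perm D.H)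
    (hπ : D.IsMatching π) :
    el 𝕜 ((D.ihx₂ h hh).close π hπ) = el 𝕜 ((D.close π hπ).ihx₂ h (hh.close hπ)) := by
  refine (el_close_rearrange 𝕜 D _ _ (fun k hl => ?_) π hπ _).trans ?_
  · rw [Equiv.Perm.mul_apply, ihxPerm_fix hh k hl, ihxPerm_fix hh k hl]
  · refine congrArg (el 𝕜) (rearrange_congr _ ?_ _ _)
    exact (congrArg (fun x : Equiv.Perm D.H => x * x) (close_ihxPerm hπ hh)).symm

theorem el_flip (D : JDiag X) (h : D.H) (ht : D.IsTri h) : el 𝕜 D + el 𝕜 (D.flip h ht) = 0 := by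
  unfold el
  rw [← map_add]
  exact Ideal.Quotient.eq_zero_iff_mem.2 (Ideal.subset_span (IsRelator.as D h ht))

theorem el_ihx (D : JDiag X) (h : D.H) (hh : D.IsIHXEdge h) :
    el 𝕜 D + el 𝕜 (D.ihx₁ h hh) + el 𝕜 (D.ihx₂ h hh) = 0 := by
  unfold el
  rw [← map_add, ← map_add]
  exact Ideal.Quotient.eq_zero_iff_mem.2 (Ideal.subset_span (IsRelator.ihx D h hh))

instance (D : JDiag X) (p : Equiv.Perm D.H → Prop) : Finite {π // D.IsMatching π ∧ p π} := by
  have := D.fin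
  infer_instance

theorem closeSum_flip (D : JDiag X) (h : D.H) (ht : D.IsTri h) (p : Equiv.Perm D.H → Prop) :
    closeSum 𝕜 D p + closeSum 𝕜 (D.flip h ht) p = 0 := by
  have e : closeSum 𝕜 (D.flip h ht) p = ∑ᶠ π : {π : Equiv.Perm D.H // D.IsMatching π ∧ p π},
      el 𝕜 ((D.close π.1 π.2.1).flip h (ht.close π.2.1)) :=
    finsum_congr fun π => close_flip 𝕜 D h ht π.1 π.2.1
  rw [e, closeSum, ← finsum_add_distrib (Set.toFinite _) (Set.toFinite _)]
  exact (finsum_congr fun π => el_flip 𝕜 _ _ _).trans finsum_zero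

theorem closeSum_ihx (D : JDiag X) (h : D.H) (hh : D.IsIHXEdge h) (p : Equiv.Perm D.H → Prop) :
    closeSum 𝕜 D p + closeSum 𝕜 (D.ihx₁ h hh) p + closeSum 𝕜 (D.ihx₂ h hh) p = 0 := by
  have e₁ : closeSum 𝕜 (D.ihx₁ h hh) p = ∑ᶠ π : {π : Equiv.Perm D.H // D.IsMatching π ∧ p π},
      el 𝕜 ((D.close π.1 π.2.1).ihx₁ h (hh.close π.2.1)) :=
    finsum_congr fun π => close_ihx₁ 𝕜 D h hh π.1 π.2.1
  have e₂ : closeSum 𝕜 (D.ihx₂ h hh) p = ∑ᶠ π : {π : Equiv.Perm D.H // D.IsMatching π ∧ p π},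
      el 𝕜 ((D.close π.1 π.2.1).ihx₂ h (hh.close π.2.1)) :=
    finsum_congr fun π => close_ihx₂ 𝕜 D h hh π.1 π.2.1
  rw [e₁, e₂, closeSum, ← finsum_add_distrib (Set.toFinite _) (Set.toFinite _),
    ← finsum_add_distrib (Set.toFinite _) (Set.toFinite _)]
  exact (finsum_congr fun π => el_ihx 𝕜 _ _ _).trans finsum_zero

/-- Rearranging one part of a disjoint union. -/
def unionRearrange (D E : JDiag X) (ρ : Equiv.Perm D.H) (hρ : ∀ h, D.mark (ρ h) = D.mark h)
    (hρ' : ∀ h, (D.union E).mark (Equiv.Perm.sumCongr ρ 1 h) = (D.union E).mark h) :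
    Iso ((D.rearrange ρ hρ).union E) ((D.union E).rearrange (Equiv.Perm.sumCongr ρ 1) hρ') where
  e := Equiv.refl _
  σ_comm := by rintro (h | h) <;> rfl
  τ_comm := by rintro (h | h) <;> rfl
  mark_comm := by rintro (h | h) <;> rfl

theorem sumCongr_pswap {α β : Type*} (a b : α) :
    Equiv.Perm.sumCongr (pswap a b) (1 : Equiv.Perm β) = pswap (Sum.inl a) (Sum.inl b) := by
  classical
  rw [pswap_eq, pswap_eq, Equiv.Perm.sumCongr_swap_one]

theorem IsTri.inl {D : JDiag X} {h : D.H} (ht : D.IsTri h) (E : JDiag X) :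
    (D.union E).IsTri (Sum.inl h) :=
  ⟨fun e => ht.1 (Sum.inl_injective e), fun e => ht.2 (Sum.inl_injective e)⟩

theorem IsIHXEdge.inl {D : JDiag X} {h : D.H} (hh : D.IsIHXEdge h) (E : JDiag X) :
    (D.union E).IsIHXEdge (Sum.inl h) where
  tri := hh.tri.inl E
  tri' := hh.tri'.inl E
  ne₁ := fun e => hh.ne₁ (Sum.inl_injective e)
  ne₂ := fun e => hh.ne₂ (Sum.inl_injective e)

theorem sumCongr_ihxPerm (D E : JDiag X) (h : D.H) :
    Equiv.Perm.sumCongr (D.ihxPerm h) (1 : Equiv.Perm E.H) =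
      (D.union E).ihxPerm (Sum.inl h) := by
  have : Equiv.Perm.sumCongr (D.ihxPerm h) (1 : Equiv.Perm E.H) =
      Equiv.Perm.sumCongr (pswap (D.σ h) (D.σ (D.σ h))) 1 *
        Equiv.Perm.sumCongr (pswap (D.σ (D.σ h)) (D.σ (D.τ h))) 1 := by
    rw [Equiv.Perm.sumCongr_mul, mul_one, ihxPerm]
  rw [this, sumCongr_pswap, sumCongr_pswap]
  rfl

theorem unionRearrange_eq (D E : JDiag X) (ρ : Equiv.Perm D.H) (hρ : ∀ h, D.mark (ρ h) = D.mark h)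
    (ρ' : Equiv.Perm (D.union E).H) (hρ' : ∀ h, (D.union E).mark (ρ' h) = (D.union E).mark h)
    (e : Equiv.Perm.sumCongr ρ 1 = ρ') :
    ∃ i : Iso ((D.rearrange ρ hρ).union E) ((D.union E).rearrange ρ' hρ'), i.e = Equiv.refl _ := by
  subst e
  exact ⟨unionRearrange D E ρ hρ hρ', rfl⟩

theorem union_flip (D E : JDiag X) (h : D.H) (ht : D.IsTri h) :
    ∃ i : Iso ((D.flip h ht).union E) ((D.union E).flip (Sum.inl h) (ht.inl E)),
      i.e = Equiv.refl _ :=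
  unionRearrange_eq D E _ _ _ _ (sumCongr_pswap _ _)

theorem union_ihx₁ (D E : JDiag X) (h : D.H) (hh : D.IsIHXEdge h) :
    ∃ i : Iso ((D.ihx₁ h hh).union E) ((D.union E).ihx₁ (Sum.inl h) (hh.inl E)),
      i.e = Equiv.refl _ :=
  unionRearrange_eq D E _ _ _ _ (sumCongr_ihxPerm D E h)

theorem union_ihx₂ (D E : JDiag X) (h : D.H) (hh : D.IsIHXEdge h) :
    ∃ i : Iso ((D.ihx₂ h hh).union E) ((D.union E).ihx₂ (Sum.inl h) (hh.inl E)),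
      i.e = Equiv.refl _ := by
  refine unionRearrange_eq D E _ _ _ _ ?_
  have : Equiv.Perm.sumCongr (D.ihxPerm h * D.ihxPerm h) (1 : Equiv.Perm E.H) =
      Equiv.Perm.sumCongr (D.ihxPerm h) 1 * Equiv.Perm.sumCongr (D.ihxPerm h) 1 := by
    rw [Equiv.Perm.sumCongr_mul, mul_one]
  rw [this, sumCongr_ihxPerm]
  rfl

/-- `π` respects the marks and exchanges the two sides given by `s`. -/
def Exchanges (D : JDiag X) (s : D.H → Bool) (π : Equiv.Perm D.H) : Prop :=
  ∀ h, D.IsLeg h → D.mark (π h) = D.mark h ∧ s (π h) = !s h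

theorem exchanges_iso {D E : JDiag X} (i : Iso D E) (s : D.H → Bool) (t : E.H → Bool) (b : Bool)
    (hst : ∀ h, t (i.e h) = (b ^^ s h)) (π : Equiv.Perm D.H) :
    D.Exchanges s π ↔ E.Exchanges t (i.e.permCongr π) := by
  unfold Exchanges
  rw [← i.e.forall_congr_right]
  refine forall_congr' fun h => ?_
  simp only [IsLeg, Equiv.permCongr_apply, Equiv.symm_apply_apply, i.mark_comm, hst]
  cases b <;> simp

theorem glueSum_iso {D D' E E' : JDiag X} (i : Iso (D.union E) (D'.union E')) (b : Bool)
    (hi : ∀ h : D.H ⊕ E.H, Sum.isLeft (i.e h) = (b ^^ Sum.isLeft h)) :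
    glueSum 𝕜 D E = glueSum 𝕜 D' E' :=
  closeSum_iso 𝕜 i (exchanges_iso i Sum.isLeft Sum.isLeft b hi)

theorem glueSum_comm (D E : JDiag X) : glueSum 𝕜 D E = glueSum 𝕜 E D :=
  glueSum_iso 𝕜 (unionComm D E) true (by rintro (h | h) <;> rfl)

theorem glueSum_subdiv (D E : JDiag X) (k : D.H) :
    glueSum 𝕜 D E = glueSum 𝕜 (D.subdiv k) E := by
  let s : (D.H ⊕ E.H) ⊕ Bool → Bool := Sum.elim Sum.isLeft (fun _ => true)
  have h1 : glueSum 𝕜 D E =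
      closeSum 𝕜 ((D.union E).subdiv (Sum.inl k)) (Exchanges _ s) := by
    refine closeSum_subdiv 𝕜 (D.union E) (Sum.inl k) fun π => ?_
    constructor
    · rintro h (x | x) hx
      · exact h x hx
      · exact absurd hx (by simp [IsLeg, subdiv])
    · exact fun h x hx => h (Sum.inl x) hx
  rw [h1]
  exact (closeSum_iso 𝕜 (unionSubdiv D E k) (exchanges_iso (unionSubdiv D E k) Sum.isLeft s false
    (by rintro ((h | h) | h) <;> rfl))).symm

theorem glueSum_step {D D' : JDiag X} (s : Step D D') (E : JDiag X) :
    glueSum 𝕜 D E = glueSum 𝕜 D' E := by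
  cases s with
  | iso i => exact glueSum_iso 𝕜 (i.unionLeft E) false (by rintro (h | h) <;> rfl)
  | subdiv k => exact glueSum_subdiv 𝕜 D E k

theorem glueSum_flip (D E : JDiag X) (h : D.H) (ht : D.IsTri h) :
    glueSum 𝕜 D E + glueSum 𝕜 (D.flip h ht) E = 0 := by
  obtain ⟨i, hi⟩ := union_flip D E h ht
  have e : glueSum 𝕜 (D.flip h ht) E =
      closeSum 𝕜 ((D.union E).flip (Sum.inl h) (ht.inl E)) (IsGluing D E) :=
    closeSum_iso 𝕜 i (fun π => by rw [hi]; rfl)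
  rw [e]
  exact closeSum_flip 𝕜 (D.union E) (Sum.inl h) (ht.inl E) _

theorem glueSum_ihx (D E : JDiag X) (h : D.H) (hh : D.IsIHXEdge h) :
    glueSum 𝕜 D E + glueSum 𝕜 (D.ihx₁ h hh) E + glueSum 𝕜 (D.ihx₂ h hh) E = 0 := by
  obtain ⟨i₁, hi₁⟩ := union_ihx₁ D E h hh
  obtain ⟨i₂, hi₂⟩ := union_ihx₂ D E h hh
  have e₁ : glueSum 𝕜 (D.ihx₁ h hh) E =
      closeSum 𝕜 ((D.union E).ihx₁ (Sum.inl h) (hh.inl E)) (IsGluing D E) :=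
    closeSum_iso 𝕜 i₁ (fun π => by rw [hi₁]; rfl)
  have e₂ : glueSum 𝕜 (D.ihx₂ h hh) E =
      closeSum 𝕜 ((D.union E).ihx₂ (Sum.inl h) (hh.inl E)) (IsGluing D E) :=
    closeSum_iso 𝕜 i₂ (fun π => by rw [hi₂]; rfl)
  rw [e₁, e₂]
  exact closeSum_ihx 𝕜 (D.union E) (Sum.inl h) (hh.inl E) _

/-- The gluing sum on homeomorphism classes. -/
def glueCls : Cls X → Cls X → Space 𝕜 Empty :=
  Quot.lift₂ (glueSum 𝕜)
    (fun D E E' s => by rw [glueSum_comm 𝕜 D E, glueSum_comm 𝕜 D E', glueSum_step 𝕜 s])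
    (fun _ _ E s => glueSum_step 𝕜 s E)

theorem glueCls_comm (a b : Cls X) : glueCls 𝕜 a b = glueCls 𝕜 b a := by
  rcases a with ⟨D⟩
  rcases b with ⟨E⟩
  exact glueSum_comm 𝕜 D E

/-- The linear extension of a function on homeomorphism classes. -/
def extend {N : Type*} [AddCommGroup N] [Module 𝕜 N] (f : Cls X → N) :
    MonoidAlgebra 𝕜 (Cls X) →ₗ[𝕜] N :=
  Finsupp.linearCombination 𝕜 f ∘ₗ (MonoidAlgebra.coeffLinearEquiv 𝕜).toLinearMap

theorem extend_single {N : Type*} [AddCommGroup N] [Module 𝕜 N] (f : Cls X → N) (c : Cls X)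
    (a : 𝕜) : extend 𝕜 f (MonoidAlgebra.single c a) = a • f c := by
  simp [extend]

theorem extend_comp {N N' : Type*} [AddCommGroup N] [Module 𝕜 N] [AddCommGroup N'] [Module 𝕜 N']
    (g : N →ₗ[𝕜] N') (f : Cls X → N) (r : MonoidAlgebra 𝕜 (Cls X)) :
    g (extend 𝕜 f r) = extend 𝕜 (fun c => g (f c)) r := by
  induction r using MonoidAlgebra.induction_linear with
  | zero => simp
  | add a b ha hb => rw [map_add, map_add, map_add, ha, hb]
  | single c k => rw [extend_single, extend_single, map_smul]

theorem single_mul_relator {r : MonoidAlgebra 𝕜 (Cls X)} (hr : IsRelator 𝕜 r) (c : Cls X) :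
    IsRelator 𝕜 (MonoidAlgebra.single c 1 * r) := by
  rcases c with ⟨E⟩
  change IsRelator 𝕜 (MonoidAlgebra.single (cls E) 1 * r)
  rw [mul_comm]
  cases hr with
  | as D h ht =>
    obtain ⟨i, -⟩ := union_flip D E h ht
    rw [add_mul, MonoidAlgebra.single_mul_single, MonoidAlgebra.single_mul_single, one_mul,
      cls_mul, cls_mul, cls_iso i]
    exact IsRelator.as (D.union E) (Sum.inl h) (ht.inl E)
  | ihx D h hh =>
    obtain ⟨i₁, -⟩ := union_ihx₁ D E h hh
    obtain ⟨i₂, -⟩ := union_ihx₂ D E h hh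
    rw [add_mul, add_mul, MonoidAlgebra.single_mul_single, MonoidAlgebra.single_mul_single,
      MonoidAlgebra.single_mul_single, one_mul, cls_mul, cls_mul, cls_mul, cls_iso i₁, cls_iso i₂]
    exact IsRelator.ihx (D.union E) (Sum.inl h) (hh.inl E)

theorem kills_ideal {N : Type*} [AddCommGroup N] [Module 𝕜 N]
    (f : MonoidAlgebra 𝕜 (Cls X) →ₗ[𝕜] N) (hf : ∀ r, IsRelator 𝕜 r → f r = 0) :
    (Ideal.span {r : MonoidAlgebra 𝕜 (Cls X) | IsRelator 𝕜 r}).restrictScalars 𝕜 ≤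
      LinearMap.ker f := by
  intro x hx
  rw [Submodule.restrictScalars_mem] at hx
  have key : ∀ a : MonoidAlgebra 𝕜 (Cls X), f (a * x) = 0 := by
    induction hx using Submodule.span_induction with
    | mem r hr =>
      intro a
      induction a using MonoidAlgebra.induction_linear with
      | zero => simp
      | add a b ha hb => rw [add_mul, map_add, ha, hb, add_zero]
      | single c k =>
        have : MonoidAlgebra.single c k = k • MonoidAlgebra.single c (1 : 𝕜) := by simp
        rw [this, smul_mul_assoc, map_smul, hf _ (single_mul_relator 𝕜 hr c), smul_zero]
    | zero => simp
    | add x y _ _ hx hy => intro a; rw [mul_add, map_add, hx, hy, add_zero]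
    | smul b x _ hx => intro a; rw [smul_eq_mul, ← mul_assoc, hx]
  simpa using key 1

/-- A function on homeomorphism classes that respects `AS` and `IHX`, on the quotient. -/
def descend {N : Type*} [AddCommGroup N] [Module 𝕜 N] (f : Cls X → N)
    (hf : ∀ r, IsRelator 𝕜 r → extend 𝕜 f r = 0) : Space 𝕜 X →ₗ[𝕜] N :=
  ((Ideal.span {r : MonoidAlgebra 𝕜 (Cls X) | IsRelator 𝕜 r}).restrictScalars 𝕜).liftQ
    (extend 𝕜 f) (kills_ideal 𝕜 _ hf) ∘ₗ
    (Submodule.Quotient.restrictScalarsEquiv 𝕜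
      (Ideal.span {r : MonoidAlgebra 𝕜 (Cls X) | IsRelator 𝕜 r})).symm.toLinearMap

theorem descend_el {N : Type*} [AddCommGroup N] [Module 𝕜 N] (f : Cls X → N)
    (hf : ∀ r, IsRelator 𝕜 r → extend 𝕜 f r = 0) (D : JDiag X) :
    descend 𝕜 f hf (el 𝕜 D) = f (cls D) := by
  refine Eq.trans ?_ ((extend_single 𝕜 f (cls D) 1).trans (one_smul _ _))
  rfl

theorem glueCls_relator (c : Cls X) (r : MonoidAlgebra 𝕜 (Cls X)) (hr : IsRelator 𝕜 r) :
    extend 𝕜 (fun d => glueCls 𝕜 d c) r = 0 := by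
  rcases c with ⟨E⟩
  cases hr with
  | as D h ht =>
    rw [map_add, extend_single, extend_single, one_smul, one_smul]
    exact glueSum_flip 𝕜 D E h ht
  | ihx D h hh =>
    rw [map_add, map_add, extend_single, extend_single, extend_single, one_smul, one_smul, one_smul]
    exact glueSum_ihx 𝕜 D E h hh

/-- Gluing with the fixed class `c`, as a linear map. -/
def glueRight (c : Cls X) : Space 𝕜 X →ₗ[𝕜] Space 𝕜 Empty :=
  descend 𝕜 (fun d => glueCls 𝕜 d c) (glueCls_relator 𝕜 c)

theorem space_hom_ext {N : Type*} [AddCommGroup N] [Module 𝕜 N] {f g : Space 𝕜 X →ₗ[𝕜] N}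
    (h : ∀ D, f (el 𝕜 D) = g (el 𝕜 D)) : f = g := by
  refine LinearMap.ext fun x => ?_
  obtain ⟨x, rfl⟩ := Ideal.Quotient.mk_surjective x
  induction x using MonoidAlgebra.induction_linear with
  | zero => simp
  | add a b ha hb => rw [map_add, map_add, map_add, ha, hb]
  | single c k =>
    rcases c with ⟨D⟩
    have e : Ideal.Quotient.mk (Ideal.span {r : MonoidAlgebra 𝕜 (Cls X) | IsRelator 𝕜 r})
        (MonoidAlgebra.single (cls D) k) = k • el 𝕜 D := by
      rw [el, ← Ideal.Quotient.mkₐ_eq_mk 𝕜, ← map_smul]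
      simp
    change f (Ideal.Quotient.mk _ (MonoidAlgebra.single (cls D) k)) =
      g (Ideal.Quotient.mk _ (MonoidAlgebra.single (cls D) k))
    rw [e, map_smul, map_smul, h]

/-- The bilinear gluing pairing `⟨A, B⟩_X`: the sum of all ways of gluing all the `x`-marked legs of
`A` to all the `x`-marked legs of `B`, for every `x` in `X`. -/
def pairing : Space 𝕜 X →ₗ[𝕜] Space 𝕜 X →ₗ[𝕜] Space 𝕜 Empty :=
  descend 𝕜 (glueRight 𝕜) fun r hr => by
    refine space_hom_ext 𝕜 fun E => ?_
    refine Eq.trans ?_ (glueCls_relator 𝕜 (cls E) r hr)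
    refine (extend_comp 𝕜 (LinearMap.applyₗ (el 𝕜 E)) (glueRight 𝕜) r).trans ?_
    refine congrArg (fun f => extend 𝕜 f r) (funext fun c => ?_)
    exact (descend_el 𝕜 _ (glueCls_relator 𝕜 c) E).trans (glueCls_comm 𝕜 _ _)

theorem pairing_el (D E : JDiag X) : pairing 𝕜 (el 𝕜 D) (el 𝕜 E) = glueSum 𝕜 D E := by
  rw [pairing, descend_el, glueRight, descend_el]
  exact glueSum_comm 𝕜 E D

/-- The span of the diagrams of degree `d` that have the property `p`.  The completed graded space of
such diagrams is the product of these spans over all `d`; its elements are written as the power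
series whose `d`-th coefficient is the part of degree `d`. -/
def piece (p : JDiag X → Prop) (d : ℕ) : Submodule 𝕜 (Space 𝕜 X) :=
  Submodule.span 𝕜 {a | ∃ D : JDiag X, p D ∧ D.degree = d ∧ a = el 𝕜 D}

/-- `P` is an element of `𝓑⁺(X)`, the completed space spanned by the strutless diagrams. -/
def IsStrutlessSeries (P : PowerSeries (Space 𝕜 X)) : Prop :=
  ∀ d, PowerSeries.coeff d P ∈ piece 𝕜 Strutless d

/-- `𝓐_d(∅)`: the degree `d` part of the space of manifold diagrams (no closed circles). -/
def manifoldPiece (d : ℕ) : Submodule 𝕜 (Space 𝕜 Empty) := piece 𝕜 CircleFree d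

/-- `𝓐_{≤m}(∅)`: manifold diagrams of degree at most `m`. -/
def manifoldLE (m : ℕ) : Submodule 𝕜 (Space 𝕜 Empty) :=
  Submodule.span 𝕜 {a | ∃ D : JDiag Empty, D.CircleFree ∧ D.degree ≤ m ∧ a = el 𝕜 D}

/-- `𝓐°_{≤m}(∅)`: closed diagrams of degree at most `m`, closed circles allowed. -/
def closedLE (m : ℕ) : Submodule 𝕜 (Space 𝕜 Empty) :=
  Submodule.span 𝕜 {a | ∃ D : JDiag Empty, D.degree ≤ m ∧ a = el 𝕜 D}

/-- The relations `O_m` (a closed circle equals `-2m`) and `P_{m+1}` (the sum of all ways of pairing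
up `2m+2` stubs is zero). -/
def idealOP (m : ℕ) : Ideal (Space 𝕜 Empty) :=
  Ideal.span ({el 𝕜 (circle Empty) + 2 * (m : Space 𝕜 Empty)} ∪
    {a | ∃ D : JDiag Unit, D.numLegs = 2 * m + 2 ∧ a = closeSum 𝕜 D (fun _ => True)})

/-- `½ ∑_{x,y} c_{xy} strut_{xy}`. -/
def halfForm [Fintype X] (c : Matrix X X 𝕜) : Space 𝕜 X :=
  (1 / 2 : 𝕜) • ∑ x, ∑ y, c x y • el 𝕜 (strut x y)

/-- `exp (½ ∑_{x,y} c_{xy} strut_{xy})`; its part of degree `k` consists of `k` struts. -/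
def gaussian [Fintype X] (c : Matrix X X 𝕜) : PowerSeries (Space 𝕜 X) :=
  PowerSeries.mk fun k => (k.factorial : 𝕜)⁻¹ • halfForm 𝕜 c ^ k

/-- The pairing `⟨F, G⟩_X` of a series `F` of products of struts with a series `G`, as a series.
Gluing `k` struts, which have `2k` legs, to a diagram of degree `d + k` gives degree `d`. -/
def strutPairing (F G : PowerSeries (Space 𝕜 X)) : PowerSeries (Space 𝕜 Empty) :=
  PowerSeries.mk fun d =>
    ∑ᶠ k : ℕ, pairing 𝕜 (PowerSeries.coeff k F) (PowerSeries.coeff (d + k) G)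

/-- `∏_x (1/m!) (½ strut_{xx})^m`, a combination of diagrams with `m |X|` struts. -/
def negKernel [Fintype X] (m : ℕ) : PowerSeries (Space 𝕜 X) :=
  PowerSeries.monomial (m * Fintype.card X)
    (∏ x : X, (m.factorial : 𝕜)⁻¹ • ((1 / 2 : 𝕜) • el 𝕜 (strut x x)) ^ m)

/-- The negative-dimensional formal integral
`∫^{(m)} G dX = ⟨∏_x (1/m!) (½ strut_{xx})^m, G⟩_X` in `𝓐°(∅)/(O_m, P_{m+1})`. -/
def negIntegral [Fintype X] (m : ℕ) (G : PowerSeries (Space 𝕜 X)) :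
    PowerSeries (Space 𝕜 Empty ⧸ idealOP 𝕜 m) :=
  PowerSeries.map (Ideal.Quotient.mk (idealOP 𝕜 m)) (strutPairing 𝕜 (negKernel 𝕜 m) G)

/-- `G = P · exp (½ ∑ Λ_{xy} strut_{xy})` is a perturbed non-degenerate Gaussian with quadratic
form `Λ` and perturbation `P`. -/
structure IsPerturbedGaussian [Fintype X] [DecidableEq X] (Λ : Matrix X X 𝕜)
    (P G : PowerSeries (Space 𝕜 X)) : Prop where
  symm : Λ.IsSymm
  nondegenerate : IsUnit Λ
  strutless : IsStrutlessSeries 𝕜 P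
  eq_mul : G = P * gaussian 𝕜 Λ

/-- The formal Gaussian integral `∫^{FG} G dX = ⟨exp (-½ ∑ (Λ⁻¹)_{xy} strut_{xy}), P⟩_X` of the
perturbed Gaussian `G = P · exp (½ ∑ Λ_{xy} strut_{xy})`. -/
def formalGaussianIntegral [Fintype X] [DecidableEq X] (Λ : Matrix X X 𝕜)
    (P : PowerSeries (Space 𝕜 X)) : PowerSeries (Space 𝕜 Empty) :=
  strutPairing 𝕜 (gaussian 𝕜 (-Λ⁻¹)) P

end JDiag

end

/-! ### Partial gluings of legs, and why they respect `AS` and `IHX`. -/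

noncomputable section

namespace JDiag

universe v

variable {X : Type u} {Y : Type v}

/-! The proof imitates Gaussian integration by parts, with the pairing in the role of the integral.
Under the pairing, multiplication by the strut with ends a, b is adjoint to the second order
operator `opD`, which joins a leg marked a to a leg marked b (`pairing_mul_st`). The derivation
`opE` a b, which changes one mark a into b, is adjoint to `opE` b a (`pairing_opE`). Write s_ab for
the strut and I for the functional ⟨∏ s_xx^m, ·⟩ with values in the quotient (`negForm`). Up to
nonzero factors, P_{m+1} makes every ⟨s_aa^(m+1), y⟩ vanish there. Applying `opE` polarizes this to
s_aa^m s_ab, so I vanishes on the image of every `opD` (`negForm_opD`): integrals of derivatives are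
zero.

Let Q = ½ ∑ l_xy s_xy, let Δ = ∑ l^xy `opD` x y, and let N = m|X|. Then [Δ, Q] = |X|·circle +
2·(number of legs), an sl₂ relation (`opG_halfForm_mul`). Under I a circle counts as −2m, and only
diagrams with 2N legs survive. Hence I(Q^(j+1) Δx) = −2(j+1)(N−j) I(Q^j x) (`negForm_pow_mul_opG`).
For j = N only the legless part of x contributes. Descending from there, I(Q^j x)/j! equals
I(Q^N)/N! times ⟨(−½ ∑ l^xy s_xy)^k/k!, x⟩ whenever j + k = N (`negForm_pow_mul_eq`). Summed over
the homogeneous parts of P this is the formal Gaussian integral times I(Q^N)/N!. Its terms with k >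
N are annihilated by that factor, because they contain a Δ that can be moved back under I
(`negForm_mul_pairing_eq_zero`).

The constant I(Q^N) is found by deforming the identity matrix to Λ along 1 + t(Λ − 1). Integration
by parts shows that its logarithmic derivative is m times that of the determinant, so it equals (det
Λ)^m times its value at the identity matrix. That value comes from the multinomial theorem and ⟨s^m,
s^m⟩ = (−4)^m (m!)², one factor for each element of X (`negForm_halfForm_pow`).

For the isomorphism in degrees at most m, surjectivity is the replacement of circles by −2m
(`exists_normal_form`). Injectivity uses the linear map `trunc`, which evaluates circles at −2m and
discards degrees above m. It is the identity on circle-free diagrams of degree at most m, and it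
kills both families of relations (`trunc_eq_zero_of_mem`). For P_{m+1}, a strut among the stubs
produces the factor circle + 2m. Two stubs at one vertex give 0 by antisymmetry. In the remaining
case every stub has its own trivalent vertex, so the glued diagram has degree above m.

Finally, no closed circle arises in the formal Gaussian integral, since each strut is glued to
components that have a trivalent vertex (`close_circleFree`). Its sum is finite in each degree
because a strutless diagram has at most three legs per trivalent vertex (`Strutless.numLegs_le`). -/

instance (D : JDiag X) : Finite D.H := D.fin

/-- The data of a partial gluing of legs and of new marks for the remaining legs. -/
structure Mod (D : JDiag X) (Y : Type v) where
  π : Equiv.Perm D.H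
  ν : D.H → Option Y
  invol : ∀ h, π (π h) = h
  supp : ∀ h, π h ≠ h → D.IsLeg h
  ν_iff : ∀ h, (ν h).isSome ↔ D.IsLeg h ∧ π h = h

theorem isLeg_iff {D : JDiag X} {h : D.H} : D.IsLeg h ↔ D.σ h = h := D.mark_iff h

theorem Mod.leg {D : JDiag X} (M : D.Mod Y) {h : D.H} (hl : D.IsLeg h) : D.IsLeg (M.π h) := by
  by_cases e : M.π h = h
  · rwa [e]
  · exact M.supp _ (by rw [M.invol]; exact fun e' => e e'.symm)

theorem Mod.fix {D : JDiag X} (M : D.Mod Y) {h : D.H} (hl : ¬ D.IsLeg h) : M.π h = h := by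
  by_contra e
  exact hl (M.supp _ e)

/-- The diagram obtained from a partial gluing with new marks: two glued legs become a subdivision
point. -/
def modify (D : JDiag X) (M : D.Mod Y) : JDiag Y where
  H := D.H
  fin := D.fin
  σ := D.σ * M.π
  τ := D.τ
  mark := M.ν
  τ_invol := D.τ_invol
  τ_ne := D.τ_ne
  valence := by
    intro h
    simp only [Equiv.Perm.mul_apply]
    by_cases hl : D.IsLeg h
    · left
      rw [isLeg_iff.1 (M.leg hl), M.invol, isLeg_iff.1 hl]
    · have e2 : ¬ D.IsLeg (D.σ h) := fun hc => hl (by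
        rw [isLeg_iff] at hc ⊢
        exact D.σ.injective hc)
      have e3 : ¬ D.IsLeg (D.σ (D.σ h)) := fun hc => e2 (by
        rw [isLeg_iff] at hc ⊢
        exact D.σ.injective hc)
      rw [M.fix hl, M.fix e2, M.fix e3]
      exact D.valence h
  mark_iff := by
    intro h
    rw [M.ν_iff, Equiv.Perm.mul_apply]
    constructor
    · rintro ⟨h1, h2⟩
      rw [h2, isLeg_iff.1 h1]
    · intro e
      by_cases hl : D.IsLeg h
      · refine ⟨hl, ?_⟩
        rwa [isLeg_iff.1 (M.leg hl)] at e
      · exact absurd (isLeg_iff.2 (by rwa [M.fix hl] at e)) hl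

/-- Isomorphic diagrams have isomorphic modifications. -/
def modifyIso {D E : JDiag X} (i : Iso D E) (M : D.Mod Y) (M' : E.Mod Y)
    (hπ : ∀ h, M'.π (i.e h) = i.e (M.π h)) (hν : ∀ h, M'.ν (i.e h) = M.ν h) :
    Iso (D.modify M) (E.modify M') where
  e := i.e
  σ_comm := fun h => (i.σ_comm (M.π h)).trans (congrArg E.σ (hπ h).symm)
  τ_comm := i.τ_comm
  mark_comm := hν

theorem Mod.subdiv_inr {D : JDiag X} {k : D.H} (M' : (D.subdiv k).Mod Y) (b : Bool) :
    M'.π (Sum.inr b) = Sum.inr b ∧ M'.ν (Sum.inr b) = none := by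
  have h : ¬ (D.subdiv k).IsLeg (Sum.inr b) := by simp [IsLeg, subdiv]
  refine ⟨M'.fix h, ?_⟩
  have := mt (M'.ν_iff (Sum.inr b)).1 (fun h' => h h'.1)
  simpa using this

/-- Modifications commute with subdivisions. -/
def modifySubdiv (D : JDiag X) (k : D.H) (M : D.Mod Y) (M' : (D.subdiv k).Mod Y)
    (hπ : ∀ h, M'.π (Sum.inl h) = Sum.inl (M.π h)) (hν : ∀ h, M'.ν (Sum.inl h) = M.ν h) :
    Iso ((D.subdiv k).modify M') ((D.modify M).subdiv k) where
  e := Equiv.refl _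
  σ_comm := by
    rintro (h | h)
    · exact congrArg (D.subdiv k).σ (hπ h)
    · exact congrArg (D.subdiv k).σ (M'.subdiv_inr h).1
  τ_comm := fun h => rfl
  mark_comm := by
    rintro (h | h)
    · exact (hν h).symm
    · exact (M'.subdiv_inr h).2.symm

/-- Gluings move legs only, so trivalent vertices stay as they are. This is what lets `AS` and `IHX`
pass through modifications. -/
theorem modify_σ {D : JDiag X} (M : D.Mod Y) {h : D.H} (ht : D.IsTri h) :
    (D.modify M).σ h = D.σ h := congrArg D.σ (M.fix ht.not_leg)

theorem modify_σσ {D : JDiag X} (M : D.Mod Y) {h : D.H} (ht : D.IsTri h) :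
    (D.modify M).σ ((D.modify M).σ h) = D.σ (D.σ h) :=
  (congrArg (D.modify M).σ (modify_σ M ht)).trans (modify_σ M ht.map)

theorem IsTri.modify {D : JDiag X} (M : D.Mod Y) {h : D.H} (ht : D.IsTri h) :
    (D.modify M).IsTri h :=
  ⟨fun hc => ht.1 ((modify_σ M ht).symm.trans hc), fun hc => ht.2 ((modify_σσ M ht).symm.trans hc)⟩

theorem IsIHXEdge.modify {D : JDiag X} (M : D.Mod Y) {h : D.H} (hh : D.IsIHXEdge h) :
    (D.modify M).IsIHXEdge h where
  tri := hh.tri.modify M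
  tri' := hh.tri'.modify M
  ne₁ := fun e => hh.ne₁ (e.trans (modify_σ M hh.tri))
  ne₂ := fun e => hh.ne₂ (e.trans (modify_σσ M hh.tri))

theorem modify_ihxPerm {D : JDiag X} (M : D.Mod Y) {h : D.H} (hh : D.IsIHXEdge h) :
    (D.modify M).ihxPerm h = D.ihxPerm h :=
  congrArg₂ (fun x y : Equiv.Perm D.H => x * y)
    (congrArg₂ pswap (modify_σ M hh.tri) (modify_σσ M hh.tri))
    (congrArg₂ pswap (modify_σσ M hh.tri) (modify_σ M hh.tri'))

/-- The two permutations have disjoint supports: the gluing moves legs, and ρ fixes them. -/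
theorem Mod.rearrange_comm {D : JDiag X} (M : D.Mod Y) {ρ : Equiv.Perm D.H}
    (hfix : ∀ h, D.IsLeg h → ρ h = h) (h : D.H) : ρ⁻¹ (M.π h) = M.π (ρ⁻¹ h) := by
  rw [Equiv.Perm.inv_eq_iff_eq]
  by_cases hl : D.IsLeg h
  · have h2 : ρ⁻¹ h = h := by rw [Equiv.Perm.inv_eq_iff_eq, hfix h hl]
    rw [h2, hfix _ (M.leg hl)]
  · obtain ⟨k, rfl⟩ := ρ.surjective h
    have h1 : ¬ D.IsLeg k := fun hc => hl (by rwa [hfix _ hc])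
    rw [M.fix hl, Equiv.Perm.coe_inv, Equiv.symm_apply_apply, M.fix h1]

/-- Modifications commute with rearrangements. -/
def modifyRearrange (D : JDiag X) (ρ : Equiv.Perm D.H) (hρ : ∀ h, D.mark (ρ h) = D.mark h)
    (hfix : ∀ h, D.IsLeg h → ρ h = h) (M : D.Mod Y) (M' : (D.rearrange ρ hρ).Mod Y)
    (hπ : ∀ h : D.H, M'.π h = M.π h) (hν : ∀ h : D.H, M'.ν h = M.ν h)
    (ρ' : Equiv.Perm (D.modify M).H) (hρ' : ∀ h, (D.modify M).mark (ρ' h) = (D.modify M).mark h)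
    (e : ρ' = ρ) :
    Iso ((D.rearrange ρ hρ).modify M') ((D.modify M).rearrange ρ' hρ') where
  e := Equiv.refl _
  σ_comm := by
    subst e
    intro h
    exact (congrArg (fun x => ρ' (D.σ (ρ'⁻¹ x))) (hπ h)).trans
      (congrArg (fun x => ρ' (D.σ x)) (M.rearrange_comm hfix h))
  τ_comm := fun h => rfl
  mark_comm := fun h => (hν h).symm

/-- An injective map of half-edges that is a mark-preserving bijection on the legs. -/
structure LegMap (D E : JDiag X) where
  j : D.H → E.H
  inj : Function.Injective j
  mark_eq : ∀ h, E.mark (j h) = D.mark h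
  exists_eq : ∀ h', E.IsLeg h' → ∃ h, j h = h'

/-- The leg map of an isomorphism. -/
def Iso.legMap {D E : JDiag X} (i : Iso D E) : LegMap D E :=
  ⟨i.e, i.e.injective, i.mark_comm, fun h' _ => i.e.surjective h'⟩

/-- The leg map of a subdivision. -/
def subdivLegMap (D : JDiag X) (k : D.H) : LegMap D (D.subdiv k) where
  j := Sum.inl
  inj := Sum.inl_injective
  mark_eq := fun h => rfl
  exists_eq := by
    rintro (h | b) hl
    · exact ⟨h, rfl⟩
    · simp [IsLeg, subdiv] at hl

/-- The leg map of a rearrangement. -/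
def rearrangeLegMap (D : JDiag X) (ρ : Equiv.Perm D.H) (hρ : ∀ h, D.mark (ρ h) = D.mark h) :
    LegMap D (D.rearrange ρ hρ) :=
  ⟨fun h => h, fun _ _ h => h, fun _ => rfl, fun h _ => ⟨h, rfl⟩⟩

/-- `M'` is the image of `M` under the leg map `j`. -/
def Mod.Compat {D E : JDiag X} (j : LegMap D E) (M : D.Mod Y) (M' : E.Mod Y) : Prop :=
  ∀ h, M'.π (j.j h) = j.j (M.π h) ∧ M'.ν (j.j h) = M.ν h

variable (𝕜 : Type*) [Field 𝕜]

theorem flip_modify (D : JDiag X) (h : D.H) (ht : D.IsTri h) (M : D.Mod Y)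
    (M' : (D.flip h ht).Mod Y) (hM : M.Compat (rearrangeLegMap D _ _) M') :
    el 𝕜 (D.modify M) + el 𝕜 ((D.flip h ht).modify M') = 0 := by
  rw [← el_flip 𝕜 (D.modify M) h (ht.modify M)]
  congr 1
  refine el_iso 𝕜 (modifyRearrange D _ _ (pswap_fix ht.map ht.map.map) M M'
    (fun h => (hM h).1) (fun h => (hM h).2) _ _ ?_)
  exact congrArg₂ pswap (modify_σ M ht) (modify_σσ M ht)

theorem ihx_modify (D : JDiag X) (h : D.H) (hh : D.IsIHXEdge h) (M : D.Mod Y)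
    (M₁ : (D.ihx₁ h hh).Mod Y) (h₁ : M.Compat (rearrangeLegMap D _ _) M₁)
    (M₂ : (D.ihx₂ h hh).Mod Y) (h₂ : M.Compat (rearrangeLegMap D _ _) M₂) :
    el 𝕜 (D.modify M) + el 𝕜 ((D.ihx₁ h hh).modify M₁) +
      el 𝕜 ((D.ihx₂ h hh).modify M₂) = 0 := by
  rw [← el_ihx 𝕜 (D.modify M) h (hh.modify M)]
  congr 1
  · congr 1
    exact el_iso 𝕜 (modifyRearrange D _ _ (ihxPerm_fix hh) M M₁
      (fun h => (h₁ h).1) (fun h => (h₁ h).2) _ _ (modify_ihxPerm M hh))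
  · refine el_iso 𝕜 (modifyRearrange D _ _ (fun k hl => ?_) M M₂
      (fun h => (h₂ h).1) (fun h => (h₂ h).2) _ _ ?_)
    · rw [Equiv.Perm.mul_apply, ihxPerm_fix hh k hl, ihxPerm_fix hh k hl]
    · exact congrArg (fun x : Equiv.Perm D.H => x * x) (modify_ihxPerm M hh)

/-- A natural family of modifications gives a linear map. -/
theorem exists_linearMap_of_family (I : JDiag X → Type) [∀ D, Finite (I D)]
    (M : ∀ D, I D → D.Mod Y)
    (nat : ∀ D E (j : LegMap D E), ∃ f : I D → I E, Function.Bijective f ∧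
      ∀ x, (M D x).Compat j (M E (f x))) :
    ∃ Φ : Space 𝕜 X →ₗ[𝕜] Space 𝕜 Y, ∀ D, Φ (el 𝕜 D) = ∑ᶠ x : I D, el 𝕜 (D.modify (M D x)) := by
  let F : Cls X → Space 𝕜 Y :=
    Quot.lift (fun D => ∑ᶠ x : I D, el 𝕜 (D.modify (M D x))) (by
      intro D E s
      cases s with
      | iso i =>
        obtain ⟨f, hf, hc⟩ := nat D E i.legMap
        exact finsum_eq_of_bijective f hf fun x =>
          el_iso 𝕜 (modifyIso i _ _ (fun h => (hc x h).1) (fun h => (hc x h).2))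
      | subdiv k =>
        obtain ⟨f, hf, hc⟩ := nat D _ (subdivLegMap D k)
        refine finsum_eq_of_bijective f hf fun x => ?_
        exact ((el_iso 𝕜 (modifySubdiv D k (M D x) (M _ (f x)) (fun h => (hc x h).1)
          (fun h => (hc x h).2))).trans (el_subdiv 𝕜 (D.modify (M D x)) k)).symm)
  -- All diagrams of a relator share their half-edges and legs. Naturality under the rearrangement
  -- leg maps therefore matches their index sets, and the relation holds term by term.
  have hF : ∀ r, IsRelator 𝕜 r → extend 𝕜 F r = 0 := by
    intro r hr
    cases hr with
    | as D h ht =>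
      rw [map_add, extend_single, extend_single, one_smul, one_smul]
      change (∑ᶠ x : I D, el 𝕜 (D.modify (M D x))) +
        ∑ᶠ x : I (D.flip h ht), el 𝕜 ((D.flip h ht).modify (M _ x)) = 0
      obtain ⟨f, hf, hc⟩ := nat D _ (rearrangeLegMap D _
        (D.mark_pswap ht.map.mark_eq ht.map.map.mark_eq))
      have e := finsum_eq_of_bijective (f := fun x => el 𝕜 ((D.flip h ht).modify (M _ (f x))))
        (g := fun x => el 𝕜 ((D.flip h ht).modify (M _ x))) f hf fun x => rfl
      rw [← e,
        ← finsum_add_distrib (Set.toFinite _) (Set.toFinite _)]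
      exact (finsum_congr fun x => flip_modify 𝕜 D h ht _ _ (hc x)).trans finsum_zero
    | ihx D h hh =>
      rw [map_add, map_add, extend_single, extend_single, extend_single, one_smul, one_smul,
        one_smul]
      change (∑ᶠ x : I D, el 𝕜 (D.modify (M D x))) +
        (∑ᶠ x : I (D.ihx₁ h hh), el 𝕜 ((D.ihx₁ h hh).modify (M _ x))) +
        ∑ᶠ x : I (D.ihx₂ h hh), el 𝕜 ((D.ihx₂ h hh).modify (M _ x)) = 0
      obtain ⟨f₁, hf₁, hc₁⟩ := nat D _ (rearrangeLegMap D _ (D.ihx_mark hh.tri hh.tri'))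
      obtain ⟨f₂, hf₂, hc₂⟩ := nat D _ (rearrangeLegMap D (D.ihxPerm h * D.ihxPerm h)
        fun x => by
          rw [Equiv.Perm.mul_apply, D.ihx_mark hh.tri hh.tri', D.ihx_mark hh.tri hh.tri'])
      have e₁ := finsum_eq_of_bijective (f := fun x => el 𝕜 ((D.ihx₁ h hh).modify (M _ (f₁ x))))
        (g := fun x => el 𝕜 ((D.ihx₁ h hh).modify (M _ x))) f₁ hf₁ fun x => rfl
      have e₂ := finsum_eq_of_bijective (f := fun x => el 𝕜 ((D.ihx₂ h hh).modify (M _ (f₂ x))))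
        (g := fun x => el 𝕜 ((D.ihx₂ h hh).modify (M _ x))) f₂ hf₂ fun x => rfl
      rw [← e₁, ← e₂,
        ← finsum_add_distrib (Set.toFinite _) (Set.toFinite _),
        ← finsum_add_distrib (Set.toFinite _) (Set.toFinite _)]
      exact (finsum_congr fun x => ihx_modify 𝕜 D h hh _ _ (hc₁ x) _ (hc₂ x)).trans finsum_zero
  exact ⟨descend 𝕜 F hF, fun D => descend_el 𝕜 F hF D⟩

end JDiag

end

/-! ### Changing the mark of one leg and joining two legs. -/

noncomputable section

namespace JDiag

universe v

variable {X : Type u} {Y : Type v}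

theorem pswap_left {α : Type*} (a b : α) : pswap a b a = b := by
  classical
  rw [pswap_eq, Equiv.swap_apply_left]

theorem pswap_right {α : Type*} (a b : α) : pswap a b b = a := by
  classical
  rw [pswap_eq, Equiv.swap_apply_right]

theorem pswap_comm {α : Type*} (a b : α) : pswap a b = pswap b a := by
  classical
  rw [pswap_eq, pswap_eq, Equiv.swap_comm]

/-! ### Finite sums -/

theorem finsum_sumType {α β N : Type*} [Finite α] [Finite β] [AddCommMonoid N] (f : α ⊕ β → N) :
    ∑ᶠ x, f x = ∑ᶠ a, f (Sum.inl a) + ∑ᶠ b, f (Sum.inr b) := by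
  have := Fintype.ofFinite α
  have := Fintype.ofFinite β
  rw [finsum_eq_sum_of_fintype, finsum_eq_sum_of_fintype, finsum_eq_sum_of_fintype,
    Fintype.sum_sum_type]

theorem finsum_sigmaType {α N : Type*} {β : α → Type*} [Finite α] [∀ a, Finite (β a)]
    [AddCommMonoid N] (f : (Σ a, β a) → N) :
    ∑ᶠ x, f x = ∑ᶠ a, ∑ᶠ b, f ⟨a, b⟩ := by
  have := Fintype.ofFinite α
  have := fun a => Fintype.ofFinite (β a)
  simp only [finsum_eq_sum_of_fintype, Fintype.sum_sigma]

theorem finsum_prodType {α β N : Type*} [Finite α] [Finite β]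
    [AddCommMonoid N] (f : α → β → N) :
    ∑ᶠ x : α × β, f x.1 x.2 = ∑ᶠ a, ∑ᶠ b, f a b := by
  have := Fintype.ofFinite α
  have := Fintype.ofFinite β
  simp only [finsum_eq_sum_of_fintype, Fintype.sum_prod_type]

theorem finsum_swap {α β N : Type*} [Finite α] [Finite β]
    [AddCommMonoid N] (f : α → β → N) :
    ∑ᶠ a, ∑ᶠ b, f a b = ∑ᶠ b, ∑ᶠ a, f a b := by
  have := Fintype.ofFinite α
  have := Fintype.ofFinite β
  simp only [finsum_eq_sum_of_fintype]
  exact Finset.sum_comm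

theorem finsum_add' {α N : Type*} [Finite α] [AddCommMonoid N] (f g : α → N) :
    ∑ᶠ a, (f a + g a) = ∑ᶠ a, f a + ∑ᶠ a, g a :=
  finsum_add_distrib (Set.toFinite _) (Set.toFinite _)

theorem map_finsum' {α N N' F : Type*} [Finite α] [AddCommMonoid N] [AddCommMonoid N']
    [FunLike F N N'] [AddMonoidHomClass F N N'] (g : F) (f : α → N) :
    g (∑ᶠ a, f a) = ∑ᶠ a, g (f a) := by
  have := Fintype.ofFinite α
  simp only [finsum_eq_sum_of_fintype, map_sum]

theorem finsum_const' {α N : Type*} [Finite α] [AddCommMonoid N] (x : N) :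
    ∑ᶠ _ : α, x = Nat.card α • x := by
  have := Fintype.ofFinite α
  simp only [finsum_eq_sum_of_fintype, Finset.sum_const, Nat.card_eq_fintype_card, Finset.card_univ]

theorem finsum_subtype_dite {α N : Type*} [Finite α] [AddCommMonoid N] (p : α → Prop)
    (f : α → N) (hf : ∀ a, ¬ p a → f a = 0) :
    ∑ᶠ a : {a // p a}, f a.1 = ∑ᶠ a, f a := by
  rw [finsum_subtype_eq_finsum_cond]
  refine finsum_congr fun a => ?_
  by_cases h : p a
  · simp [h]
  · simp [h, hf a h]

/-! ### Legs with a given mark -/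

/-- The legs with mark `a`. -/
def Lg (D : JDiag X) (a : X) : Type := {h : D.H // D.mark h = some a}

instance (D : JDiag X) (a : X) : Finite (D.Lg a) := by
  unfold Lg
  infer_instance

theorem Lg.isLeg {D : JDiag X} {a : X} (ℓ : D.Lg a) : D.IsLeg ℓ.1 := by
  have := ℓ.2
  simp [IsLeg, this]

/-- The action of leg maps on the legs with a given mark. -/
def LegMap.lg {D E : JDiag X} (j : LegMap D E) (a : X) (ℓ : D.Lg a) : E.Lg a :=
  ⟨j.j ℓ.1, (j.mark_eq ℓ.1).trans ℓ.2⟩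

theorem LegMap.lg_bijective {D E : JDiag X} (j : LegMap D E) (a : X) :
    Function.Bijective (j.lg a) := by
  refine ⟨fun x y h => Subtype.ext (j.inj (congrArg Subtype.val h)), fun y => ?_⟩
  obtain ⟨h, hh⟩ := j.exists_eq y.1 y.isLeg
  refine ⟨⟨h, ?_⟩, Subtype.ext hh⟩
  rw [← j.mark_eq, hh]
  exact y.2

theorem finsum_lg_union {N : Type*} [AddCommMonoid N] (D E : JDiag X) (a : X)
    (f : (D.union E).H → N) :
    ∑ᶠ ℓ : (D.union E).Lg a, f ℓ.1 =
      ∑ᶠ ℓ : D.Lg a, f (Sum.inl ℓ.1) + ∑ᶠ ℓ : E.Lg a, f (Sum.inr ℓ.1) := by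
  let g : D.Lg a ⊕ E.Lg a → (D.union E).Lg a :=
    Sum.elim (fun ℓ => ⟨Sum.inl ℓ.1, ℓ.2⟩) (fun ℓ => ⟨Sum.inr ℓ.1, ℓ.2⟩)
  refine Eq.trans ?_ (finsum_sumType (fun x => f (g x).1))
  refine (finsum_eq_of_bijective g ⟨?_, ?_⟩ fun x => rfl).symm
  · rintro (x | x) (y | y) h
    · exact congrArg Sum.inl (Subtype.ext (Sum.inl_injective (congrArg Subtype.val h)))
    · exact absurd (congrArg Subtype.val h) Sum.inl_ne_inr
    · exact absurd (congrArg Subtype.val h) Sum.inr_ne_inl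
    · exact congrArg Sum.inr (Subtype.ext (Sum.inr_injective (congrArg Subtype.val h)))
  · rintro ⟨x | x, hx⟩
    · exact ⟨Sum.inl ⟨x, hx⟩, rfl⟩
    · exact ⟨Sum.inr ⟨x, hx⟩, rfl⟩

theorem finsum_ite_eq {α N : Type*} [Finite α] [AddCommMonoid N] (p : α → Prop)
    [DecidablePred p] (f : α → N) :
    ∑ᶠ a : {a // p a}, f a.1 = ∑ᶠ a, if p a then f a else 0 := by
  rw [← finsum_subtype_dite p (fun a => if p a then f a else 0) (fun a ha => if_neg ha)]
  exact finsum_congr fun a => (if_pos a.2).symm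

theorem finsum_lg_strut [DecidableEq X] {N : Type*} [AddCommMonoid N] (c d a : X)
    (f : Bool → N) :
    ∑ᶠ ℓ : (strut c d).Lg a, f ℓ.1 = (if c = a then f false else 0) + if d = a then f true else 0 := by
  have h1 : ∑ᶠ ℓ : (strut c d).Lg a, f ℓ.1 = ∑ᶠ b : Bool,
      if (if b then some d else some c) = some a then f b else 0 :=
    finsum_ite_eq (fun b : Bool => (if b then some d else some c) = some a) f
  rw [h1, finsum_eq_sum_of_fintype, Fintype.sum_bool, add_comm]
  simp

/-! ### Changing the mark of a leg, and joining two legs -/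

open Classical in
/-- The marks after changing the mark of `h` to `b`. -/
def remarkFun {α : Type} (f : α → Option X) (h : α) (b : X) (x : α) : Option X :=
  if x = h then some b else f x

open Classical in
/-- The marks after removing the marks of `h` and `k`. -/
def joinFun {α : Type} (f : α → Option X) (h k : α) (x : α) : Option X :=
  if x = h ∨ x = k then none else f x

theorem remarkFun_self {α : Type} (f : α → Option X) (h : α) (b : X) :
    remarkFun f h b h = some b := if_pos rfl

theorem remarkFun_of_ne {α : Type} (f : α → Option X) {h x : α} (b : X) (e : x ≠ h) :
    remarkFun f h b x = f x := if_neg e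

theorem joinFun_left {α : Type} (f : α → Option X) (h k : α) :
    joinFun f h k h = none := if_pos (Or.inl rfl)

theorem joinFun_right {α : Type} (f : α → Option X) (h k : α) :
    joinFun f h k k = none := if_pos (Or.inr rfl)

theorem joinFun_of_ne {α : Type} (f : α → Option X) {h k x : α} (e : x ≠ h) (e' : x ≠ k) :
    joinFun f h k x = f x := if_neg (by simp [e, e'])

theorem joinFun_comm {α : Type} (f : α → Option X) (h k : α) :
    joinFun f h k = joinFun f k h := by
  funext x
  unfold joinFun
  congr 1
  rw [or_comm]

theorem remarkFun_map {α β : Type} {j : α → β} (hj : Function.Injective j) {f : α → Option X}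
    {g : β → Option X} (hg : ∀ x, g (j x) = f x) (h : α) (b : X) (x : α) :
    remarkFun g (j h) b (j x) = remarkFun f h b x := by
  by_cases e : x = h
  · rw [e, remarkFun_self, remarkFun_self]
  · rw [remarkFun_of_ne _ _ e, remarkFun_of_ne _ _ (fun e' => e (hj e')), hg]

theorem joinFun_map {α β : Type} {j : α → β} (hj : Function.Injective j) {f : α → Option X}
    {g : β → Option X} (hg : ∀ x, g (j x) = f x) (h k : α) (x : α) :
    joinFun g (j h) (j k) (j x) = joinFun f h k x := by
  by_cases e : x = h
  · rw [e, joinFun_left, joinFun_left]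
  · by_cases e' : x = k
    · rw [e', joinFun_right, joinFun_right]
    · rw [joinFun_of_ne _ e e', joinFun_of_ne _ (fun e2 => e (hj e2)) (fun e2 => e' (hj e2)), hg]

/-- Changing the mark of the leg `ℓ` to `b`. -/
def remarkMod (D : JDiag X) (ℓ : D.H) (hl : D.IsLeg ℓ) (b : X) : D.Mod X where
  π := 1
  ν := remarkFun D.mark ℓ b
  invol := fun h => rfl
  supp := fun h hh => absurd rfl hh
  ν_iff := by
    intro h
    by_cases e : h = ℓ
    · subst e
      simp [hl, remarkFun_self]
    · simp [remarkFun_of_ne _ _ e, IsLeg]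

/-- Joining the legs `ℓ` and `ℓ'`. -/
def joinMod (D : JDiag X) (ℓ ℓ' : D.H) (hl : D.IsLeg ℓ) (hl' : D.IsLeg ℓ') (hne : ℓ ≠ ℓ') :
    D.Mod X where
  π := pswap ℓ ℓ'
  ν := joinFun D.mark ℓ ℓ'
  invol := pswap_pswap ℓ ℓ'
  supp := by
    intro h hh
    by_contra hc
    exact hh (pswap_of_ne (fun e => hc (e ▸ hl)) (fun e => hc (e ▸ hl')))
  ν_iff := by
    intro h
    by_cases e : h = ℓ
    · subst e
      simp [pswap_left, hne.symm, joinFun_left]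
    · by_cases e' : h = ℓ'
      · subst e'
        simp [pswap_right, hne, joinFun_right]
      · simp [joinFun_of_ne _ e e', pswap_of_ne e e', IsLeg]

variable (𝕜 : Type*) [Field 𝕜]

open Classical in
/-- The diagram `D` with the mark of the leg `h` changed to `b`. -/
def rm (D : JDiag X) (h : D.H) (b : X) : Space 𝕜 X :=
  if hl : D.IsLeg h then el 𝕜 (D.modify (D.remarkMod h hl b)) else 0

open Classical in
/-- The diagram `D` with the legs `h` and `k` joined. -/
def jn (D : JDiag X) (h k : D.H) : Space 𝕜 X :=
  if hl : D.IsLeg h ∧ D.IsLeg k ∧ h ≠ k then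
    el 𝕜 (D.modify (D.joinMod h k hl.1 hl.2.1 hl.2.2)) else 0

theorem rm_of_leg {D : JDiag X} {h : D.H} (hl : D.IsLeg h) (b : X) :
    rm 𝕜 D h b = el 𝕜 (D.modify (D.remarkMod h hl b)) := dif_pos hl

theorem jn_of_leg {D : JDiag X} {h k : D.H} (hl : D.IsLeg h) (hk : D.IsLeg k) (hne : h ≠ k) :
    jn 𝕜 D h k = el 𝕜 (D.modify (D.joinMod h k hl hk hne)) := dif_pos ⟨hl, hk, hne⟩

theorem rm_of_not {D : JDiag X} {h : D.H} (hl : ¬ D.IsLeg h) (b : X) : rm 𝕜 D h b = 0 :=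
  dif_neg hl

theorem jn_of_not {D : JDiag X} {h k : D.H} (hl : ¬ (D.IsLeg h ∧ D.IsLeg k ∧ h ≠ k)) :
    jn 𝕜 D h k = 0 := dif_neg hl

theorem rm_iso {D E : JDiag X} (i : Iso D E) (h : D.H) (b : X) :
    rm 𝕜 E (i.e h) b = rm 𝕜 D h b := by
  have hl : E.IsLeg (i.e h) ↔ D.IsLeg h := by simp [IsLeg, i.mark_comm]
  by_cases h1 : D.IsLeg h
  · rw [rm_of_leg 𝕜 h1, rm_of_leg 𝕜 (hl.2 h1)]
    exact (el_iso 𝕜 (modifyIso i _ _ (fun k => rfl)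
      (fun k => remarkFun_map i.e.injective i.mark_comm h b k))).symm
  · rw [rm_of_not 𝕜 h1, rm_of_not 𝕜 (hl.not.2 h1)]

theorem jn_iso {D E : JDiag X} (i : Iso D E) (h k : D.H) :
    jn 𝕜 E (i.e h) (i.e k) = jn 𝕜 D h k := by
  have hl : ∀ h, E.IsLeg (i.e h) ↔ D.IsLeg h := fun h => by simp [IsLeg, i.mark_comm]
  by_cases h1 : D.IsLeg h ∧ D.IsLeg k ∧ h ≠ k
  · rw [jn_of_leg 𝕜 h1.1 h1.2.1 h1.2.2, jn_of_leg 𝕜 ((hl h).2 h1.1) ((hl k).2 h1.2.1)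
      (fun e => h1.2.2 (i.e.injective e))]
    exact (el_iso 𝕜 (modifyIso i _ _ (fun x => (pswap_map i.e.injective h k x).symm)
      (fun x => joinFun_map i.e.injective i.mark_comm h k x))).symm
  · rw [jn_of_not 𝕜 h1, jn_of_not 𝕜 (by simpa [hl] using h1)]

theorem jn_symm (D : JDiag X) (h k : D.H) : jn 𝕜 D h k = jn 𝕜 D k h := by
  by_cases h1 : D.IsLeg h ∧ D.IsLeg k ∧ h ≠ k
  · rw [jn_of_leg 𝕜 h1.1 h1.2.1 h1.2.2, jn_of_leg 𝕜 h1.2.1 h1.1 h1.2.2.symm]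
    congr 2
    simp [joinMod, pswap_comm h k, joinFun_comm D.mark h k]
  · rw [jn_of_not 𝕜 h1, jn_of_not 𝕜 (fun h2 => h1 ⟨h2.2.1, h2.1, h2.2.2.symm⟩)]

theorem el_mul (D E : JDiag X) : el 𝕜 D * el 𝕜 E = el 𝕜 (D.union E) := by
  unfold el
  rw [← map_mul, MonoidAlgebra.single_mul_single, one_mul, cls_mul]

theorem el_empty : el 𝕜 (empty X) = 1 := rfl

/-- The modification affects one component only, so the other factor splits off. This is the source
of the Leibniz rule for `opE`. -/
theorem rm_union_inl (D E : JDiag X) (h : D.H) (b : X) :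
    rm 𝕜 (D.union E) (Sum.inl h) b = rm 𝕜 D h b * el 𝕜 E := by
  by_cases h1 : D.IsLeg h
  · have h2 : (D.union E).IsLeg (Sum.inl h) := h1
    rw [rm_of_leg 𝕜 h1, rm_of_leg 𝕜 h2, el_mul]
    refine el_iso 𝕜 ⟨Equiv.refl _, ?_, ?_, ?_⟩
    · rintro (k | k) <;> rfl
    · rintro (k | k) <;> rfl
    · rintro (k | k)
      · exact (remarkFun_map (f := D.mark) (g := (D.union E).mark) Sum.inl_injective
          (fun x => rfl) h b k).symm
      · exact (remarkFun_of_ne (α := D.H ⊕ E.H) _ b Sum.inr_ne_inl).symm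
  · have h2 : ¬ (D.union E).IsLeg (Sum.inl h) := h1
    rw [rm_of_not 𝕜 h1, rm_of_not 𝕜 h2, zero_mul]

theorem rm_union_inr (D E : JDiag X) (h : E.H) (b : X) :
    rm 𝕜 (D.union E) (Sum.inr h) b = el 𝕜 D * rm 𝕜 E h b :=
  (rm_iso 𝕜 (unionComm D E) (Sum.inr h) b).symm.trans
    ((rm_union_inl 𝕜 E D h b).trans (mul_comm _ _))

theorem jn_union_inl (D E : JDiag X) (h k : D.H) :
    jn 𝕜 (D.union E) (Sum.inl h) (Sum.inl k) = jn 𝕜 D h k * el 𝕜 E := by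
  by_cases h1 : D.IsLeg h ∧ D.IsLeg k ∧ h ≠ k
  · have h2 : (D.union E).IsLeg (Sum.inl h) := h1.1
    have h3 : (D.union E).IsLeg (Sum.inl k) := h1.2.1
    rw [jn_of_leg 𝕜 h1.1 h1.2.1 h1.2.2, jn_of_leg 𝕜 h2 h3 (fun e => h1.2.2 (Sum.inl_injective e)),
      el_mul]
    refine el_iso 𝕜 ⟨Equiv.refl _, ?_, ?_, ?_⟩
    · rintro (x | x)
      · exact congrArg (D.union E).σ (pswap_map Sum.inl_injective h k x).symm
      · exact congrArg (D.union E).σ (pswap_of_ne Sum.inr_ne_inl Sum.inr_ne_inl)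
    · rintro (x | x) <;> rfl
    · rintro (x | x)
      · exact (joinFun_map (f := D.mark) (g := (D.union E).mark) Sum.inl_injective
          (fun x => rfl) h k x).symm
      · exact (joinFun_of_ne (α := D.H ⊕ E.H) _ Sum.inr_ne_inl Sum.inr_ne_inl).symm
  · have h2 : ¬ ((D.union E).IsLeg (Sum.inl h) ∧ (D.union E).IsLeg (Sum.inl k) ∧
        (Sum.inl h : D.H ⊕ E.H) ≠ Sum.inl k) :=
      fun h' => h1 ⟨h'.1, h'.2.1, fun e => h'.2.2 (congrArg _ e)⟩
    rw [jn_of_not 𝕜 h1, jn_of_not 𝕜 h2, zero_mul]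

theorem jn_union_inr (D E : JDiag X) (h k : E.H) :
    jn 𝕜 (D.union E) (Sum.inr h) (Sum.inr k) = el 𝕜 D * jn 𝕜 E h k :=
  (jn_iso 𝕜 (unionComm D E) (Sum.inr h) (Sum.inr k)).symm.trans
    ((jn_union_inl 𝕜 E D h k).trans (mul_comm _ _))

theorem subdiv_τ_apply (D : JDiag X) (h : D.H) (x : D.H ⊕ Bool) :
    (D.subdiv h).τ x = pswap (Sum.inl (D.τ h)) (Sum.inr false)
      (Equiv.Perm.sumCongr D.τ Equiv.boolNot (pswap (Sum.inl (D.τ h)) (Sum.inr false) x)) := rfl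

theorem subdiv_τ_inl_self (D : JDiag X) (h : D.H) :
    (D.subdiv h).τ (Sum.inl h) = Sum.inr false := by
  have e : (Sum.inl h : D.H ⊕ Bool) ≠ Sum.inl (D.τ h) :=
    fun e => D.τ_ne h (Sum.inl_injective e).symm
  refine (subdiv_τ_apply D h _).trans ?_
  rw [pswap_of_ne e (by simp)]
  exact pswap_left _ _

theorem subdiv_τ_inl_τ (D : JDiag X) (h : D.H) :
    (D.subdiv h).τ (Sum.inl (D.τ h)) = Sum.inr true := by
  refine (subdiv_τ_apply D h _).trans ?_
  rw [pswap_left]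
  exact pswap_of_ne (x := (Sum.inr true : D.H ⊕ Bool)) (by simp) (by simp)

theorem subdiv_τ_inl (D : JDiag X) (h x : D.H) (h1 : x ≠ h) (h2 : x ≠ D.τ h) :
    (D.subdiv h).τ (Sum.inl x) = Sum.inl (D.τ x) := by
  refine (subdiv_τ_apply D h _).trans ?_
  rw [pswap_of_ne (x := Sum.inl x) (fun e => h2 (Sum.inl_injective e)) Sum.inl_ne_inr]
  exact pswap_of_ne (x := Sum.inl (D.τ x)) (fun e => h1 (D.τ.injective (Sum.inl_injective e)))
    Sum.inl_ne_inr

theorem subdiv_τ_false (D : JDiag X) (h : D.H) :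
    (D.subdiv h).τ (Sum.inr false) = Sum.inl h :=
  (congrArg (D.subdiv h).τ (subdiv_τ_inl_self D h).symm).trans ((D.subdiv h).τ_invol (Sum.inl h))

theorem subdiv_τ_true (D : JDiag X) (h : D.H) :
    (D.subdiv h).τ (Sum.inr true) = Sum.inl (D.τ h) :=
  (congrArg (D.subdiv h).τ (subdiv_τ_inl_τ D h).symm).trans
    ((D.subdiv h).τ_invol (Sum.inl (D.τ h)))

open Classical in
/-- The bijection of half-edges for `strutJoin`. -/
def strutJoinEquiv {α : Type} (ℓ : α) : Bool ⊕ α ≃ α ⊕ Bool where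
  -- The free end of the strut takes over the name `ℓ`. The glued end and the old `ℓ` become the two
  -- sides of a subdivision point; with the edge subdivided at `τ ℓ`, the side `false` faces `τ ℓ`
  -- and the side `true` faces the new end.
  toFun := Sum.elim (fun b => if b then Sum.inl ℓ else Sum.inr true)
    (fun h => if h = ℓ then Sum.inr false else Sum.inl h)
  invFun := Sum.elim (fun h => if h = ℓ then Sum.inl true else Sum.inr h)
    (fun b => if b then Sum.inl false else Sum.inr ℓ)
  left_inv := by
    rintro ((_ | _) | h)
    · simp
    · simp
    · by_cases e : h = ℓ <;> simp [e]
  right_inv := by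
    rintro (h | (_ | _))
    · by_cases e : h = ℓ <;> simp [e]
    · simp
    · simp

theorem strutJoinEquiv_self {α : Type} (ℓ : α) :
    strutJoinEquiv ℓ (Sum.inr ℓ) = Sum.inr false := if_pos rfl

theorem strutJoinEquiv_of_ne {α : Type} {ℓ h : α} (e : h ≠ ℓ) :
    strutJoinEquiv ℓ (Sum.inr h) = Sum.inl h := if_neg e

/-- Joining one end of a strut to the leg `ℓ` changes the mark of `ℓ` to that of the other end. -/
def strutJoin (c d : X) (V : JDiag X) (ℓ : V.H) (hl : V.IsLeg ℓ)
    (h1 : ((strut c d).union V).IsLeg (Sum.inl false))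
    (h2 : ((strut c d).union V).IsLeg (Sum.inr ℓ))
    (h3 : (Sum.inl false : Bool ⊕ V.H) ≠ Sum.inr ℓ) :
    Iso (((strut c d).union V).modify (((strut c d).union V).joinMod (Sum.inl false) (Sum.inr ℓ)
      h1 h2 h3)) ((V.modify (V.remarkMod ℓ hl d)).subdiv (V.τ ℓ)) where
  e := strutJoinEquiv ℓ
  σ_comm := by
    let T := (V.modify (V.remarkMod ℓ hl d)).subdiv (V.τ ℓ)
    rintro ((_ | _) | h)
    · refine (congrArg (fun x => strutJoinEquiv ℓ (((strut c d).union V).σ x))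
        (pswap_left (Sum.inl false : Bool ⊕ V.H) (Sum.inr ℓ))).trans ?_
      exact (congrArg (fun x => strutJoinEquiv ℓ (Sum.inr x)) (isLeg_iff.1 hl)).trans
        (strutJoinEquiv_self ℓ)
    · refine (congrArg (fun x => strutJoinEquiv ℓ (((strut c d).union V).σ x))
        (pswap_of_ne (a := (Sum.inl false : Bool ⊕ V.H)) (b := Sum.inr ℓ) (x := Sum.inl true)
          (by simp) (by simp))).trans ?_
      exact congrArg Sum.inl (isLeg_iff.1 hl).symm
    · by_cases e : h = ℓ
      · subst e
        refine (congrArg (fun x => strutJoinEquiv h (((strut c d).union V).σ x))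
          (pswap_right (Sum.inl false : Bool ⊕ V.H) (Sum.inr h))).trans ?_
        exact (congrArg T.σ (strutJoinEquiv_self h)).symm
      · have e' : V.σ h ≠ ℓ := fun e' => e (V.σ.injective (e'.trans (isLeg_iff.1 hl).symm))
        refine (congrArg (fun x => strutJoinEquiv ℓ (((strut c d).union V).σ x))
          (pswap_of_ne (a := (Sum.inl false : Bool ⊕ V.H)) (b := Sum.inr ℓ) (x := Sum.inr h)
            (by simp) (by simpa using e))).trans ?_
        exact (strutJoinEquiv_of_ne e').trans (congrArg T.σ (strutJoinEquiv_of_ne e)).symm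
  τ_comm := by
    let W := V.modify (V.remarkMod ℓ hl d)
    let T := W.subdiv (V.τ ℓ)
    have t : W.τ (V.τ ℓ) = ℓ := V.τ_invol ℓ
    have t1 : T.τ (Sum.inl ℓ) = Sum.inr true :=
      (congrArg (fun x => T.τ (Sum.inl x)) t.symm).trans (subdiv_τ_inl_τ W (V.τ ℓ))
    rintro ((_ | _) | h)
    · exact ((subdiv_τ_true W (V.τ ℓ)).trans (congrArg Sum.inl t)).symm
    · exact t1.symm
    · by_cases e : h = ℓ
      · subst e
        refine (strutJoinEquiv_of_ne (V.τ_ne h)).trans ?_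
        exact ((congrArg T.τ (strutJoinEquiv_self h)).trans (subdiv_τ_false W (V.τ h))).symm
      · refine Eq.trans ?_ (congrArg T.τ (strutJoinEquiv_of_ne e)).symm
        by_cases e' : V.τ h = ℓ
        · subst e'
          refine (strutJoinEquiv_self (V.τ h)).trans ?_
          refine ((congrArg (fun x => T.τ (Sum.inl x)) (V.τ_invol h).symm).trans ?_).symm
          exact subdiv_τ_inl_self W (V.τ (V.τ h))
        · refine (strutJoinEquiv_of_ne e').trans (subdiv_τ_inl W (V.τ ℓ) h ?_ ?_).symm
          · intro e2
            exact e' ((congrArg V.τ e2).trans (V.τ_invol ℓ))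
          · exact fun e2 => e (e2.trans t)
  mark_comm := by
    let T := (V.modify (V.remarkMod ℓ hl d)).subdiv (V.τ ℓ)
    rintro ((_ | _) | h)
    · exact (joinFun_left _ _ _).symm
    · have e1 : joinFun (α := Bool ⊕ V.H) ((strut c d).union V).mark (Sum.inl false) (Sum.inr ℓ)
          (Sum.inl true) = some d :=
        joinFun_of_ne _ (fun e => Bool.false_ne_true (Sum.inl_injective e).symm) Sum.inl_ne_inr
      exact (remarkFun_self V.mark ℓ d).trans e1.symm
    · by_cases e : h = ℓ
      · subst e
        exact (congrArg T.mark (strutJoinEquiv_self h)).trans (joinFun_right _ _ _).symm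
      · refine (congrArg T.mark (strutJoinEquiv_of_ne e)).trans
          ((remarkFun_of_ne V.mark d e).trans (joinFun_of_ne (α := Bool ⊕ V.H)
            ((strut c d).union V).mark Sum.inr_ne_inl ?_).symm)
        exact fun e' => e (Sum.inr_injective e')

/-- Exchanging the ends of a strut. -/
def strutComm (c d : X) : Iso (strut c d) (strut d c) where
  e := Equiv.boolNot
  σ_comm := fun _ => rfl
  τ_comm := fun _ => rfl
  mark_comm := by rintro (_ | _) <;> rfl

theorem el_strut_comm (c d : X) : el 𝕜 (strut c d) = el 𝕜 (strut d c) :=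
  el_iso 𝕜 (strutComm c d)

theorem jn_strut_inl_false (c d : X) (V : JDiag X) (ℓ : V.H) (hl : V.IsLeg ℓ) :
    jn 𝕜 ((strut c d).union V) (Sum.inl false) (Sum.inr ℓ) = rm 𝕜 V ℓ d := by
  have h1 : ((strut c d).union V).IsLeg (Sum.inl false) := rfl
  have h2 : ((strut c d).union V).IsLeg (Sum.inr ℓ) := hl
  refine (jn_of_leg 𝕜 h1 h2 Sum.inl_ne_inr).trans (Eq.trans ?_ (rm_of_leg 𝕜 hl d).symm)
  exact (el_iso 𝕜 (strutJoin c d V ℓ hl h1 h2 Sum.inl_ne_inr)).trans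
    (el_subdiv 𝕜 (V.modify (V.remarkMod ℓ hl d)) (V.τ ℓ))

theorem jn_strut_inl_true (c d : X) (V : JDiag X) (ℓ : V.H) (hl : V.IsLeg ℓ) :
    jn 𝕜 ((strut c d).union V) (Sum.inl true) (Sum.inr ℓ) = rm 𝕜 V ℓ c :=
  (jn_iso 𝕜 ((strutComm c d).unionLeft V) (Sum.inl true) (Sum.inr ℓ)).symm.trans
    (jn_strut_inl_false 𝕜 d c V ℓ hl)

/-- The only way a closed circle is created by a joining: a strut is closed up on itself. -/
theorem jn_strut (c d : X) : jn 𝕜 (strut c d) false true = el 𝕜 (circle X) := by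
  have h1 : (strut c d).IsLeg false := rfl
  have h2 : (strut c d).IsLeg true := rfl
  rw [jn_of_leg 𝕜 h1 h2 Bool.false_ne_true]
  refine el_iso 𝕜 ⟨Equiv.refl _, ?_, ?_, ?_⟩
  · rintro (_ | _)
    · exact pswap_left _ _
    · exact pswap_right _ _
  · rintro (_ | _) <;> rfl
  · rintro (_ | _)
    · exact (if_pos (Or.inl rfl)).symm
    · exact (if_pos (Or.inr rfl)).symm

end JDiag

end

/-! ### The operators `opE` and `opD`, and their commutation with multiplication. -/

noncomputable section

namespace JDiag

variable {X : Type u} (𝕜 : Type*) [Field 𝕜]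

theorem exists_opE (a b : X) : ∃ Φ : Space 𝕜 X →ₗ[𝕜] Space 𝕜 X, ∀ D,
    Φ (el 𝕜 D) = ∑ᶠ ℓ : D.Lg a, el 𝕜 (D.modify (D.remarkMod ℓ.1 ℓ.isLeg b)) :=
  exists_linearMap_of_family 𝕜 (fun D => D.Lg a) (fun D ℓ => D.remarkMod ℓ.1 ℓ.isLeg b)
    fun _ _ j => ⟨j.lg a, j.lg_bijective a, fun ℓ h =>
      ⟨rfl, remarkFun_map j.inj j.mark_eq ℓ.1 b h⟩⟩

/-- The derivation that changes the mark of one leg from `a` to `b`, in all possible ways. -/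
def opE (a b : X) : Space 𝕜 X →ₗ[𝕜] Space 𝕜 X := Classical.choose (exists_opE 𝕜 a b)

theorem opE_el (a b : X) (D : JDiag X) :
    opE 𝕜 a b (el 𝕜 D) = ∑ᶠ ℓ : D.Lg a, rm 𝕜 D ℓ.1 b :=
  (Classical.choose_spec (exists_opE 𝕜 a b) D).trans
    (finsum_congr fun ℓ => (rm_of_leg 𝕜 ℓ.isLeg b).symm)

theorem exists_opD (a b : X) : ∃ Φ : Space 𝕜 X →ₗ[𝕜] Space 𝕜 X, ∀ D,
    Φ (el 𝕜 D) = ∑ᶠ p : {p : D.Lg a × D.Lg b // p.1.1 ≠ p.2.1},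
      el 𝕜 (D.modify (D.joinMod p.1.1.1 p.1.2.1 p.1.1.isLeg p.1.2.isLeg p.2)) := by
  refine exists_linearMap_of_family 𝕜 (fun D => {p : D.Lg a × D.Lg b // p.1.1 ≠ p.2.1})
    (fun D p => D.joinMod p.1.1.1 p.1.2.1 p.1.1.isLeg p.1.2.isLeg p.2) fun D E j => ?_
  refine ⟨fun p => ⟨(j.lg a p.1.1, j.lg b p.1.2), fun e => p.2 (j.inj e)⟩, ⟨?_, ?_⟩, fun p h =>
    ⟨(pswap_map j.inj _ _ h).symm, joinFun_map j.inj j.mark_eq _ _ h⟩⟩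
  · rintro ⟨⟨p1, p2⟩, hp⟩ ⟨⟨q1, q2⟩, hq⟩ h
    have h' := congrArg Subtype.val h
    have e1 := (j.lg_bijective a).1 (congrArg Prod.fst h')
    have e2 := (j.lg_bijective b).1 (congrArg Prod.snd h')
    exact Subtype.ext (Prod.ext e1 e2)
  · rintro ⟨⟨q1, q2⟩, hq⟩
    obtain ⟨p1, rfl⟩ := (j.lg_bijective a).2 q1
    obtain ⟨p2, rfl⟩ := (j.lg_bijective b).2 q2
    exact ⟨⟨(p1, p2), fun e => hq (congrArg j.j e)⟩, rfl⟩

/-- The second order operator that joins a leg marked `a` to a leg marked `b`, in all possible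
ways. -/
def opD (a b : X) : Space 𝕜 X →ₗ[𝕜] Space 𝕜 X := Classical.choose (exists_opD 𝕜 a b)

theorem opD_el (a b : X) (D : JDiag X) :
    opD 𝕜 a b (el 𝕜 D) = ∑ᶠ ℓ : D.Lg a, ∑ᶠ ℓ' : D.Lg b, jn 𝕜 D ℓ.1 ℓ'.1 := by
  rw [← finsum_prodType, ← finsum_subtype_dite (fun p : D.Lg a × D.Lg b => p.1.1 ≠ p.2.1)
    (fun p => jn 𝕜 D p.1.1 p.2.1) (fun p hp => jn_of_not 𝕜 (fun h => hp h.2.2))]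
  exact (Classical.choose_spec (exists_opD 𝕜 a b) D).trans
    (finsum_congr fun p => (jn_of_leg 𝕜 p.1.1.isLeg p.1.2.isLeg p.2).symm)

theorem finsum_mul' {α R : Type*} [Finite α] [Semiring R] (f : α → R) (r : R) :
    (∑ᶠ a, f a) * r = ∑ᶠ a, f a * r := map_finsum' (AddMonoidHom.mulRight r) f

theorem mul_finsum' {α R : Type*} [Finite α] [Semiring R] (f : α → R) (r : R) :
    r * (∑ᶠ a, f a) = ∑ᶠ a, r * f a := map_finsum' (AddMonoidHom.mulLeft r) f

theorem opE_el_mul (a b : X) (D F : JDiag X) :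
    opE 𝕜 a b (el 𝕜 D * el 𝕜 F) = opE 𝕜 a b (el 𝕜 D) * el 𝕜 F + el 𝕜 D * opE 𝕜 a b (el 𝕜 F) := by
  rw [el_mul, opE_el, opE_el, opE_el, finsum_lg_union D F a (fun h => rm 𝕜 (D.union F) h b),
    finsum_mul', mul_finsum']
  exact congrArg₂ (· + ·) (finsum_congr fun ℓ => rm_union_inl 𝕜 D F ℓ.1 b)
    (finsum_congr fun ℓ => rm_union_inr 𝕜 D F ℓ.1 b)

/-- Diagrams span the quotient, so a linear statement needs checking on diagrams only. -/
theorem space_induction {p : Space 𝕜 X → Prop} (x : Space 𝕜 X) (h0 : p 0)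
    (hadd : ∀ x y, p x → p y → p (x + y)) (hsmul : ∀ (c : 𝕜) x, p x → p (c • x))
    (hel : ∀ D, p (el 𝕜 D)) : p x := by
  have key : Submodule.span 𝕜 (Set.range (el 𝕜 (X := X))) = ⊤ := by
    rw [← Submodule.ker_mkQ (Submodule.span 𝕜 (Set.range (el 𝕜 (X := X)))), LinearMap.ker_eq_top]
    refine space_hom_ext 𝕜 fun D => ?_
    rw [LinearMap.zero_apply, Submodule.mkQ_apply, Submodule.Quotient.mk_eq_zero]
    exact Submodule.subset_span ⟨D, rfl⟩
  have hx : x ∈ Submodule.span 𝕜 (Set.range (el 𝕜 (X := X))) := key ▸ Submodule.mem_top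
  induction hx using Submodule.span_induction with
  | mem x hx =>
    obtain ⟨D, rfl⟩ := hx
    exact hel D
  | zero => exact h0
  | add x y _ _ hx hy => exact hadd x y hx hy
  | smul c x _ hx => exact hsmul c x hx

theorem opE_mul (a b : X) (x y : Space 𝕜 X) :
    opE 𝕜 a b (x * y) = opE 𝕜 a b x * y + x * opE 𝕜 a b y := by
  induction x using space_induction with
  | h0 => simp
  | hadd x x' hx hx' => simp only [add_mul, map_add, hx, hx']; abel
  | hsmul c x hx => simp only [smul_mul_assoc, map_smul, hx, smul_add]
  | hel D =>
    induction y using space_induction with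
    | h0 => simp
    | hadd y y' hy hy' => simp only [mul_add, map_add, hy, hy']; abel
    | hsmul c y hy => simp only [mul_smul_comm, map_smul, hy, smul_add]
    | hel F => exact opE_el_mul 𝕜 a b D F

/-- A second order Leibniz rule: the two joined legs lie in the same factor, or one lies in each,
which gives the two cross terms. -/
theorem opD_el_mul (a b : X) (D F : JDiag X) :
    opD 𝕜 a b (el 𝕜 D * el 𝕜 F) = opD 𝕜 a b (el 𝕜 D) * el 𝕜 F + el 𝕜 D * opD 𝕜 a b (el 𝕜 F) +
      (∑ᶠ ℓ : D.Lg a, ∑ᶠ ℓ' : F.Lg b, jn 𝕜 (D.union F) (Sum.inl ℓ.1) (Sum.inr ℓ'.1)) +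
      ∑ᶠ ℓ : F.Lg a, ∑ᶠ ℓ' : D.Lg b, jn 𝕜 (D.union F) (Sum.inr ℓ.1) (Sum.inl ℓ'.1) := by
  have e : ∀ h : (D.union F).H, ∑ᶠ ℓ' : (D.union F).Lg b, jn 𝕜 (D.union F) h ℓ'.1 =
      ∑ᶠ ℓ' : D.Lg b, jn 𝕜 (D.union F) h (Sum.inl ℓ'.1) +
      ∑ᶠ ℓ' : F.Lg b, jn 𝕜 (D.union F) h (Sum.inr ℓ'.1) := fun h =>
    finsum_lg_union D F b (fun k => jn 𝕜 (D.union F) h k)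
  rw [el_mul, opD_el, opD_el, opD_el,
    finsum_lg_union D F a (fun h => ∑ᶠ ℓ' : (D.union F).Lg b, jn 𝕜 (D.union F) h ℓ'.1),
    finsum_congr (fun ℓ : D.Lg a => e (Sum.inl ℓ.1)), finsum_congr (fun ℓ : F.Lg a => e (Sum.inr ℓ.1)),
    finsum_add', finsum_add', finsum_mul', mul_finsum']
  have e1 : ∑ᶠ ℓ : D.Lg a, ∑ᶠ ℓ' : D.Lg b, jn 𝕜 (D.union F) (Sum.inl ℓ.1) (Sum.inl ℓ'.1) =
      ∑ᶠ ℓ : D.Lg a, (∑ᶠ ℓ' : D.Lg b, jn 𝕜 D ℓ.1 ℓ'.1) * el 𝕜 F := by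
    refine finsum_congr fun ℓ => ?_
    rw [finsum_mul']
    exact finsum_congr fun ℓ' => jn_union_inl 𝕜 D F _ _
  have e2 : ∑ᶠ ℓ : F.Lg a, ∑ᶠ ℓ' : F.Lg b, jn 𝕜 (D.union F) (Sum.inr ℓ.1) (Sum.inr ℓ'.1) =
      ∑ᶠ ℓ : F.Lg a, el 𝕜 D * (∑ᶠ ℓ' : F.Lg b, jn 𝕜 F ℓ.1 ℓ'.1) := by
    refine finsum_congr fun ℓ => ?_
    rw [mul_finsum']
    exact finsum_congr fun ℓ' => jn_union_inr 𝕜 D F _ _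
  rw [e1, e2]
  abel

/-- A diagram without legs. -/
def Legless (D : JDiag X) : Prop := ∀ h, ¬ D.IsLeg h

theorem Legless.isEmpty {D : JDiag X} (hD : D.Legless) (a : X) : IsEmpty (D.Lg a) :=
  ⟨fun ℓ => hD ℓ.1 ℓ.isLeg⟩

/-- Without legs there is nothing to join, so legless diagrams, circles in particular, behave as
scalars for `opD`. -/
theorem opD_legless_mul (a b : X) {D : JDiag X} (hD : D.Legless) (x : Space 𝕜 X) :
    opD 𝕜 a b (el 𝕜 D * x) = el 𝕜 D * opD 𝕜 a b x := by
  have h1 := hD.isEmpty a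
  have h2 := hD.isEmpty b
  induction x using space_induction with
  | h0 => simp
  | hadd y y' hy hy' => simp only [mul_add, map_add, hy, hy']
  | hsmul c y hy => simp only [mul_smul_comm, map_smul, hy]
  | hel F =>
    rw [opD_el_mul, opD_el 𝕜 a b D, finsum_of_isEmpty, finsum_of_isEmpty,
      finsum_congr (fun ℓ : F.Lg a => finsum_of_isEmpty _)]
    simp

/-- The Kronecker symbol. -/
def dl [DecidableEq X] (a b : X) : 𝕜 := if a = b then 1 else 0

/-- The strut as an element of the algebra of diagrams. -/
abbrev st (a b : X) : Space 𝕜 X := el 𝕜 (strut a b)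

variable [DecidableEq X]

theorem dl_smul {N : Type*} [AddCommGroup N] [Module 𝕜 N] (a b : X) (x : N) :
    dl 𝕜 a b • x = if a = b then x else 0 := by
  unfold dl
  split_ifs <;> simp

omit [DecidableEq X] in
theorem rm_strut_false (c d b : X) : rm 𝕜 (strut c d) false b = st 𝕜 b d := by
  refine (rm_of_leg 𝕜 (D := strut c d) (h := false) rfl b).trans ?_
  refine el_iso 𝕜 ⟨Equiv.refl _, fun h => rfl, fun h => rfl, ?_⟩
  rintro (_ | _)
  · exact (remarkFun_self (α := Bool) (strut c d).mark false b).symm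
  · have : remarkFun (α := Bool) (strut c d).mark false b true = some d :=
      remarkFun_of_ne (α := Bool) (h := false) (x := true) _ _ (by simp)
    exact this.symm

omit [DecidableEq X] in
theorem rm_strut_true (c d b : X) : rm 𝕜 (strut c d) true b = st 𝕜 c b :=
  (rm_iso 𝕜 (strutComm c d) true b).symm.trans
    ((rm_strut_false 𝕜 d c b).trans (el_strut_comm 𝕜 b c))

theorem opE_st (a b c d : X) :
    opE 𝕜 a b (st 𝕜 c d) = dl 𝕜 c a • st 𝕜 b d + dl 𝕜 d a • st 𝕜 c b := by
  rw [opE_el, dl_smul, dl_smul]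
  refine (finsum_lg_strut c d a (fun h => rm 𝕜 (strut c d) h b)).trans ?_
  rw [rm_strut_false, rm_strut_true]

omit [DecidableEq X] in
theorem jn_strut_true_false (c d : X) : jn 𝕜 (strut c d) true false = el 𝕜 (circle X) :=
  (jn_symm 𝕜 _ _ _).trans (jn_strut 𝕜 c d)

theorem opD_st (a b c d : X) :
    opD 𝕜 a b (st 𝕜 c d) =
      (dl 𝕜 c a * dl 𝕜 d b + dl 𝕜 d a * dl 𝕜 c b) • el 𝕜 (circle X) := by
  have z : ∀ b : Bool, jn 𝕜 (strut c d) b b = 0 := fun b => jn_of_not 𝕜 (fun h => h.2.2 rfl)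
  have e : ∀ h : Bool, ∑ᶠ ℓ' : (strut c d).Lg b, jn 𝕜 (strut c d) h ℓ'.1 =
      (if c = b then jn 𝕜 (strut c d) h false else 0) +
        if d = b then jn 𝕜 (strut c d) h true else 0 := fun h =>
    finsum_lg_strut c d b (fun k => jn 𝕜 (strut c d) h k)
  rw [opD_el]
  refine (finsum_lg_strut c d a (fun h => ∑ᶠ ℓ' : (strut c d).Lg b, jn 𝕜 (strut c d) h ℓ'.1)).trans ?_
  rw [e, e, z, z, jn_strut, jn_strut_true_false, add_smul, mul_smul, mul_smul, dl_smul, dl_smul,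
    dl_smul, dl_smul, ite_self, ite_self, zero_add, add_zero]

/-- The basic commutation relation. Joining both ends of the strut to each other makes a circle.
Joining one end to a leg of x absorbs the strut, and that leg receives the mark of the other end, so
the cross terms are first order operators `opE`. -/
theorem opD_st_mul (a b c d : X) (x : Space 𝕜 X) :
    opD 𝕜 a b (st 𝕜 c d * x) = st 𝕜 c d * opD 𝕜 a b x +
      (dl 𝕜 c a * dl 𝕜 d b + dl 𝕜 d a * dl 𝕜 c b) • (el 𝕜 (circle X) * x) +
      (dl 𝕜 c a • opE 𝕜 b d x + dl 𝕜 d a • opE 𝕜 b c x +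
        (dl 𝕜 c b • opE 𝕜 a d x + dl 𝕜 d b • opE 𝕜 a c x)) := by
  induction x using space_induction with
  | h0 => simp
  | hadd y y' hy hy' => simp only [mul_add, map_add, hy, hy', smul_add]; abel
  | hsmul r y hy =>
    simp only [mul_smul_comm, map_smul, hy, smul_add, smul_comm r]
  | hel F =>
    rw [opD_el_mul, opD_st]
    have e1 : ∑ᶠ ℓ : (strut c d).Lg a, ∑ᶠ ℓ' : F.Lg b,
        jn 𝕜 ((strut c d).union F) (Sum.inl ℓ.1) (Sum.inr ℓ'.1) =
        dl 𝕜 c a • opE 𝕜 b d (el 𝕜 F) + dl 𝕜 d a • opE 𝕜 b c (el 𝕜 F) := by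
      refine (finsum_lg_strut c d a (fun h => ∑ᶠ ℓ' : F.Lg b,
        jn 𝕜 ((strut c d).union F) (Sum.inl h) (Sum.inr ℓ'.1))).trans ?_
      rw [dl_smul, dl_smul, opE_el, opE_el,
        finsum_congr (fun ℓ' : F.Lg b => jn_strut_inl_false 𝕜 c d F ℓ'.1 ℓ'.isLeg),
        finsum_congr (fun ℓ' : F.Lg b => jn_strut_inl_true 𝕜 c d F ℓ'.1 ℓ'.isLeg)]
    have e2 : ∑ᶠ ℓ : F.Lg a, ∑ᶠ ℓ' : (strut c d).Lg b,
        jn 𝕜 ((strut c d).union F) (Sum.inr ℓ.1) (Sum.inl ℓ'.1) =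
        dl 𝕜 c b • opE 𝕜 a d (el 𝕜 F) + dl 𝕜 d b • opE 𝕜 a c (el 𝕜 F) := by
      rw [finsum_swap]
      refine (finsum_lg_strut c d b (fun h => ∑ᶠ ℓ' : F.Lg a,
        jn 𝕜 ((strut c d).union F) (Sum.inr ℓ'.1) (Sum.inl h))).trans ?_
      rw [dl_smul, dl_smul, opE_el, opE_el,
        finsum_congr (fun ℓ' : F.Lg a => (jn_symm 𝕜 _ _ _).trans
          (jn_strut_inl_false 𝕜 c d F ℓ'.1 ℓ'.isLeg)),
        finsum_congr (fun ℓ' : F.Lg a => (jn_symm 𝕜 _ _ _).trans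
          (jn_strut_inl_true 𝕜 c d F ℓ'.1 ℓ'.isLeg))]
    rw [e1, e2, smul_mul_assoc]
    abel

end JDiag

end

/-! ### Expanding sums over gluings along one chosen leg. -/

noncomputable section

namespace JDiag

variable {X : Type u} (𝕜 : Type*) [Field 𝕜]

theorem joinMod_isLeg {D : JDiag X} {a k : D.H} {ha : D.IsLeg a} {hk : D.IsLeg k} {hne : a ≠ k}
    {h : D.H} : (D.modify (D.joinMod a k ha hk hne)).IsLeg h ↔ D.IsLeg h ∧ h ≠ a ∧ h ≠ k := by
  refine ((D.joinMod a k ha hk hne).ν_iff h).trans (and_congr_right fun _ => ?_)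
  change pswap a k h = h ↔ _
  constructor
  · intro e
    refine ⟨?_, ?_⟩
    · rintro rfl
      rw [pswap_left] at e
      exact hne e.symm
    · rintro rfl
      rw [pswap_right] at e
      exact hne e
  · exact fun e => pswap_of_ne e.1 e.2

theorem closeSum_congr (D : JDiag X) {p q : Equiv.Perm D.H → Prop}
    (h : ∀ π, D.IsMatching π → (p π ↔ q π)) : closeSum 𝕜 D p = closeSum 𝕜 D q :=
  finsum_eq_of_bijective
    (Equiv.subtypeEquiv (Equiv.refl _) (fun π => by exact and_congr_right (h π)))
    (Equiv.bijective _) fun _ => rfl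

theorem pswap_mul_comm {α : Type*} {a k : α} {π : Equiv.Perm α} (ha : π a = a) (hk : π k = k)
    (x : α) : pswap a k (π x) = π (pswap a k x) := by
  by_cases h1 : x = a
  · rw [h1, ha, pswap_left, hk]
  · by_cases h2 : x = k
    · rw [h2, hk, pswap_right, ha]
    · rw [pswap_of_ne h1 h2, pswap_of_ne]
      · exact fun e => h1 (π.injective (e.trans ha.symm))
      · exact fun e => h2 (π.injective (e.trans hk.symm))

theorem join_fix {D : JDiag X} {a k : D.H} {ha : D.IsLeg a} {hk : D.IsLeg k} {hne : a ≠ k}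
    {π : Equiv.Perm D.H} (hπ : (D.modify (D.joinMod a k ha hk hne)).IsMatching π) :
    π a = a ∧ π k = k :=
  ⟨(hπ.2 a).2 (fun h => (joinMod_isLeg.1 h).2.1 rfl),
    (hπ.2 k).2 (fun h => (joinMod_isLeg.1 h).2.2 rfl)⟩

/-- A perfect matching that pairs a with k is the same as a matching of the legs left after a and k
are joined. The transposition translates between the two, here in one direction and in
`isMatching_join` in the other. -/
theorem isMatching_mul_pswap {D : JDiag X} {a k : D.H} {ha : D.IsLeg a} {hk : D.IsLeg k}
    {hne : a ≠ k} {π : Equiv.Perm D.H}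
    (hπ : (D.modify (D.joinMod a k ha hk hne)).IsMatching π) :
    D.IsMatching (π * pswap a k) := by
  obtain ⟨fa, fk⟩ := join_fix hπ
  refine ⟨fun h => ?_, fun h => ?_⟩
  · rw [Equiv.Perm.mul_apply, Equiv.Perm.mul_apply, pswap_mul_comm fa fk, pswap_pswap]
    exact hπ.1 h
  · rw [Equiv.Perm.mul_apply]
    by_cases h1 : h = a
    · rw [h1, pswap_left, fk]
      exact iff_of_false hne.symm (fun h => h ha)
    · by_cases h2 : h = k
      · rw [h2, pswap_right, fa]
        exact iff_of_false hne (fun h => h hk)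
      · rw [pswap_of_ne h1 h2]
        refine (hπ.2 h).trans (not_congr (joinMod_isLeg.trans ?_))
        simp [h1, h2]

theorem isMatching_join {D : JDiag X} {a k : D.H} {ha : D.IsLeg a} {hk : D.IsLeg k}
    {hne : a ≠ k} {π : Equiv.Perm D.H} (hπ : D.IsMatching π) (e : π a = k) :
    (D.modify (D.joinMod a k ha hk hne)).IsMatching (π * pswap a k) := by
  have e' : π k = a := by rw [← e, hπ.1]
  have key : ∀ h, h ≠ a → h ≠ k → π h ≠ a ∧ π h ≠ k := fun h h1 h2 =>
    ⟨fun e2 => h2 (π.injective (e2.trans e'.symm)), fun e2 => h1 (π.injective (e2.trans e.symm))⟩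
  refine ⟨fun (h : D.H) => ?_, fun (h : D.H) => ?_⟩
  · change π (pswap a k (π (pswap a k h))) = h
    by_cases h1 : h = a
    · rw [h1, pswap_left, e', pswap_left, e']
    · by_cases h2 : h = k
      · rw [h2, pswap_right, e, pswap_right, e]
      · rw [pswap_of_ne h1 h2, pswap_of_ne (key h h1 h2).1 (key h h1 h2).2, hπ.1]
  · change π (pswap a k h) = h ↔ _
    by_cases h1 : h = a
    · rw [h1, pswap_left, e']
      exact iff_of_true rfl (fun h => (joinMod_isLeg.1 h).2.1 rfl)
    · by_cases h2 : h = k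
      · rw [h2, pswap_right, e]
        exact iff_of_true rfl (fun h => (joinMod_isLeg.1 h).2.2 rfl)
      · rw [pswap_of_ne h1 h2]
        refine (hπ.2 h).trans (not_congr (Iff.trans ?_ joinMod_isLeg.symm))
        simp [h1, h2]

/-- Expansion of a sum over gluings according to the partner of the leg `a`. -/
theorem closeSum_expand (D : JDiag X) (R : D.H → D.H → Prop) (a : D.H) (ha : D.IsLeg a) :
    closeSum 𝕜 D (fun π => ∀ h, D.IsLeg h → R h (π h)) =
      ∑ᶠ k : {k // (D.IsLeg k ∧ a ≠ k) ∧ R a k ∧ R k a},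
        closeSum 𝕜 (D.modify (D.joinMod a k.1 ha k.2.1.1 k.2.1.2))
          (fun π => ∀ h, (D.modify (D.joinMod a k.1 ha k.2.1.1 k.2.1.2)).IsLeg h → R h (π h)) := by
  unfold closeSum
  refine Eq.symm ((finsum_sigmaType (β := fun k : {k // (D.IsLeg k ∧ a ≠ k) ∧ R a k ∧ R k a} =>
    {π : Equiv.Perm D.H // (D.modify (D.joinMod a k.1 ha k.2.1.1 k.2.1.2)).IsMatching π ∧
      ∀ h, (D.modify (D.joinMod a k.1 ha k.2.1.1 k.2.1.2)).IsLeg h → R h (π h)})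
    (fun x => el 𝕜 ((D.modify (D.joinMod a x.1.1 ha x.1.2.1.1 x.1.2.1.2)).close
      x.2.1 x.2.2.1))).symm.trans ?_)
  -- The partner of `a` and the matching of the remaining legs determine the whole matching; its
  -- value at `a` recovers the partner.
  refine finsum_eq_of_bijective (fun x => ⟨x.2.1 * pswap a x.1.1,
    isMatching_mul_pswap x.2.2.1, ?_⟩) ⟨?_, ?_⟩ ?_
  · obtain ⟨⟨k, ⟨hk, hne⟩, h1, h2⟩, π, hπ, hR⟩ := x
    obtain ⟨fa, fk⟩ := join_fix hπ
    intro h hl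
    change R h (π (pswap a k h))
    by_cases e1 : h = a
    · rw [e1, pswap_left, fk]
      exact h1
    · by_cases e2 : h = k
      · rw [e2, pswap_right, fa]
        exact h2
      · rw [pswap_of_ne e1 e2]
        exact hR h (joinMod_isLeg.2 ⟨hl, e1, e2⟩)
  · rintro ⟨⟨k, ⟨hk, hne⟩, h1, h2⟩, π, hπ, hR⟩ ⟨⟨k', ⟨hk', hne'⟩, h1', h2'⟩, π', hπ', hR'⟩ h
    have h := congrArg Subtype.val h
    change π * pswap a k = π' * pswap a k' at h
    have e := DFunLike.congr_fun h a
    rw [Equiv.Perm.mul_apply, Equiv.Perm.mul_apply, pswap_left, pswap_left, (join_fix hπ).2,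
      (join_fix hπ').2] at e
    subst e
    have e := mul_right_cancel h
    subst e
    rfl
  · rintro ⟨π, hπ, hR⟩
    have hne : a ≠ π a := fun e => (hπ.2 a).1 e.symm ha
    refine ⟨⟨⟨π a, ⟨hπ.leg ha, hne⟩, hR a ha, ?_⟩, π * pswap a (π a), isMatching_join hπ rfl, ?_⟩,
      ?_⟩
    · have := hR _ (hπ.leg ha)
      rwa [hπ.1] at this
    · intro h hl
      obtain ⟨h1, h2, h3⟩ := joinMod_isLeg.1 hl
      change R h (π (pswap a (π a) h))
      rw [pswap_of_ne h2 h3]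
      exact hR h h1
    · refine Subtype.ext ?_
      change π * pswap a (π a) * pswap a (π a) = π
      ext h
      rw [Equiv.Perm.mul_apply, Equiv.Perm.mul_apply, pswap_pswap]
  · rintro ⟨⟨k, ⟨hk, hne⟩, h1, h2⟩, π, hπ, hR⟩
    obtain ⟨fa, fk⟩ := join_fix hπ
    exact el_iso 𝕜 ⟨Equiv.refl _, fun h => congrArg D.σ (pswap_mul_comm fa fk h), fun _ => rfl,
      fun _ => rfl⟩

/-- The sum over all mark-preserving gluings that exchange the two sides given by `s`. -/
def bs (D : JDiag X) (s : D.H → Bool) : Space 𝕜 Empty := closeSum 𝕜 D (D.Exchanges s)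

theorem glueSum_eq_bs (D E : JDiag X) : glueSum 𝕜 D E = bs 𝕜 (D.union E) Sum.isLeft := rfl

/-- Only the sides of legs enter the gluing condition. This gives freedom to recolour half-edges
when a strut is absorbed. -/
theorem bs_congr (D : JDiag X) {s t : D.H → Bool} (h : ∀ x, D.IsLeg x → s x = t x) :
    bs 𝕜 D s = bs 𝕜 D t := by
  refine closeSum_congr 𝕜 D fun π hπ => forall_congr' fun x => forall_congr' fun hx => ?_
  rw [h x hx, h _ (hπ.leg hx)]

theorem bs_iso {D E : JDiag X} (i : Iso D E) {s : D.H → Bool} {t : E.H → Bool}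
    (h : ∀ x, t (i.e x) = s x) : bs 𝕜 D s = bs 𝕜 E t :=
  closeSum_iso 𝕜 i (exchanges_iso i s t false fun x => by rw [h, Bool.false_xor])

theorem bs_subdiv (D : JDiag X) (k : D.H) {s : D.H → Bool} {t : (D.subdiv k).H → Bool}
    (h : ∀ x, t (Sum.inl x) = s x) : bs 𝕜 D s = bs 𝕜 (D.subdiv k) t := by
  refine closeSum_subdiv 𝕜 D k fun π => ⟨?_, ?_⟩
  · rintro hp (x | x) hx
    · exact ⟨(hp x hx).1, ((h _).trans (hp x hx).2).trans (congrArg _ (h x).symm)⟩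
    · exact absurd hx (by simp [IsLeg, subdiv])
  · intro hp x hx
    obtain ⟨h1, h2⟩ := hp (Sum.inl x) hx
    exact ⟨h1, ((h _).symm.trans h2).trans (congrArg _ (h x))⟩

open Classical in
/-- The sum `bs` after joining the legs `h` and `k`. -/
def bj (D : JDiag X) (s : D.H → Bool) (h k : D.H) : Space 𝕜 Empty :=
  if hl : D.IsLeg h ∧ D.IsLeg k ∧ h ≠ k then
    bs 𝕜 (D.modify (D.joinMod h k hl.1 hl.2.1 hl.2.2)) s else 0

theorem bj_of_leg {D : JDiag X} {h k : D.H} (hl : D.IsLeg h) (hk : D.IsLeg k) (hne : h ≠ k)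
    (s : D.H → Bool) : bj 𝕜 D s h k = bs 𝕜 (D.modify (D.joinMod h k hl hk hne)) s :=
  dif_pos ⟨hl, hk, hne⟩

theorem bj_of_not {D : JDiag X} {h k : D.H} (hl : ¬ (D.IsLeg h ∧ D.IsLeg k ∧ h ≠ k))
    (s : D.H → Bool) : bj 𝕜 D s h k = 0 := dif_neg hl

theorem joinMod_mark {D : JDiag X} {a k : D.H} {ha : D.IsLeg a} {hk : D.IsLeg k} {hne : a ≠ k}
    {h : D.H} (hl : (D.modify (D.joinMod a k ha hk hne)).IsLeg h) :
    (D.modify (D.joinMod a k ha hk hne)).mark h = D.mark h := by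
  obtain ⟨-, h2, h3⟩ := joinMod_isLeg.1 hl
  exact joinFun_of_ne _ h2 h3

-- `closeSum_expand` for two-sided, mark-preserving gluings. The sum may run over all half-edges,
-- since `bj` vanishes when the chosen half-edges cannot be joined.
open Classical in
theorem bs_expand (D : JDiag X) (s : D.H → Bool) (a : D.H) (ha : D.IsLeg a) :
    bs 𝕜 D s = ∑ᶠ k : D.H, if D.mark k = D.mark a ∧ s k = !s a then bj 𝕜 D s a k else 0 := by
  refine (closeSum_expand 𝕜 D (fun h k => D.mark k = D.mark h ∧ s k = !s h) a ha).trans ?_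
  rw [← finsum_subtype_dite (fun k => (D.IsLeg k ∧ a ≠ k) ∧
    (D.mark k = D.mark a ∧ s k = !s a) ∧ (D.mark a = D.mark k ∧ s a = !s k))]
  · refine finsum_congr fun k => ?_
    rw [if_pos k.2.2.1, bj_of_leg 𝕜 ha k.2.1.1 k.2.1.2]
    refine closeSum_congr 𝕜 _ fun π hπ => forall_congr' fun h => forall_congr' fun hh => ?_
    rw [joinMod_mark hh, joinMod_mark (hπ.leg hh)]
  · intro k hk
    split_ifs with h
    · refine bj_of_not 𝕜 (fun hl => hk ⟨hl.2, h, h.1.symm, ?_⟩) s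
      rw [h.2, Bool.not_not]
    · rfl

/-- Joining forgets the marks of the joined legs. -/
theorem bj_congr {D E : JDiag X} (e : D.H ≃ E.H) (hσ : ∀ h, e (D.σ h) = E.σ (e h))
    (hτ : ∀ h, e (D.τ h) = E.τ (e h)) {a k : D.H}
    (hm : ∀ h, h ≠ a → h ≠ k → E.mark (e h) = D.mark h) {s : D.H → Bool} {t : E.H → Bool}
    (hs : ∀ h, h ≠ a → h ≠ k → t (e h) = s h) :
    bj 𝕜 D s a k = bj 𝕜 E t (e a) (e k) := by
  have hl : ∀ h, E.IsLeg (e h) ↔ D.IsLeg h := fun h => by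
    rw [isLeg_iff, isLeg_iff, ← hσ, e.apply_eq_iff_eq]
  by_cases h1 : D.IsLeg a ∧ D.IsLeg k ∧ a ≠ k
  · obtain ⟨ha, hk, hne⟩ := h1
    rw [bj_of_leg 𝕜 ha hk hne, bj_of_leg 𝕜 ((hl a).2 ha) ((hl k).2 hk) (e.injective.ne hne)]
    rw [bs_congr 𝕜 (D.modify (D.joinMod a k ha hk hne)) (s := s) (t := fun h => t (e h))
      (fun x hx => (hs x (joinMod_isLeg.1 hx).2.1 (joinMod_isLeg.1 hx).2.2).symm)]
    refine bs_iso 𝕜 (D := D.modify (D.joinMod a k ha hk hne))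
      (E := E.modify (E.joinMod (e a) (e k) ((hl a).2 ha) ((hl k).2 hk) (e.injective.ne hne)))
      ⟨e, fun (h : D.H) => ?_, hτ, fun (h : D.H) => ?_⟩ fun x => rfl
    · exact (hσ _).trans (congrArg E.σ (pswap_map e.injective a k h))
    · by_cases e1 : h = a
      · subst e1
        exact (joinFun_left _ _ _).trans (joinFun_left _ _ _).symm
      · by_cases e2 : h = k
        · subst e2
          exact (joinFun_right _ _ _).trans (joinFun_right _ _ _).symm
        · exact (joinFun_of_ne E.mark (e.injective.ne e1) (e.injective.ne e2)).trans
            ((hm h e1 e2).trans (joinFun_of_ne D.mark e1 e2).symm)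
  · rw [bj_of_not 𝕜 h1, bj_of_not 𝕜]
    rw [hl, hl, e.injective.ne_iff]
    exact h1

/-- Joining one end of a strut to a leg, in sums over gluings. -/
theorem bj_strut (c d : X) (V : JDiag X) (ℓ : V.H) (hl : V.IsLeg ℓ)
    (s : ((strut c d).union V).H → Bool) (t : V.H → Bool) (h1 : t ℓ = s (Sum.inl true))
    (h2 : ∀ h, h ≠ ℓ → t h = s (Sum.inr h)) :
    bj 𝕜 ((strut c d).union V) s (Sum.inl false) (Sum.inr ℓ) =
      bs 𝕜 (V.modify (V.remarkMod ℓ hl d)) t := by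
  have l1 : ((strut c d).union V).IsLeg (Sum.inl false) := rfl
  have l2 : ((strut c d).union V).IsLeg (Sum.inr ℓ) := hl
  let j := strutJoinEquiv ℓ
  refine (bj_of_leg 𝕜 l1 l2 Sum.inl_ne_inr s).trans ?_
  refine (bs_iso 𝕜 (strutJoin c d V ℓ hl l1 l2 Sum.inl_ne_inr) (t := fun x => s (j.symm x))
    (fun x => congrArg s (j.symm_apply_apply x))).trans ?_
  refine (bs_subdiv 𝕜 (V.modify (V.remarkMod ℓ hl d)) (V.τ ℓ) fun x => ?_).symm
  by_cases e : x = ℓ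
  · refine Eq.trans (congrArg s ?_) ((congrArg t e).trans h1).symm
    exact (j.symm_apply_eq).2 (congrArg Sum.inl e)
  · refine Eq.trans ?_ (h2 x e).symm
    refine congrArg s ?_
    exact (j.symm_apply_eq).2 (strutJoinEquiv_of_ne e).symm

end JDiag

end

/-! ### Adjointness for the pairing, and the projection to legless diagrams. -/

noncomputable section

namespace JDiag

variable {X : Type u} (𝕜 : Type*) [Field 𝕜]

theorem el_isoOf {D E : JDiag X} (e : D.H ≃ E.H) (hσ : ∀ h, e (D.σ h) = E.σ (e h))
    (hτ : ∀ h, e (D.τ h) = E.τ (e h)) (hm : ∀ h, E.mark (e h) = D.mark h) :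
    el 𝕜 D = el 𝕜 E := el_iso 𝕜 ⟨e, hσ, hτ, hm⟩

theorem bs_isoOf {D E : JDiag X} (e : D.H ≃ E.H) (hσ : ∀ h, e (D.σ h) = E.σ (e h))
    (hτ : ∀ h, e (D.τ h) = E.τ (e h)) (hm : ∀ h, E.mark (e h) = D.mark h)
    {s : D.H → Bool} {t : E.H → Bool} (h : ∀ x, t (e x) = s x) : bs 𝕜 D s = bs 𝕜 E t :=
  bs_iso 𝕜 ⟨e, hσ, hτ, hm⟩ h

theorem pairing_comm (x y : Space 𝕜 X) : pairing 𝕜 x y = pairing 𝕜 y x := by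
  have h : pairing 𝕜 (X := X) = (pairing 𝕜).flip :=
    space_hom_ext 𝕜 fun D => space_hom_ext 𝕜 fun E => by
      rw [LinearMap.flip_apply, pairing_el, pairing_el, glueSum_comm]
  exact congrArg (fun f => f x y) h

open Classical in
theorem finsum_lg {N : Type*} [AddCommMonoid N] (D : JDiag X) (a : X) (f : D.H → N) :
    ∑ᶠ ℓ : D.Lg a, f ℓ.1 = ∑ᶠ k : D.H, if D.mark k = some a then f k else 0 :=
  finsum_ite_eq (fun k => D.mark k = some a) f

theorem bj_symm (D : JDiag X) (s : D.H → Bool) (h k : D.H) : bj 𝕜 D s h k = bj 𝕜 D s k h := by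
  by_cases h1 : D.IsLeg h ∧ D.IsLeg k ∧ h ≠ k
  · rw [bj_of_leg 𝕜 h1.1 h1.2.1 h1.2.2, bj_of_leg 𝕜 h1.2.1 h1.1 h1.2.2.symm]
    congr 2
    simp [joinMod, pswap_comm h k, joinFun_comm D.mark h k]
  · rw [bj_of_not 𝕜 h1, bj_of_not 𝕜 (fun h2 => h1 ⟨h2.2.1, h2.1, h2.2.2.symm⟩)]

/-- Whether two legs are joined before or after the disjoint union with F makes no difference to the
glued diagrams. -/
theorem pairing_jn (F D : JDiag X) (h k : D.H) :
    pairing 𝕜 (el 𝕜 F) (jn 𝕜 D h k) =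
      bj 𝕜 (F.union D) Sum.isLeft (Sum.inr h) (Sum.inr k) := by
  by_cases h1 : D.IsLeg h ∧ D.IsLeg k ∧ h ≠ k
  · obtain ⟨hl, hk, hne⟩ := h1
    have l1 : (F.union D).IsLeg (Sum.inr h) := hl
    have l2 : (F.union D).IsLeg (Sum.inr k) := hk
    rw [jn_of_leg 𝕜 hl hk hne, pairing_el, glueSum_eq_bs]
    refine Eq.trans ?_ (bj_of_leg 𝕜 l1 l2 (fun e => hne (Sum.inr_injective e)) _).symm
    refine bs_isoOf 𝕜 (Equiv.refl (F.H ⊕ D.H)) ?_ ?_ ?_ fun x => rfl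
    · rintro (x | x)
      · exact (congrArg (F.union D).σ
          (pswap_of_ne (x := Sum.inl x) Sum.inl_ne_inr Sum.inl_ne_inr)).symm
      · exact congrArg (F.union D).σ (pswap_map Sum.inr_injective h k x)
    · rintro (x | x) <;> rfl
    · rintro (x | x)
      · exact joinFun_of_ne (x := Sum.inl x) (F.union D).mark Sum.inl_ne_inr Sum.inl_ne_inr
      · exact joinFun_map (f := D.mark) (g := (F.union D).mark) Sum.inr_injective (fun x => rfl) h k x
  · have h2 : ¬ ((F.union D).IsLeg (Sum.inr h) ∧ (F.union D).IsLeg (Sum.inr k) ∧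
        (Sum.inr h : F.H ⊕ D.H) ≠ Sum.inr k) :=
      fun h' => h1 ⟨h'.1, h'.2.1, fun e => h'.2.2 (congrArg _ e)⟩
    rw [jn_of_not 𝕜 h1, map_zero]
    exact (bj_of_not 𝕜 h2 _).symm

/-- Moving a strut to the front. -/
def unionStrut (F S D : JDiag X) : Iso ((F.union S).union D) (S.union (F.union D)) where
  e := ((Equiv.sumComm F.H S.H).sumCongr (Equiv.refl D.H)).trans (Equiv.sumAssoc S.H F.H D.H)
  σ_comm := by rintro ((h | h) | h) <;> rfl
  τ_comm := by rintro ((h | h) | h) <;> rfl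
  mark_comm := by rintro ((h | h) | h) <;> rfl

-- This is the situation once a strut with ends a, b has been absorbed by the leg ℓ of D. The leg
-- then stands for the b-end of the strut, so it counts for the side of F even though it belongs to
-- D. Its partner must therefore be a b-marked leg of D.
open Classical in
theorem bs_remark_inr (F D : JDiag X) (ℓ : D.H) (hl : D.IsLeg ℓ)
    (hl' : (F.union D).IsLeg (Sum.inr ℓ)) (b : X) :
    bs 𝕜 ((F.union D).modify ((F.union D).remarkMod (Sum.inr ℓ) hl' b))
        (Sum.elim (fun _ => true) (fun x => decide (x = ℓ))) =
      ∑ᶠ ℓ' : D.Lg b, bj 𝕜 (F.union D) Sum.isLeft (Sum.inr ℓ) (Sum.inr ℓ'.1) := by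
  have mk : ∀ x : D.H, x ≠ ℓ →
      remarkFun (α := F.H ⊕ D.H) (F.union D).mark (Sum.inr ℓ) b (Sum.inr x) = D.mark x := fun x hx =>
    remarkFun_of_ne (F.union D).mark b (fun e => hx (Sum.inr_injective e))
  have mk' : remarkFun (α := F.H ⊕ D.H) (F.union D).mark (Sum.inr ℓ) b (Sum.inr ℓ) = some b :=
    remarkFun_self (α := F.H ⊕ D.H) (F.union D).mark (Sum.inr ℓ) b
  have l1 : ((F.union D).modify ((F.union D).remarkMod (Sum.inr ℓ) hl' b)).IsLeg (Sum.inr ℓ) := by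
    change (remarkFun (α := F.H ⊕ D.H) (F.union D).mark (Sum.inr ℓ) b (Sum.inr ℓ)).isSome
    rw [mk']
    rfl
  refine (bs_expand 𝕜 _ _ (Sum.inr ℓ) l1).trans ?_
  refine (finsum_sumType (α := F.H) (β := D.H) _).trans ?_
  rw [finsum_lg D b (fun x => bj 𝕜 (F.union D) Sum.isLeft (Sum.inr ℓ) (Sum.inr x))]
  refine Eq.trans (congrArg₂ (· + ·) (Eq.trans (finsum_congr fun x => ?_) finsum_zero)
    (finsum_congr fun x => ?_)) (zero_add _)
  · refine if_neg fun h => ?_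
    have := h.2
    simp at this
  · by_cases hx : x = ℓ
    · have e2 : ¬ ((F.union D).IsLeg (Sum.inr ℓ) ∧ (F.union D).IsLeg (Sum.inr x) ∧
          (Sum.inr ℓ : F.H ⊕ D.H) ≠ Sum.inr x) := fun h => h.2.2 (by rw [hx])
      refine Eq.trans (if_neg fun h => ?_) (Eq.trans (if_congr Iff.rfl (bj_of_not 𝕜 e2 _) rfl)
        (ite_self _)).symm
      have := h.2
      simp [hx] at this
    · refine if_congr ?_ ?_ rfl
      · change remarkFun (α := F.H ⊕ D.H) (F.union D).mark (Sum.inr ℓ) b (Sum.inr x) =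
          remarkFun (α := F.H ⊕ D.H) (F.union D).mark (Sum.inr ℓ) b (Sum.inr ℓ) ∧
            decide (x = ℓ) = !decide (ℓ = ℓ) ↔ _
        rw [mk x hx, mk']
        simp [hx]
      · refine bj_congr 𝕜 (D := (F.union D).modify ((F.union D).remarkMod (Sum.inr ℓ) hl' b))
          (E := F.union D) (Equiv.refl (F.H ⊕ D.H)) (fun h => rfl) (fun h => rfl)
          (fun h h1 _ => ?_) (fun h h1 _ => ?_)
        · exact (remarkFun_of_ne (F.union D).mark b h1).symm
        · rcases h with h | h
          · rfl
          · have : h ≠ ℓ := fun e => h1 (by rw [e])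
            exact (decide_eq_false this).symm

-- Expand over the partner of the a-end of the strut, which must be an a-marked leg of D. The strut
-- is absorbed there (`bj_strut`), and the expansion over the partner of its b-end is then a joining
-- of two legs of D.
open Classical in
theorem pairing_mul_st_el (a b : X) (F D : JDiag X) :
    pairing 𝕜 (el 𝕜 F * st 𝕜 a b) (el 𝕜 D) = pairing 𝕜 (el 𝕜 F) (opD 𝕜 a b (el 𝕜 D)) := by
  let s : Bool ⊕ (F.H ⊕ D.H) → Bool := Sum.elim (fun _ => true) Sum.isLeft
  have e1 : bs 𝕜 ((F.union (strut a b)).union D) Sum.isLeft =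
      bs 𝕜 ((strut a b).union (F.union D)) s :=
    bs_iso 𝕜 (unionStrut F (strut a b) D) (by rintro ((h | h) | h) <;> rfl)
  rw [el_mul, pairing_el, glueSum_eq_bs, e1, opD_el, map_finsum',
    finsum_lg D a (fun ℓ => pairing 𝕜 (el 𝕜 F) (∑ᶠ ℓ' : D.Lg b, jn 𝕜 D ℓ ℓ'.1))]
  have l1 : ((strut a b).union (F.union D)).IsLeg (Sum.inl false) := rfl
  refine (bs_expand 𝕜 ((strut a b).union (F.union D)) s (Sum.inl false) l1).trans ?_
  refine (finsum_sumType (α := Bool) (β := F.H ⊕ D.H) _).trans ?_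
  refine Eq.trans (congrArg₂ (· + ·) (Eq.trans (finsum_congr fun x => ?_) finsum_zero)
    (finsum_sumType (α := F.H) (β := D.H) _)) (zero_add _) |>.trans ?_
  · refine if_neg fun h => ?_
    have h2 : true = !true := h.2
    exact absurd h2 (by decide)
  refine Eq.trans (congrArg₂ (· + ·) (Eq.trans (finsum_congr fun x => ?_) finsum_zero)
    (finsum_congr fun x => ?_)) (zero_add _)
  · refine if_neg fun h => ?_
    have h2 : true = !true := h.2
    exact absurd h2 (by decide)
  · by_cases hx : D.mark x = some a
    · have hl : D.IsLeg x := by simp [IsLeg, hx]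
      refine (if_pos ⟨hx, rfl⟩).trans (Eq.trans ?_ (if_pos hx).symm)
      rw [map_finsum', finsum_congr fun ℓ' : D.Lg b => pairing_jn 𝕜 F D x ℓ'.1]
      refine Eq.trans ?_ (bs_remark_inr 𝕜 F D x hl hl b)
      refine bj_strut 𝕜 a b (F.union D) (Sum.inr x) hl s _ ?_ ?_
      · exact decide_eq_true rfl
      · rintro (h | h) hh
        · rfl
        · have : h ≠ x := fun e => hh (by rw [e])
          exact decide_eq_false this
    · exact (if_neg fun h => hx h.1).trans (if_neg hx).symm

/-- Multiplication by a strut is adjoint to the joining of two legs. -/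
theorem pairing_mul_st (a b : X) (x y : Space 𝕜 X) :
    pairing 𝕜 (x * st 𝕜 a b) y = pairing 𝕜 x (opD 𝕜 a b y) := by
  have h : (pairing 𝕜).comp (LinearMap.mulRight 𝕜 (st 𝕜 a b)) =
      (pairing 𝕜).compl₂ (opD 𝕜 a b) :=
    space_hom_ext 𝕜 fun F => space_hom_ext 𝕜 fun D => pairing_mul_st_el 𝕜 a b F D
  exact congrArg (fun f => f x y) h

/-- A remarked leg is glued next, and gluing forgets its mark. The result is a sum over partners,
expressed with the original diagrams. With its counterpart on the right, it turns both sides of the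
adjunction for `opE` into the same double sum over pairs of legs. -/
theorem pairing_rm_left (F D : JDiag X) (a : X) (ℓ : F.H) (hl : F.IsLeg ℓ) :
    pairing 𝕜 (rm 𝕜 F ℓ a) (el 𝕜 D) =
      ∑ᶠ ℓ' : D.Lg a, bj 𝕜 (F.union D) Sum.isLeft (Sum.inl ℓ) (Sum.inr ℓ'.1) := by
  classical
  have mk : remarkFun F.mark ℓ a ℓ = some a := remarkFun_self F.mark ℓ a
  have l1 : ((F.modify (F.remarkMod ℓ hl a)).union D).IsLeg (Sum.inl ℓ) := by
    change (remarkFun F.mark ℓ a ℓ).isSome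
    rw [mk]
    rfl
  rw [rm_of_leg 𝕜 hl, pairing_el, glueSum_eq_bs]
  refine (bs_expand 𝕜 _ _ (Sum.inl ℓ) l1).trans ?_
  refine (finsum_sumType (α := F.H) (β := D.H) _).trans ?_
  rw [finsum_lg D a (fun x => bj 𝕜 (F.union D) Sum.isLeft (Sum.inl ℓ) (Sum.inr x))]
  refine Eq.trans (congrArg₂ (· + ·) (Eq.trans (finsum_congr fun x => ?_) finsum_zero)
    (finsum_congr fun x => ?_)) (zero_add _)
  · refine if_neg fun h => ?_
    have h2 : true = !true := h.2
    exact absurd h2 (by decide)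
  · refine if_congr ?_ ?_ rfl
    · change D.mark x = remarkFun F.mark ℓ a ℓ ∧ false = !true ↔ _
      rw [mk]
      simp
    · refine bj_congr 𝕜 (D := (F.modify (F.remarkMod ℓ hl a)).union D) (E := F.union D)
        (Equiv.refl (F.H ⊕ D.H)) ?_ (fun h => rfl)
        (fun h h1 _ => ?_) (fun h h1 _ => rfl)
      · rintro (h | h) <;> rfl
      · rcases h with h | h
        · exact (remarkFun_of_ne F.mark a (fun e => h1 (congrArg Sum.inl e))).symm
        · rfl

theorem pairing_rm_right (F D : JDiag X) (b : X) (ℓ' : D.H) (hl : D.IsLeg ℓ') :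
    pairing 𝕜 (el 𝕜 F) (rm 𝕜 D ℓ' b) =
      ∑ᶠ ℓ : F.Lg b, bj 𝕜 (F.union D) Sum.isLeft (Sum.inl ℓ.1) (Sum.inr ℓ') := by
  classical
  have mk : remarkFun D.mark ℓ' b ℓ' = some b := remarkFun_self D.mark ℓ' b
  have l1 : (F.union (D.modify (D.remarkMod ℓ' hl b))).IsLeg (Sum.inr ℓ') := by
    change (remarkFun D.mark ℓ' b ℓ').isSome
    rw [mk]
    rfl
  rw [rm_of_leg 𝕜 hl, pairing_el, glueSum_eq_bs]
  refine (bs_expand 𝕜 _ _ (Sum.inr ℓ') l1).trans ?_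
  refine (finsum_sumType (α := F.H) (β := D.H) _).trans ?_
  rw [finsum_lg F b (fun x => bj 𝕜 (F.union D) Sum.isLeft (Sum.inl x) (Sum.inr ℓ'))]
  refine Eq.trans (congrArg₂ (· + ·) (finsum_congr fun x => ?_)
    (Eq.trans (finsum_congr fun x => ?_) finsum_zero)) (add_zero _)
  · refine if_congr ?_ ?_ rfl
    · change F.mark x = remarkFun D.mark ℓ' b ℓ' ∧ true = !false ↔ _
      rw [mk]
      simp
    · refine (bj_congr 𝕜 (D := F.union (D.modify (D.remarkMod ℓ' hl b))) (E := F.union D)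
        (Equiv.refl (F.H ⊕ D.H)) ?_ (fun h => rfl)
        (fun h h1 _ => ?_) (fun h h1 _ => rfl)).trans (bj_symm 𝕜 (F.union D) Sum.isLeft _ _)
      · rintro (h | h) <;> rfl
      · rcases h with h | h
        · rfl
        · exact (remarkFun_of_ne D.mark b (fun e => h1 (congrArg Sum.inr e))).symm
  · refine if_neg fun h => ?_
    have h2 : false = !false := h.2
    exact absurd h2 (by decide)

/-- The operators `opE 𝕜 a b` and `opE 𝕜 b a` are adjoint. -/
theorem pairing_opE (a b : X) (x y : Space 𝕜 X) :
    pairing 𝕜 (opE 𝕜 b a x) y = pairing 𝕜 x (opE 𝕜 a b y) := by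
  have h : (pairing 𝕜).comp (opE 𝕜 b a) = (pairing 𝕜).compl₂ (opE 𝕜 a b) := by
    refine space_hom_ext 𝕜 fun F => space_hom_ext 𝕜 fun D => ?_
    change pairing 𝕜 (opE 𝕜 b a (el 𝕜 F)) (el 𝕜 D) = pairing 𝕜 (el 𝕜 F) (opE 𝕜 a b (el 𝕜 D))
    rw [← pairing_comm, opE_el, opE_el, map_finsum', map_finsum',
      finsum_congr fun ℓ : F.Lg b => (pairing_comm 𝕜 _ _).trans
        (pairing_rm_left 𝕜 F D a ℓ.1 ℓ.isLeg),
      finsum_congr fun ℓ' : D.Lg a => pairing_rm_right 𝕜 F D b ℓ'.1 ℓ'.isLeg]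
    -- Both sides are now sums over pairs of a b-marked leg of F and an a-marked leg of D that are
    -- glued to each other.
    exact finsum_swap _
  exact congrArg (fun f => f x y) h

/-! ### Pairing with the empty diagram -/

/-- The modification that turns a diagram without legs into a closed diagram. -/
def closedMod (D : JDiag X) (hD : D.Legless) : D.Mod Empty where
  π := 1
  ν := fun _ => none
  invol := fun _ => rfl
  supp := fun _ h => absurd rfl h
  ν_iff := fun h => by simp [hD h]

theorem eps_of_leg {D : JDiag X} {ℓ : D.H} (hl : D.IsLeg ℓ) : pairing 𝕜 1 (el 𝕜 D) = 0 := by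
  rw [← el_empty, pairing_el, glueSum_eq_bs]
  have l1 : ((empty X).union D).IsLeg (Sum.inr ℓ) := hl
  refine (bs_expand 𝕜 _ _ (Sum.inr ℓ) l1).trans ?_
  refine Eq.trans (finsum_congr fun x => ?_) finsum_zero
  refine if_neg fun h => ?_
  rcases x with x | x
  · exact x.elim
  · simpa using h.2

theorem eps_legless {D : JDiag X} (hD : D.Legless) :
    pairing 𝕜 1 (el 𝕜 D) = el 𝕜 (D.modify (D.closedMod hD)) := by
  rw [← el_empty, pairing_el]
  have hl : ∀ h, ¬ ((empty X).union D).IsLeg h := by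
    rintro (h | h)
    · exact h.elim
    · exact hD h
  have h1 : ((empty X).union D).IsMatching 1 ∧ IsGluing (empty X) D 1 :=
    ⟨⟨fun _ => rfl, fun h => iff_of_true rfl (hl h)⟩, fun h hh => absurd hh (hl h)⟩
  have u : ∀ π : {π : Equiv.Perm ((empty X).union D).H //
      ((empty X).union D).IsMatching π ∧ IsGluing (empty X) D π}, π = ⟨1, h1⟩ := fun π =>
    Subtype.ext (Equiv.ext fun h => (π.2.1.2 h).2 (hl h))
  unfold glueSum closeSum
  let i : Unique {π : Equiv.Perm ((empty X).union D).H //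
      ((empty X).union D).IsMatching π ∧ IsGluing (empty X) D π} := ⟨⟨⟨1, h1⟩⟩, u⟩
  refine (finsum_unique _).trans ?_
  refine el_isoOf 𝕜 (Equiv.emptySum Empty D.H) ?_ ?_ ?_
  · rintro (h | h)
    · exact h.elim
    · rfl
  · rintro (h | h)
    · exact h.elim
    · rfl
  · rintro (h | h)
    · exact h.elim
    · rfl

/-- Pairing with the empty diagram is the projection to legless diagrams, which is multiplicative
because a union is legless exactly when both parts are. -/
theorem eps_mul (x y : Space 𝕜 X) :
    pairing 𝕜 1 (x * y) = pairing 𝕜 1 x * pairing 𝕜 1 y := by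
  induction x using space_induction with
  | h0 => simp
  | hadd x x' hx hx' => simp only [add_mul, map_add, hx, hx']
  | hsmul c x hx => simp only [smul_mul_assoc, map_smul, hx]
  | hel D =>
    induction y using space_induction with
    | h0 => simp
    | hadd y y' hy hy' => simp only [mul_add, map_add, hy, hy']
    | hsmul c y hy => simp only [mul_smul_comm, map_smul, hy]
    | hel F =>
      rw [el_mul]
      by_cases hD : D.Legless
      · by_cases hF : F.Legless
        · have h : (D.union F).Legless := by
            rintro (h | h)
            · exact hD h
            · exact hF h
          rw [eps_legless 𝕜 hD, eps_legless 𝕜 hF, eps_legless 𝕜 h, el_mul]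
          refine el_isoOf 𝕜 (Equiv.refl (D.H ⊕ F.H)) ?_ ?_ ?_ <;>
          · rintro (h | h) <;> rfl
        · obtain ⟨ℓ, hl⟩ := not_forall_not.1 hF
          rw [eps_of_leg 𝕜 hl, mul_zero]
          exact eps_of_leg 𝕜 (D := D.union F) (ℓ := Sum.inr ℓ) hl
      · obtain ⟨ℓ, hl⟩ := not_forall_not.1 hD
        rw [eps_of_leg 𝕜 hl, zero_mul]
        exact eps_of_leg 𝕜 (D := D.union F) (ℓ := Sum.inl ℓ) hl

theorem circle_legless : (circle X).Legless := fun h hl => by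
  have : ((none : Option X).isSome : Prop) := hl
  simp at this

theorem eps_circle : pairing 𝕜 1 (el 𝕜 (circle X)) = el 𝕜 (circle Empty) := by
  rw [eps_legless 𝕜 circle_legless]
  exact el_isoOf 𝕜 (Equiv.refl Bool) (fun _ => rfl) (fun _ => rfl) (fun _ => rfl)

theorem empty_legless : (empty X).Legless := fun h => h.elim

theorem eps_one : pairing 𝕜 (1 : Space 𝕜 X) 1 = 1 := by
  rw [← el_empty, ← el_empty (X := Empty)]
  refine (eps_legless 𝕜 empty_legless).trans ?_
  exact el_isoOf 𝕜 (Equiv.refl Empty) (fun h => h.elim) (fun h => h.elim) (fun h => h.elim)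

/-! ### Polynomials in struts -/

/-- The subalgebra generated by the struts. -/
def strutAlg (X : Type u) : Subalgebra 𝕜 (Space 𝕜 X) :=
  Algebra.adjoin 𝕜 (Set.range fun p : X × X => st 𝕜 p.1 p.2)

theorem st_mem (a b : X) : st 𝕜 a b ∈ strutAlg 𝕜 X :=
  Algebra.subset_adjoin ⟨(a, b), rfl⟩

/-- A polynomial in struts acts on the other argument of the pairing as the same polynomial in the
operators `opD`. Such an operator commutes with multiplication by legless diagrams. -/
theorem exists_transpose {F : Space 𝕜 X} (hF : F ∈ strutAlg 𝕜 X) :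
    ∃ T : Space 𝕜 X →ₗ[𝕜] Space 𝕜 X, (∀ G y, pairing 𝕜 (G * F) y = pairing 𝕜 G (T y)) ∧
      ∀ D : JDiag X, D.Legless → ∀ y, T (el 𝕜 D * y) = el 𝕜 D * T y := by
  induction hF using Algebra.adjoin_induction with
  | mem F hF =>
    obtain ⟨⟨a, b⟩, rfl⟩ := hF
    exact ⟨opD 𝕜 a b, fun G y => pairing_mul_st 𝕜 a b G y,
      fun D hD y => opD_legless_mul 𝕜 a b hD y⟩
  | algebraMap r =>
    refine ⟨r • LinearMap.id, fun G y => ?_, fun D hD y => (mul_smul_comm r (el 𝕜 D) y).symm⟩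
    rw [mul_comm, ← Algebra.smul_def]
    simp
  | add F F' _ _ h h' =>
    obtain ⟨T, hT, hT'⟩ := h
    obtain ⟨U, hU, hU'⟩ := h'
    refine ⟨T + U, fun G y => ?_, fun D hD y => ?_⟩
    · rw [mul_add, map_add, LinearMap.add_apply, hT, hU, LinearMap.add_apply, map_add]
    · rw [LinearMap.add_apply, LinearMap.add_apply, hT' D hD, hU' D hD, mul_add]
  | mul F F' _ _ h h' =>
    obtain ⟨T, hT, hT'⟩ := h
    obtain ⟨U, hU, hU'⟩ := h'
    refine ⟨T ∘ₗ U, fun G y => ?_, fun D hD y => ?_⟩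
    · rw [← mul_assoc, hU, hT, LinearMap.comp_apply]
    · rw [LinearMap.comp_apply, LinearMap.comp_apply, hU' D hD, hT' D hD]

theorem pairing_legless_mul {F : Space 𝕜 X} (hF : F ∈ strutAlg 𝕜 X) {D : JDiag X}
    (hD : D.Legless) (y : Space 𝕜 X) :
    pairing 𝕜 F (el 𝕜 D * y) = pairing 𝕜 1 (el 𝕜 D) * pairing 𝕜 F y := by
  obtain ⟨T, hT, hT'⟩ := exists_transpose 𝕜 hF
  rw [← one_mul F, hT, hT, hT' D hD, eps_mul]

end JDiag

end

/-! ### Powers of one strut, and the relations P_{m+1} in terms of the pairing. -/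

noncomputable section

namespace JDiag

variable {X : Type u} (𝕜 : Type*) [Field 𝕜]

theorem rm_self (D : JDiag X) (a : X) (ℓ : D.Lg a) : rm 𝕜 D ℓ.1 a = el 𝕜 D := by
  rw [rm_of_leg 𝕜 ℓ.isLeg]
  refine el_isoOf 𝕜 (Equiv.refl D.H) (fun _ => rfl) (fun _ => rfl) (fun h => ?_)
  by_cases e : h = ℓ.1
  · rw [e]
    exact ℓ.2.trans (remarkFun_self D.mark ℓ.1 a).symm
  · exact (remarkFun_of_ne D.mark a e).symm

theorem opE_diag_el (a : X) (D : JDiag X) :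
    opE 𝕜 a a (el 𝕜 D) = (Nat.card (D.Lg a) : 𝕜) • el 𝕜 D := by
  rw [opE_el, finsum_congr (rm_self 𝕜 D a), finsum_const', Nat.cast_smul_eq_nsmul]

/-- `opE 𝕜 a b` as a derivation. -/
def derE (a b : X) : Derivation 𝕜 (Space 𝕜 X) (Space 𝕜 X) :=
  Derivation.mk' (opE 𝕜 a b) fun x y => by
    rw [opE_mul, smul_eq_mul, smul_eq_mul]
    ring

theorem opE_pow (a b : X) (x : Space 𝕜 X) (n : ℕ) :
    opE 𝕜 a b (x ^ n) = (n : 𝕜) • (x ^ (n - 1) * opE 𝕜 a b x) := by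
  have := (derE 𝕜 a b).leibniz_pow x n
  rw [Nat.cast_smul_eq_nsmul]
  exact this

theorem opE_one (a b : X) : opE 𝕜 a b 1 = 0 := (derE 𝕜 a b).map_one_eq_zero

theorem opE_algebraMap (a b : X) (r : 𝕜) : opE 𝕜 a b (algebraMap 𝕜 _ r) = 0 :=
  (derE 𝕜 a b).map_algebraMap r

theorem numLegs_join {D : JDiag X} {a k : D.H} (ha : D.IsLeg a) (hk : D.IsLeg k) (hne : a ≠ k) :
    D.numLegs = (D.modify (D.joinMod a k ha hk hne)).numLegs + 2 := by
  have e1 : D.numLegs = {h : D.H | D.IsLeg h}.ncard := Nat.card_coe_set_eq _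
  have e2 : (D.modify (D.joinMod a k ha hk hne)).numLegs =
      {h : D.H | D.IsLeg h ∧ h ≠ a ∧ h ≠ k}.ncard := by
    refine Eq.trans ?_ (Nat.card_coe_set_eq _)
    exact Nat.card_congr (Equiv.subtypeEquivRight (fun h => joinMod_isLeg))
  have e3 : {h : D.H | D.IsLeg h} = insert a (insert k {h : D.H | D.IsLeg h ∧ h ≠ a ∧ h ≠ k}) := by
    ext h
    simp only [Set.mem_ofPred_eq, Set.mem_insert_iff]
    constructor
    · intro hl
      by_cases e : h = a
      · exact Or.inl e
      · by_cases e' : h = k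
        · exact Or.inr (Or.inl e')
        · exact Or.inr (Or.inr ⟨hl, e, e'⟩)
    · rintro (rfl | rfl | h)
      · exact ha
      · exact hk
      · exact h.1
  rw [e1, e2, e3, Set.ncard_insert_of_notMem, Set.ncard_insert_of_notMem]
  · simp
  · simp [hne]

theorem numLegs_eq_zero {D : JDiag X} : D.numLegs = 0 ↔ D.Legless := by
  unfold numLegs
  rw [Nat.card_eq_zero]
  constructor
  · rintro (h | h) k hk
    · exact h.elim ⟨k, hk⟩
    · exact absurd (inferInstance : Finite {h // D.IsLeg h}) (not_finite_iff_infinite.2 h)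
  · intro h
    exact Or.inl ⟨fun k => h k.1 k.2⟩

theorem numLegs_eq_card_lg {D : JDiag X} {a : X} (h : ∀ ℓ, D.IsLeg ℓ → D.mark ℓ = some a) :
    D.numLegs = Nat.card (D.Lg a) :=
  Nat.card_congr (Equiv.subtypeEquivRight fun ℓ => ⟨h ℓ, fun e => by simp [IsLeg, e]⟩)

theorem closeSum_legless {D : JDiag X} (hD : D.Legless) :
    closeSum 𝕜 D (fun _ => True) = el 𝕜 (D.modify (D.closedMod hD)) := by
  have h1 : D.IsMatching 1 ∧ True :=
    ⟨⟨fun _ => rfl, fun h => iff_of_true rfl (hD h)⟩, trivial⟩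
  have u : ∀ π : {π : Equiv.Perm D.H // D.IsMatching π ∧ True}, π = ⟨1, h1⟩ := fun π =>
    Subtype.ext (Equiv.ext fun h => (π.2.1.2 h).2 (hD h))
  unfold closeSum
  let i : Unique {π : Equiv.Perm D.H // D.IsMatching π ∧ True} := ⟨⟨⟨1, h1⟩⟩, u⟩
  refine (finsum_unique _).trans ?_
  exact el_isoOf 𝕜 (Equiv.refl D.H) (fun _ => rfl) (fun _ => rfl) (fun _ => rfl)

/-- The factor counts the ways to assign the ordered ends of k labelled struts to a given matching.
In the induction one strut is removed: its first end has 2k choices of leg, and the sum over the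
second end is the expansion over the partner of that leg. -/
theorem pairing_pow_st (a : X) (k : ℕ) : ∀ D : JDiag X,
    (∀ ℓ, D.IsLeg ℓ → D.mark ℓ = some a) → D.numLegs = 2 * k →
    pairing 𝕜 (st 𝕜 a a ^ k) (el 𝕜 D) =
      ((2 ^ k * k.factorial : ℕ) : 𝕜) • closeSum 𝕜 D (fun _ => True) := by
  induction k with
  | zero =>
    intro D _ hn
    rw [pow_zero, eps_legless 𝕜 (numLegs_eq_zero.1 hn), closeSum_legless 𝕜 (numLegs_eq_zero.1 hn)]
    simp
  | succ k ih =>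
    intro D ha hn
    rw [pow_succ, pairing_mul_st, opD_el, map_finsum']
    have key : ∀ ℓ : D.Lg a, pairing 𝕜 (st 𝕜 a a ^ k) (∑ᶠ ℓ' : D.Lg a, jn 𝕜 D ℓ.1 ℓ'.1) =
        ((2 ^ k * k.factorial : ℕ) : 𝕜) • closeSum 𝕜 D (fun _ => True) := by
      intro ℓ
      have e1 : closeSum 𝕜 D (fun _ => True) =
          closeSum 𝕜 D (fun π => ∀ h, D.IsLeg h → (fun _ _ => True) h (π h)) :=
        closeSum_congr 𝕜 D fun π _ => by simp
      let f : {x // (D.IsLeg x ∧ ℓ.1 ≠ x) ∧ True ∧ True} → Space 𝕜 Empty := fun x =>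
        closeSum 𝕜 (D.modify (D.joinMod ℓ.1 x.1 ℓ.isLeg x.2.1.1 x.2.1.2)) fun _ => True
      have e2 : closeSum 𝕜 D (fun _ => True) = ∑ᶠ x, f x := by
        rw [e1]
        refine (closeSum_expand 𝕜 D (fun _ _ => True) ℓ.1 ℓ.isLeg).trans ?_
        refine finsum_congr fun x => closeSum_congr 𝕜 _ fun π _ => by simp
      rw [e2, map_finsum']
      have e3 := map_finsum' (LinearMap.lsmul 𝕜 (Space 𝕜 Empty)
        ((2 ^ k * k.factorial : ℕ) : 𝕜)) f
      simp only [LinearMap.lsmul_apply] at e3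
      rw [e3, finsum_lg D a (fun x => pairing 𝕜 (st 𝕜 a a ^ k) (jn 𝕜 D ℓ.1 x)),
        ← finsum_subtype_dite (fun x => (D.IsLeg x ∧ ℓ.1 ≠ x) ∧ True ∧ True)]
      · refine finsum_congr fun x => ?_
        rw [if_pos (ha _ x.2.1.1), jn_of_leg 𝕜 ℓ.isLeg x.2.1.1 x.2.1.2]
        refine ih _ (fun h hl => ?_) ?_
        · rw [joinMod_mark hl]
          exact ha _ (joinMod_isLeg.1 hl).1
        · have := numLegs_join ℓ.isLeg x.2.1.1 x.2.1.2
          omega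
      · intro x hx
        split_ifs with h
        · rw [jn_of_not, map_zero]
          exact fun h' => hx ⟨⟨h'.2.1, h'.2.2⟩, trivial, trivial⟩
        · rfl
    rw [finsum_congr key, finsum_const', ← numLegs_eq_card_lg ha, hn,
      ← Nat.cast_smul_eq_nsmul 𝕜, smul_smul, ← Nat.cast_mul]
    congr 2
    rw [Nat.factorial_succ]
    ring

/-- The diagram with all marks replaced by the unique element of `Unit`. -/
def toUnit (D : JDiag X) : JDiag Unit where
  H := D.H
  fin := D.fin
  σ := D.σ
  τ := D.τ
  mark := fun h => (D.mark h).map fun _ => ()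
  τ_invol := D.τ_invol
  τ_ne := D.τ_ne
  valence := D.valence
  mark_iff := fun h => by rw [Option.isSome_map, D.mark_iff]

theorem toUnit_isLeg {D : JDiag X} {h : D.H} : D.toUnit.IsLeg h ↔ D.IsLeg h := by
  simp [IsLeg, toUnit]

/-- Unrestricted matchings ignore the marks. This brings diagrams marked by X to the form of stubs
in which P_{m+1} is stated. -/
theorem closeSum_toUnit (D : JDiag X) :
    closeSum 𝕜 D (fun _ => True) = closeSum 𝕜 D.toUnit (fun _ => True) := by
  refine finsum_eq_of_bijective (Equiv.subtypeEquiv (Equiv.refl (Equiv.Perm D.H)) fun π => ?_)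
    (Equiv.bijective _) fun π => ?_
  · refine and_congr_left fun _ => and_congr_right fun _ => forall_congr' fun h => ?_
    exact iff_congr Iff.rfl (not_congr toUnit_isLeg.symm)
  · exact el_isoOf 𝕜 (Equiv.refl D.H) (fun _ => rfl) (fun _ => rfl) (fun _ => rfl)

theorem st_comm (a b : X) : st 𝕜 a b = st 𝕜 b a := el_strut_comm 𝕜 a b

variable [DecidableEq X]

theorem dl_self (a : X) : dl 𝕜 a a = 1 := if_pos rfl

theorem dl_of_ne {a b : X} (h : a ≠ b) : dl 𝕜 a b = 0 := if_neg h

theorem opE_st_pow (a b : X) (k : ℕ) :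
    opE 𝕜 b b (st 𝕜 a a ^ k) = (2 * k * dl 𝕜 a b : 𝕜) • st 𝕜 a a ^ k := by
  rw [opE_pow, opE_st]
  by_cases h : a = b
  · subst h
    rcases k with _ | k
    · simp
    · rw [Nat.add_sub_cancel, ← add_smul, mul_smul_comm, smul_smul, ← pow_succ, dl_self]
      congr 1
      ring
  · simp [dl_of_ne 𝕜 h]

/-- Both arguments are eigenvectors of the self-adjoint operator `opE` b b, which counts b-marked
legs; for different eigenvalues the pairing vanishes. -/
theorem pairing_pow_st_eq_zero (a b : X) (k : ℕ) (D : JDiag X)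
    (h : (Nat.card (D.Lg b) : 𝕜) ≠ 2 * k * dl 𝕜 a b) :
    pairing 𝕜 (st 𝕜 a a ^ k) (el 𝕜 D) = 0 := by
  have h1 := pairing_opE 𝕜 b b (st 𝕜 a a ^ k) (el 𝕜 D)
  rw [opE_st_pow, opE_diag_el, map_smul, map_smul, LinearMap.smul_apply, ← sub_eq_zero,
    ← sub_smul, smul_eq_zero, sub_eq_zero] at h1
  exact h1.resolve_left fun e => h e.symm

theorem opE_mem (a b : X) {F : Space 𝕜 X} (hF : F ∈ strutAlg 𝕜 X) :
    opE 𝕜 a b F ∈ strutAlg 𝕜 X := by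
  induction hF using Algebra.adjoin_induction with
  | mem F hF =>
    obtain ⟨⟨c, d⟩, rfl⟩ := hF
    rw [opE_st]
    exact add_mem (Subalgebra.smul_mem _ (st_mem 𝕜 _ _) _) (Subalgebra.smul_mem _ (st_mem 𝕜 _ _) _)
  | algebraMap r =>
    rw [opE_algebraMap]
    exact zero_mem _
  | add F F' _ _ h h' =>
    rw [map_add]
    exact add_mem h h'
  | mul F F' hF hF' h h' =>
    rw [opE_mul]
    exact add_mem (mul_mem h hF') (mul_mem hF h')

variable [CharZero 𝕜]

/-- The relations `P_{m+1}`, in terms of the pairing. -/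
theorem pairing_pow_mem (m : ℕ) (a : X) (y : Space 𝕜 X) :
    pairing 𝕜 (st 𝕜 a a ^ (m + 1)) y ∈ idealOP 𝕜 m := by
  induction y using space_induction with
  | h0 => simp
  | hadd x y hx hy =>
    rw [map_add]
    exact add_mem hx hy
  | hsmul c x hx =>
    rw [map_smul]
    exact Submodule.smul_of_tower_mem _ c hx
  | hel D =>
    -- The pairing is nonzero only if D has exactly 2m+2 legs, all marked a; then it is a multiple
    -- of a generator of the ideal.
    by_cases h1 : ∀ ℓ, D.IsLeg ℓ → D.mark ℓ = some a
    · by_cases h2 : D.numLegs = 2 * (m + 1)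
      · rw [pairing_pow_st 𝕜 a (m + 1) D h1 h2, closeSum_toUnit]
        refine Submodule.smul_of_tower_mem _ _ (Ideal.subset_span (Or.inr ⟨D.toUnit, ?_, rfl⟩))
        rw [← mul_add_one, ← h2]
        exact Nat.card_congr (Equiv.subtypeEquivRight fun h => toUnit_isLeg)
      · rw [pairing_pow_st_eq_zero 𝕜 a a]
        · exact zero_mem _
        · rw [← numLegs_eq_card_lg h1, dl_self, mul_one]
          exact_mod_cast h2
    · push Not at h1
      obtain ⟨ℓ, hl, hne⟩ := h1
      obtain ⟨b, hb⟩ := Option.isSome_iff_exists.1 hl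
      have hab : a ≠ b := fun e => hne (by rw [hb, e])
      rw [pairing_pow_st_eq_zero 𝕜 a b]
      · exact zero_mem _
      · rw [dl_of_ne 𝕜 hab, mul_zero]
        have : Nonempty (D.Lg b) := ⟨⟨ℓ, hb⟩⟩
        exact_mod_cast (Nat.card_pos (α := D.Lg b)).ne'

theorem pairing_pow_mul_mem (m : ℕ) (a : X) {F : Space 𝕜 X} (hF : F ∈ strutAlg 𝕜 X)
    (y : Space 𝕜 X) : pairing 𝕜 (st 𝕜 a a ^ (m + 1) * F) y ∈ idealOP 𝕜 m := by
  obtain ⟨T, hT, -⟩ := exists_transpose 𝕜 hF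
  rw [hT]
  exact pairing_pow_mem 𝕜 m a _

/-- The polarized relations `P_{m+1}`. -/
theorem pairing_pow_mul_st_mem (m : ℕ) (a b : X) {F : Space 𝕜 X} (hF : F ∈ strutAlg 𝕜 X)
    (y : Space 𝕜 X) : pairing 𝕜 (st 𝕜 a a ^ m * st 𝕜 a b * F) y ∈ idealOP 𝕜 m := by
  by_cases hab : a = b
  · subst hab
    rw [← pow_succ]
    exact pairing_pow_mul_mem 𝕜 m a hF y
  -- Polarization: the derivation `opE` a b sends `st a a ^ (m+1)` to a multiple of `st a a ^ m * st
  -- a b`. By adjointness it keeps the pairing in the ideal, and the remaining Leibniz term is in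
  -- the ideal already.
  have h1 : pairing 𝕜 (opE 𝕜 a b (st 𝕜 a a ^ (m + 1) * F)) y ∈ idealOP 𝕜 m := by
    rw [pairing_opE]
    exact pairing_pow_mul_mem 𝕜 m a hF _
  have h2 : opE 𝕜 a b (st 𝕜 a a ^ (m + 1) * F) =
      (2 * (m + 1) : 𝕜) • (st 𝕜 a a ^ m * st 𝕜 a b * F) + st 𝕜 a a ^ (m + 1) * opE 𝕜 a b F := by
    rw [opE_mul, opE_pow, opE_st, dl_self, one_smul, one_smul, st_comm 𝕜 b a,
      Nat.add_sub_cancel, ← two_smul 𝕜 (st 𝕜 a b), mul_smul_comm, smul_smul, smul_mul_assoc]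
    push_cast
    rw [mul_comm ((m : 𝕜) + 1)]
  rw [h2, map_add, LinearMap.add_apply, map_smul, LinearMap.smul_apply] at h1
  have h3 := (Submodule.add_mem_iff_left _ (pairing_pow_mul_mem 𝕜 m a (opE_mem 𝕜 a b hF) y)).1 h1
  have h4 := Submodule.smul_of_tower_mem (idealOP 𝕜 m) (2 * (m + 1) : 𝕜)⁻¹ h3
  rwa [smul_smul, inv_mul_cancel₀ (mul_ne_zero two_ne_zero (Nat.cast_add_one_ne_zero m)),
    one_smul] at h4

end JDiag

end

/-! ### The functional `negForm` with values in an algebra where O_m and P_{m+1} hold. -/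

noncomputable section

namespace JDiag

variable (𝕜 : Type*) [Field 𝕜] {X : Type u}

theorem prod_mem_strutAlg (S : Finset X) (f : X → ℕ) : ∏ x ∈ S, st 𝕜 x x ^ f x ∈ strutAlg 𝕜 X :=
  prod_mem fun x _ => pow_mem (st_mem 𝕜 x x) _

theorem opE_prod_eq_zero [DecidableEq X] (a b : X) (S : Finset X) (f : X → ℕ) (ha : a ∉ S) :
    opE 𝕜 a b (∏ x ∈ S, st 𝕜 x x ^ f x) = 0 := by
  induction S using Finset.induction_on with
  | empty => rw [Finset.prod_empty, opE_one]
  | insert c S hc ih =>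
    rw [Finset.mem_insert, not_or] at ha
    rw [Finset.prod_insert hc, opE_mul, ih ha.2, opE_pow, opE_st, dl_of_ne 𝕜 (Ne.symm ha.1)]
    simp

variable {R : Type*} [CommRing R] [Algebra 𝕜 R] (φ : Space 𝕜 Empty →ₐ[𝕜] R) (m : ℕ)

variable {φ m} in
theorem map_circle (hφ : ∀ a ∈ idealOP 𝕜 m, φ a = 0) :
    φ (el 𝕜 (circle Empty)) = algebraMap 𝕜 R (-2 * m : 𝕜) := by
  have h2 := hφ (el 𝕜 (circle Empty) + 2 * (m : Space 𝕜 Empty)) (Ideal.subset_span (Or.inl rfl))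
  have e : φ 2 = 2 := map_ofNat φ 2
  rw [map_add, ← eq_neg_iff_add_eq_zero, map_mul, e, map_natCast] at h2
  rw [h2, map_mul, map_neg, map_natCast, map_ofNat, neg_mul]

-- O_m becomes usable inside a pairing: a circle moves out of the pairing as a scalar and then takes
-- the value −2m.
variable {φ m} in
theorem map_pairing_circle_mul (hφ : ∀ a ∈ idealOP 𝕜 m, φ a = 0) {F : Space 𝕜 X} (hF : F ∈ strutAlg 𝕜 X) (x : Space 𝕜 X) :
    φ (pairing 𝕜 F (el 𝕜 (circle X) * x)) =
      (-2 * m : 𝕜) • φ (pairing 𝕜 F x) := by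
  rw [pairing_legless_mul 𝕜 hF circle_legless, eps_circle, map_mul, map_circle 𝕜 hφ, ← Algebra.smul_def]

variable [Fintype X]

variable (X) in
/-- The product of the `m`-th powers of the struts with two equal marks. -/
def diagStruts : Space 𝕜 X := ∏ x : X, st 𝕜 x x ^ m

variable (X) in
/-- Pairing with `diagStruts`, followed by a homomorphism. -/
def negForm : Space 𝕜 X →ₗ[𝕜] R := φ.toLinearMap ∘ₗ pairing 𝕜 (diagStruts 𝕜 X m)

theorem negForm_apply (x : Space 𝕜 X) :
    negForm 𝕜 X φ m x = φ (pairing 𝕜 (diagStruts 𝕜 X m) x) := rfl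

theorem diagStruts_mem : diagStruts 𝕜 X m ∈ strutAlg 𝕜 X :=
  prod_mem_strutAlg 𝕜 Finset.univ fun _ => m

/-- The operator that multiplies a diagram by its number of legs. -/
def opN : Space 𝕜 X →ₗ[𝕜] Space 𝕜 X := ∑ a, opE 𝕜 a a

theorem opN_apply (x : Space 𝕜 X) : opN 𝕜 x = ∑ a, opE 𝕜 a a x := by
  simp [opN]

theorem opN_mul (x y : Space 𝕜 X) : opN 𝕜 (x * y) = opN 𝕜 x * y + x * opN 𝕜 y := by
  rw [opN_apply, opN_apply, opN_apply, Finset.sum_congr rfl fun a _ => opE_mul 𝕜 a a x y,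
    Finset.sum_add_distrib, Finset.sum_mul, Finset.mul_sum]

theorem sum_card_lg (D : JDiag X) : ∑ a, Nat.card (D.Lg a) = D.numLegs := by
  have : ∀ a, Finite (D.Lg a) := fun a => inferInstance
  have e : (Σ a, D.Lg a) ≃ {h // D.IsLeg h} :=
    { toFun := fun p => ⟨p.2.1, p.2.isLeg⟩
      invFun := fun h => ⟨(D.mark h.1).get h.2, ⟨h.1, (Option.some_get h.2).symm⟩⟩
      left_inv := by
        rintro ⟨a, ℓ, hl⟩
        have h : (D.mark ℓ).get (by simp [hl]) = a := by simp [hl]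
        have key : ∀ b (hb : D.mark ℓ = some b), b = a →
            (⟨b, ⟨ℓ, hb⟩⟩ : Σ a, D.Lg a) = ⟨a, ⟨ℓ, hl⟩⟩ := by
          rintro b hb rfl
          rfl
        exact key _ _ h
      right_inv := fun h => rfl }
  rw [numLegs, ← Nat.card_congr e, Nat.card_sigma]

theorem opN_pow {h : Space 𝕜 X} (hh : opN 𝕜 h = (2 : 𝕜) • h) (j : ℕ) :
    opN 𝕜 (h ^ j) = (2 * j : 𝕜) • h ^ j := by
  induction j with
  | zero =>
    rw [pow_zero, opN_apply, Finset.sum_congr rfl fun a _ => opE_one 𝕜 a a]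
    simp
  | succ j ih =>
    rw [pow_succ, opN_mul, ih, hh, smul_mul_assoc, mul_smul_comm, ← add_smul]
    congr 1
    push_cast
    ring

variable {φ m} in
theorem negForm_circle_mul (hφ : ∀ a ∈ idealOP 𝕜 m, φ a = 0) (x : Space 𝕜 X) :
    negForm 𝕜 X φ m (el 𝕜 (circle X) * x) = (-2 * m : 𝕜) • negForm 𝕜 X φ m x :=
  map_pairing_circle_mul 𝕜 hφ (diagStruts_mem 𝕜 m) x

theorem opN_el (D : JDiag X) : opN 𝕜 (el 𝕜 D) = (D.numLegs : 𝕜) • el 𝕜 D := by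
  rw [opN_apply, Finset.sum_congr rfl fun a _ => opE_diag_el 𝕜 a D, ← Finset.sum_smul,
    ← Nat.cast_sum, sum_card_lg]

variable [DecidableEq X]

theorem diagStruts_eq (a : X) :
    diagStruts 𝕜 X m = st 𝕜 a a ^ m * ∏ x ∈ Finset.univ.erase a, st 𝕜 x x ^ m :=
  (Finset.mul_prod_erase _ _ (Finset.mem_univ a)).symm

theorem opE_diag_prod (a : X) (f : X → ℕ) :
    opE 𝕜 a a (∏ x, st 𝕜 x x ^ f x) = (2 * f a : 𝕜) • ∏ x, st 𝕜 x x ^ f x := by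
  rw [← Finset.mul_prod_erase _ _ (Finset.mem_univ a), opE_mul,
    opE_prod_eq_zero 𝕜 a a _ f (Finset.notMem_erase a _), opE_st_pow, dl_self, mul_one, mul_zero,
    add_zero, smul_mul_assoc]

/-- By adjointness the leg-counting operator acts on the diagonal struts instead, and these have 2m
ends of each mark. Thus `negForm` sees only diagrams with 2m legs of every mark. -/
theorem negForm_opE_self (a : X) (x : Space 𝕜 X) :
    negForm 𝕜 X φ m (opE 𝕜 a a x) = (2 * m : 𝕜) • negForm 𝕜 X φ m x := by
  have h : opE 𝕜 a a (diagStruts 𝕜 X m) = (2 * m : 𝕜) • diagStruts 𝕜 X m :=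
    opE_diag_prod 𝕜 a fun _ => m
  rw [negForm_apply, ← pairing_opE, h, map_smul]
  exact map_smul φ _ _

theorem negForm_opN (x : Space 𝕜 X) :
    negForm 𝕜 X φ m (opN 𝕜 x) = (2 * (m * Fintype.card X : ℕ) : 𝕜) • negForm 𝕜 X φ m x := by
  rw [opN_apply, map_sum, Finset.sum_congr rfl fun a _ => negForm_opE_self 𝕜 φ m a x,
    Finset.sum_const, Finset.card_univ, ← Nat.cast_smul_eq_nsmul 𝕜, smul_smul]
  congr 1
  push_cast
  ring

omit [DecidableEq X] in
theorem opN_st (a b : X) : opN 𝕜 (st 𝕜 a b) = (2 : 𝕜) • st 𝕜 a b := by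
  have : (strut a b).numLegs = 2 := by
    have h : ∀ x : Bool, (strut a b).IsLeg x := by
      rintro (_ | _) <;> rfl
    have e : {x // (strut a b).IsLeg x} ≃ Bool := Equiv.subtypeUnivEquiv h
    rw [numLegs, Nat.card_congr e]
    simp
  rw [opN_el, this]
  norm_num

omit [DecidableEq X] in
theorem opN_halfForm (Λ : Matrix X X 𝕜) : opN 𝕜 (halfForm 𝕜 Λ) = (2 : 𝕜) • halfForm 𝕜 Λ := by
  simp only [halfForm, map_smul, map_sum]
  rw [smul_comm (2 : 𝕜)]
  congr 1
  simp only [Finset.smul_sum]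
  refine Finset.sum_congr rfl fun a _ => Finset.sum_congr rfl fun b _ => ?_
  rw [smul_comm (2 : 𝕜)]
  exact congrArg _ (opN_st 𝕜 a b)

variable [CharZero 𝕜]

-- The analogue of the vanishing of the integral of a derivative: moving `opD` across produces the
-- polarized relation `st a a ^ m * st a b`.
variable {φ m} in
theorem negForm_opD (hφ : ∀ a ∈ idealOP 𝕜 m, φ a = 0) (a b : X) (x : Space 𝕜 X) : negForm 𝕜 X φ m (opD 𝕜 a b x) = 0 := by
  rw [negForm_apply, ← pairing_mul_st, diagStruts_eq 𝕜 m a, mul_right_comm]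
  exact hφ _
    (pairing_pow_mul_st_mem 𝕜 m a b (prod_mem_strutAlg 𝕜 _ fun _ => m) x)

theorem negForm_pow_mul_el (j : ℕ) {h : Space 𝕜 X} (hh : opN 𝕜 h = (2 : 𝕜) • h) (D : JDiag X)
    (hj : 2 * j + D.numLegs ≠ 2 * (m * Fintype.card X)) :
    negForm 𝕜 X φ m (h ^ j * el 𝕜 D) = 0 := by
  have h1 := negForm_opN 𝕜 φ m (h ^ j * el 𝕜 D)
  rw [opN_mul, opN_pow 𝕜 hh, opN_el, smul_mul_assoc, mul_smul_comm, ← add_smul, map_smul,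
    ← sub_eq_zero, ← sub_smul, smul_eq_zero, sub_eq_zero] at h1
  refine h1.resolve_left fun e => hj ?_
  exact_mod_cast e

theorem negForm_pow_mul_eq_zero (j : ℕ) {h : Space 𝕜 X} (hh : opN 𝕜 h = (2 : 𝕜) • h)
    (hj : m * Fintype.card X < j) (x : Space 𝕜 X) : negForm 𝕜 X φ m (h ^ j * x) = 0 := by
  induction x using space_induction with
  | h0 => simp
  | hadd x y hx hy => rw [mul_add, map_add, hx, hy, add_zero]
  | hsmul c x hx => rw [mul_smul_comm, map_smul, hx, smul_zero]
  | hel D => exact negForm_pow_mul_el 𝕜 φ m j hh D (by omega)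

/-- Normalization of `negForm`. -/
theorem negForm_pow_mul {h : Space 𝕜 X} (hh : opN 𝕜 h = (2 : 𝕜) • h) (x : Space 𝕜 X) :
    negForm 𝕜 X φ m (h ^ (m * Fintype.card X) * x) =
      negForm 𝕜 X φ m (h ^ (m * Fintype.card X)) *
        φ (pairing 𝕜 1 x) := by
  induction x using space_induction with
  | h0 => simp
  | hadd x y hx hy => simp only [mul_add, map_add, hx, hy]
  | hsmul c x hx => simp only [mul_smul_comm, map_smul, hx]
  | hel D =>
    -- The power of h already supplies all the legs that are needed, so any further leg gives 0,
    -- while a legless diagram factors out.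
    by_cases hD : D.Legless
    · rw [mul_comm (h ^ (m * Fintype.card X)), negForm_apply,
        pairing_legless_mul 𝕜 (diagStruts_mem 𝕜 m) hD, map_mul, mul_comm]
      rfl
    · have h1 : D.numLegs ≠ 0 := fun e => hD (numLegs_eq_zero.1 e)
      obtain ⟨ℓ, hl⟩ := not_forall_not.1 hD
      rw [negForm_pow_mul_el 𝕜 φ m _ hh D (by omega), eps_of_leg 𝕜 hl, map_zero, mul_zero]

end JDiag

end

/-! ### The contracted operator `opG`, its sl₂ relation, and integration by parts. -/

noncomputable section

namespace JDiag

variable (𝕜 : Type*) [Field 𝕜] {X : Type u} [Fintype X]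

/-- Joining two legs, contracted with the matrix `M`. -/
def opG (M : Matrix X X 𝕜) : Space 𝕜 X →ₗ[𝕜] Space 𝕜 X := ∑ a, ∑ b, M a b • opD 𝕜 a b

theorem opG_apply (M : Matrix X X 𝕜) (x : Space 𝕜 X) :
    opG 𝕜 M x = ∑ a, ∑ b, M a b • opD 𝕜 a b x := by
  simp [opG]

theorem halfForm_eq (Λ : Matrix X X 𝕜) :
    halfForm 𝕜 Λ = (1 / 2 : 𝕜) • ∑ a, ∑ b, Λ a b • st 𝕜 a b := rfl

theorem halfForm_add_smul (A B : Matrix X X 𝕜) (t : 𝕜) :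
    halfForm 𝕜 (A + t • B) = halfForm 𝕜 A + t • halfForm 𝕜 B := by
  simp only [halfForm_eq, Matrix.add_apply, Matrix.smul_apply, add_smul, Finset.sum_add_distrib,
    smul_add, smul_eq_mul, mul_smul, Finset.smul_sum, smul_comm t (1 / 2 : 𝕜)]

theorem pairing_mul_halfForm (M : Matrix X X 𝕜) (F y : Space 𝕜 X) :
    pairing 𝕜 (F * halfForm 𝕜 M) y = pairing 𝕜 F ((1 / 2 : 𝕜) • opG 𝕜 M y) := by
  simp only [halfForm_eq, opG_apply, mul_smul_comm, Finset.mul_sum, map_smul, map_sum,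
    LinearMap.smul_apply, LinearMap.sum_apply, pairing_mul_st]

theorem pairing_mul_halfForm_pow (M : Matrix X X 𝕜) (k : ℕ) (F y : Space 𝕜 X) :
    pairing 𝕜 (F * halfForm 𝕜 M ^ k) y =
      pairing 𝕜 F ((((1 / 2 : 𝕜) • opG 𝕜 M) ^ k) y) := by
  induction k generalizing y with
  | zero =>
    rw [pow_zero, pow_zero, mul_one]
    rfl
  | succ k ih =>
    rw [pow_succ, ← mul_assoc, pairing_mul_halfForm, ih, pow_succ]
    rfl

variable [DecidableEq X]

/-- Symmetry of M identifies the cross terms of `opD_st_mul` in pairs, whence the factors 2. -/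
theorem opG_st_mul {M : Matrix X X 𝕜} (hM : M.IsSymm) (c d : X) (x : Space 𝕜 X) :
    opG 𝕜 M (st 𝕜 c d * x) = st 𝕜 c d * opG 𝕜 M x + (2 * M c d) • (el 𝕜 (circle X) * x) +
      (2 : 𝕜) • ((∑ b, M c b • opE 𝕜 b d x) + ∑ b, M d b • opE 𝕜 b c x) := by
  have hs : ∀ a b, M a b = M b a := fun a b => (hM.apply a b).symm
  simp only [opG_apply, opD_st_mul, smul_add, Finset.sum_add_distrib, Finset.mul_sum,
    mul_smul_comm, add_smul, smul_smul]
  have k1 : ∀ (c d : X) (y : Space 𝕜 X),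
      ∑ a, ∑ b, (M a b * (dl 𝕜 c a * dl 𝕜 d b)) • y = M c d • y := by
    intro c d y
    have e : ∀ a b, (M a b * (dl 𝕜 c a * dl 𝕜 d b)) • y =
        dl 𝕜 c a • dl 𝕜 d b • M a b • y := fun a b => by
      rw [smul_smul, smul_smul]
      congr 1
      ring
    simp only [e, dl_smul]
    simp
  have k2 : ∀ (c d : X), ∑ a, ∑ b, (M a b * dl 𝕜 c a) • opE 𝕜 b d x =
      ∑ b, M c b • opE 𝕜 b d x := by
    intro c d
    rw [Finset.sum_comm]
    simp only [mul_comm _ (dl 𝕜 _ _), mul_smul, dl_smul]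
    simp
  have k3 : ∀ (c d : X), ∑ a, ∑ b, (M a b * dl 𝕜 c b) • opE 𝕜 a d x =
      ∑ b, M c b • opE 𝕜 b d x := by
    intro c d
    simp only [mul_comm _ (dl 𝕜 _ _), mul_smul, dl_smul]
    simp [hs c]
  simp only [k1, k2, k3, hs d c]
  module

/-- The contraction of Λ with its inverse is the identity. Its trace |X| multiplies the circle, and
the first order terms collapse to the leg-counting operator. This is the sl₂ relation between the
quadratic form, its dual Laplacian and the number of legs. -/
theorem opG_halfForm_mul {Λ : Matrix X X 𝕜} (hΛ : Λ.IsSymm) (hu : IsUnit Λ) [CharZero 𝕜]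
    (x : Space 𝕜 X) :
    opG 𝕜 Λ⁻¹ (halfForm 𝕜 Λ * x) = halfForm 𝕜 Λ * opG 𝕜 Λ⁻¹ x +
      ((Fintype.card X : 𝕜) • (el 𝕜 (circle X) * x) + (2 : 𝕜) • opN 𝕜 x) := by
  have hM : (Λ⁻¹).IsSymm := by
    rw [Matrix.IsSymm, Matrix.transpose_nonsing_inv, hΛ]
  have hs : ∀ a b, Λ⁻¹ a b = Λ⁻¹ b a := fun a b => (hM.apply a b).symm
  have hs' : ∀ a b, Λ a b = Λ b a := fun a b => (hΛ.apply a b).symm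
  have hd : IsUnit Λ.det := (Matrix.isUnit_iff_isUnit_det Λ).1 hu
  have hmul : ∀ b d, ∑ c, Λ c d * Λ⁻¹ c b = dl 𝕜 d b := by
    intro b d
    have := congrFun (congrFun (Matrix.mul_nonsing_inv Λ hd) d) b
    rw [Matrix.mul_apply, Matrix.one_apply] at this
    rw [dl, ← this]
    exact Finset.sum_congr rfl fun c _ => by rw [hs' c d]
  have e1 : ∑ c, ∑ d, Λ c d • (2 * Λ⁻¹ c d) • (el 𝕜 (circle X) * x) =
      (2 * Fintype.card X : 𝕜) • (el 𝕜 (circle X) * x) := by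
    rw [Finset.sum_comm]
    simp only [smul_smul, ← Finset.sum_smul]
    congr 1
    have : ∀ d, ∑ c, Λ c d * (2 * Λ⁻¹ c d) = 2 := by
      intro d
      have := hmul d d
      rw [dl_self] at this
      have e : ∑ c, Λ c d * (2 * Λ⁻¹ c d) = 2 * ∑ c, Λ c d * Λ⁻¹ c d := by
        rw [Finset.mul_sum]
        exact Finset.sum_congr rfl fun c _ => by ring
      rw [e, this, mul_one]
    rw [Finset.sum_congr rfl fun d _ => this d]
    simp [mul_comm]
  have e2 : ∑ c, ∑ d, Λ c d • ∑ b, Λ⁻¹ c b • opE 𝕜 b d x = opN 𝕜 x := by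
    rw [Finset.sum_comm, opN_apply]
    refine Finset.sum_congr rfl fun d _ => ?_
    simp only [Finset.smul_sum, smul_smul]
    rw [Finset.sum_comm]
    simp only [← Finset.sum_smul, hmul, dl_smul]
    simp
  have e3 : ∑ c, ∑ d, Λ c d • ∑ b, Λ⁻¹ d b • opE 𝕜 b c x = opN 𝕜 x := by
    rw [Finset.sum_comm, ← e2]
    exact Finset.sum_congr rfl fun c _ => Finset.sum_congr rfl fun d _ => by rw [hs' d c]
  have e4 : opG 𝕜 Λ⁻¹ (halfForm 𝕜 Λ * x) =
      (1 / 2 : 𝕜) • ∑ c, ∑ d, Λ c d • opG 𝕜 Λ⁻¹ (st 𝕜 c d * x) := by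
    simp only [halfForm_eq, smul_mul_assoc, Finset.sum_mul, map_smul, map_sum]
  have e5 : halfForm 𝕜 Λ * opG 𝕜 Λ⁻¹ x =
      (1 / 2 : 𝕜) • ∑ c, ∑ d, Λ c d • (st 𝕜 c d * opG 𝕜 Λ⁻¹ x) := by
    simp only [halfForm_eq, smul_mul_assoc, Finset.sum_mul]
  rw [e4, e5]
  simp only [opG_st_mul 𝕜 hM, smul_add, Finset.sum_add_distrib, e1]
  simp only [smul_comm _ (2 : 𝕜), ← Finset.smul_sum, e2, e3]
  match_scalars <;> field_simp
  norm_num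

/-- Commuting past the factors one at a time, the leg counter also sees the forms already passed,
with two legs each. The resulting sum 4(0 + 1 + ⋯ + j) is the term (j+1)·2j. -/
theorem opG_halfForm_pow_mul {Λ : Matrix X X 𝕜} (hΛ : Λ.IsSymm) (hu : IsUnit Λ) [CharZero 𝕜]
    (j : ℕ) (x : Space 𝕜 X) :
    opG 𝕜 Λ⁻¹ (halfForm 𝕜 Λ ^ (j + 1) * x) = halfForm 𝕜 Λ ^ (j + 1) * opG 𝕜 Λ⁻¹ x +
      (j + 1 : 𝕜) • (halfForm 𝕜 Λ ^ j * ((Fintype.card X : 𝕜) • (el 𝕜 (circle X) * x) +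
        (2 : 𝕜) • opN 𝕜 x + (2 * j : 𝕜) • x)) := by
  induction j with
  | zero => simp [opG_halfForm_mul 𝕜 hΛ hu]
  | succ j ih =>
    rw [pow_succ' _ (j + 1), mul_assoc, opG_halfForm_mul 𝕜 hΛ hu, ih, opN_mul,
      opN_pow 𝕜 (opN_halfForm 𝕜 Λ)]
    push_cast
    generalize halfForm 𝕜 Λ = h
    generalize opN 𝕜 x = y
    generalize el 𝕜 (circle X) = c
    generalize opG 𝕜 Λ⁻¹ x = z
    simp only [mul_add, mul_smul_comm, smul_mul_assoc, smul_add, pow_succ, smul_smul]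
    rw [show c * (h ^ j * h * x) = h ^ j * h * (c * x) by ring,
      show h * (h ^ j * (c * x)) = h ^ j * h * (c * x) by ring,
      show h * (h ^ j * y) = h ^ j * h * y by ring,
      show h * (h ^ j * x) = h ^ j * h * x by ring,
      show h * (h ^ j * h * z) = h ^ j * h * h * z by ring,
      show h * (h ^ j * h) * z = h ^ j * h * h * z by ring]
    module

variable [CharZero 𝕜] {R : Type*} [CommRing R] [Algebra 𝕜 R] {φ : Space 𝕜 Empty →ₐ[𝕜] R} {m : ℕ}

theorem negForm_opG (hφ : ∀ a ∈ idealOP 𝕜 m, φ a = 0) (M : Matrix X X 𝕜) (x : Space 𝕜 X) :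
    negForm 𝕜 X φ m (opG 𝕜 M x) = 0 := by
  simp [opG_apply, negForm_opD 𝕜 hφ]

/-- Integration by parts. -/
theorem negForm_pow_mul_opG (hφ : ∀ a ∈ idealOP 𝕜 m, φ a = 0) {Λ : Matrix X X 𝕜} (hΛ : Λ.IsSymm)
    (hu : IsUnit Λ) (j : ℕ) (x : Space 𝕜 X) :
    negForm 𝕜 X φ m (halfForm 𝕜 Λ ^ (j + 1) * opG 𝕜 Λ⁻¹ x) =
      (-2 * (j + 1) * ((m * Fintype.card X : ℕ) - j) : 𝕜) •
        negForm 𝕜 X φ m (halfForm 𝕜 Λ ^ j * x) := by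
  have h1 := negForm_opG 𝕜 hφ Λ⁻¹ (halfForm 𝕜 Λ ^ (j + 1) * x)
  have h2 : negForm 𝕜 X φ m (halfForm 𝕜 Λ ^ j * opN 𝕜 x) =
      (2 * (m * Fintype.card X : ℕ) - 2 * j : 𝕜) • negForm 𝕜 X φ m (halfForm 𝕜 Λ ^ j * x) := by
    have := negForm_opN 𝕜 φ m (halfForm 𝕜 Λ ^ j * x)
    rw [opN_mul, opN_pow 𝕜 (opN_halfForm 𝕜 Λ), map_add, smul_mul_assoc, map_smul] at this
    rw [sub_smul, ← this, add_sub_cancel_left]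
  have h3 : negForm 𝕜 X φ m (halfForm 𝕜 Λ ^ j * (el 𝕜 (circle X) * x)) =
      (-2 * m : 𝕜) • negForm 𝕜 X φ m (halfForm 𝕜 Λ ^ j * x) := by
    rw [mul_left_comm, negForm_circle_mul 𝕜 hφ]
  rw [opG_halfForm_pow_mul 𝕜 hΛ hu, map_add, map_smul, mul_add, mul_add, mul_smul_comm,
    mul_smul_comm, mul_smul_comm, map_add, map_add, map_smul, map_smul, map_smul, h2, h3] at h1
  -- With N = m|X|, the circle gives −2N, the leg counter gives 2(2N − 2j), and the forms already
  -- present give 2j, in total 2(N − j).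
  rw [eq_neg_of_add_eq_zero_left h1]
  push_cast
  module

/-- The formal Gaussian integral as the negative-dimensional one. -/
theorem negForm_pow_mul_eq (hφ : ∀ a ∈ idealOP 𝕜 m, φ a = 0) {Λ : Matrix X X 𝕜} (hΛ : Λ.IsSymm)
    (hu : IsUnit Λ) (k : ℕ) (j : ℕ) (hj : j + k = m * Fintype.card X) (x : Space 𝕜 X) :
    ((j.factorial : 𝕜)⁻¹) • negForm 𝕜 X φ m (halfForm 𝕜 Λ ^ j * x) =
      ((m * Fintype.card X).factorial : 𝕜)⁻¹ •
      (negForm 𝕜 X φ m (halfForm 𝕜 Λ ^ (m * Fintype.card X)) *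
        φ (pairing 𝕜 ((k.factorial : 𝕜)⁻¹ • halfForm 𝕜 (-Λ⁻¹) ^ k) x)) := by
  induction k generalizing j x with
  | zero =>
    obtain rfl : j = m * Fintype.card X := hj
    rw [negForm_pow_mul 𝕜 φ m (opN_halfForm 𝕜 Λ)]
    simp
  | succ k ih =>
    have h1 := ih (j + 1) (by omega) (opG 𝕜 Λ⁻¹ x)
    have hN : ((m * Fintype.card X : ℕ) : 𝕜) - j = k + 1 := by
      rw [← hj]
      push_cast
      ring
    have hneg : opG 𝕜 (-Λ⁻¹) x = -opG 𝕜 Λ⁻¹ x := by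
      simp [opG_apply]
    have hk : (k + 1 : 𝕜) ≠ 0 := Nat.cast_add_one_ne_zero k
    have hj : (j + 1 : 𝕜) ≠ 0 := Nat.cast_add_one_ne_zero j
    have h0 : (j.factorial : 𝕜) ≠ 0 := Nat.cast_ne_zero.2 j.factorial_ne_zero
    have h0' : (k.factorial : 𝕜) ≠ 0 := Nat.cast_ne_zero.2 k.factorial_ne_zero
    rw [negForm_pow_mul_opG 𝕜 hφ hΛ hu, hN, Nat.factorial_succ, smul_smul] at h1
    rw [pow_succ, map_smul, LinearMap.smul_apply, pairing_mul_halfForm, hneg, Nat.factorial_succ]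
    rw [map_smul, LinearMap.smul_apply] at h1
    simp only [map_smul, map_neg, smul_neg, mul_neg, mul_smul_comm] at h1 ⊢
    -- The scalar of integration by parts, with N − j = k + 1, is split off so that the case j + 1
    -- can be substituted. What is left over, −½/(k+1), is the factor that one more dual strut
    -- contributes to the exponential.
    have h2 : (j.factorial : 𝕜)⁻¹ • negForm 𝕜 X φ m (halfForm 𝕜 Λ ^ j * x) =
        (-(1 / 2) * (k + 1 : 𝕜)⁻¹ : 𝕜) •
        ((((j + 1) * j.factorial : ℕ) : 𝕜)⁻¹ * (-2 * (j + 1) * (k + 1))) •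
          negForm 𝕜 X φ m (halfForm 𝕜 Λ ^ j * x) := by
      rw [smul_smul]
      congr 1
      push_cast
      field_simp
    rw [h2, h1, ← smul_neg]
    have h3 : ∀ y : Space 𝕜 X, pairing 𝕜 (halfForm 𝕜 (-Λ⁻¹) ^ k) (-y) =
      -pairing 𝕜 (halfForm 𝕜 (-Λ⁻¹) ^ k) y := fun y => map_neg _ _
    push_cast
    rw [mul_inv]
    module

/-- Struts beyond the first m|X| are turned into operators `opG` on x. The identity with j = 0 then
rewrites the product as a multiple of `negForm` of an image of `opG`, which is 0. This disposes of
terms of the Gaussian integral that have no counterpart in the other integral. -/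
theorem negForm_mul_pairing_eq_zero (hφ : ∀ a ∈ idealOP 𝕜 m, φ a = 0) {Λ : Matrix X X 𝕜}
    (hΛ : Λ.IsSymm) (hu : IsUnit Λ) (k : ℕ) (hk : m * Fintype.card X < k) (x : Space 𝕜 X) :
    negForm 𝕜 X φ m (halfForm 𝕜 Λ ^ (m * Fintype.card X)) *
        φ (pairing 𝕜 (halfForm 𝕜 (-Λ⁻¹) ^ k) x) = 0 := by
  obtain ⟨l, rfl⟩ := Nat.exists_eq_add_of_lt hk
  have h0 : ((m * Fintype.card X).factorial : 𝕜) ≠ 0 :=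
    Nat.cast_ne_zero.2 (Nat.factorial_ne_zero _)
  have key : ∀ M y, negForm 𝕜 X φ m (halfForm 𝕜 Λ ^ (m * Fintype.card X)) *
        φ (pairing 𝕜 (halfForm 𝕜 (-Λ⁻¹) ^ (m * Fintype.card X)) (opG 𝕜 M y)) = 0 := by
    intro M y
    have h1 := negForm_pow_mul_eq 𝕜 hφ hΛ hu (m * Fintype.card X) 0 (zero_add _) (opG 𝕜 M y)
    rw [pow_zero, one_mul, negForm_opG 𝕜 hφ, smul_zero, map_smul, LinearMap.smul_apply, map_smul,
      mul_smul_comm, smul_smul] at h1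
    exact (smul_eq_zero.1 h1.symm).resolve_left (mul_ne_zero (inv_ne_zero h0) (inv_ne_zero h0))
  rw [add_assoc, pow_add, pairing_mul_halfForm_pow, pow_succ']
  change _ * φ (pairing 𝕜 _ ((1 / 2 : 𝕜) • opG 𝕜 (-Λ⁻¹) _)) = 0
  rw [map_smul, map_smul, mul_smul_comm, key, smul_zero]

end JDiag

end

/-! ### The normalization constant and the power of the determinant. -/

noncomputable section

namespace JDiag

-- Applying L to the coefficients of the power, expanded in t, gives a genuine polynomial over 𝕜.
-- Formal differentiation can then replace calculus.
open Polynomial in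
theorem exists_polynomial_pow {𝕜 A : Type*} [Field 𝕜] [CommRing A] [Algebra 𝕜 A] (L : A →ₗ[𝕜] 𝕜)
    (a b : A) (N : ℕ) : ∃ q : 𝕜[X], (∀ t, q.eval t = L ((a + t • b) ^ N)) ∧
      ∀ t, (derivative q).eval t = N * L ((a + t • b) ^ (N - 1) * b) := by
  let F : A[X] →ₗ[𝕜] 𝕜[X] := Polynomial.lsum fun n => (monomial n) ∘ₗ L
  have hF : ∀ n x, F (monomial n x) = monomial n (L x) := fun n x => by
    simp [F, Polynomial.lsum_apply, Polynomial.sum_monomial_index]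
  have h1 : ∀ (P : A[X]) t, (F P).eval t = L (P.eval (algebraMap 𝕜 A t)) := by
    intro P t
    induction P using Polynomial.induction_on' with
    | add P Q hP hQ => rw [map_add, eval_add, eval_add, map_add, hP, hQ]
    | monomial n x =>
      rw [hF, eval_monomial, eval_monomial, ← map_pow, mul_comm x, ← Algebra.smul_def, map_smul,
        smul_eq_mul, mul_comm]
  have h2 : ∀ P : A[X], derivative (F P) = F (derivative P) := by
    intro P
    induction P using Polynomial.induction_on' with
    | add P Q hP hQ => simp only [map_add, hP, hQ]
    | monomial n x =>
      rw [hF, derivative_monomial, derivative_monomial, hF, mul_comm x, ← nsmul_eq_mul, map_nsmul,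
        nsmul_eq_mul, mul_comm]
  refine ⟨F ((C a + X * C b) ^ N), fun t => ?_, fun t => ?_⟩
  · rw [h1]
    simp [Algebra.smul_def, mul_comm b]
  · rw [h2, h1, derivative_pow]
    have e : eval (algebraMap 𝕜 A t) (C (N : A) * (C a + X * C b) ^ (N - 1) *
        derivative (C a + X * C b)) = N • ((a + t • b) ^ (N - 1) * b) := by
      simp [Algebra.smul_def, mul_assoc, mul_comm b (algebraMap 𝕜 A t)]
    rw [e, map_nsmul, nsmul_eq_mul]

-- Jacobi's formula at an invertible point: shift t to the origin, factor out the invertible matrix,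
-- and use that the linear coefficient of det(1 + XM) is the trace of M.
open Polynomial in
theorem derivative_eval_det {𝕜 n : Type*} [Field 𝕜] [Fintype n] [DecidableEq n] (A B : Matrix n n 𝕜)
    (t : 𝕜) (h : IsUnit (A + t • B).det) :
    (derivative (A.map C + (X : 𝕜[X]) • B.map C).det).eval t =
      (A + t • B).det * ((A + t • B)⁻¹ * B).trace := by
  have e : (A.map C + (X : 𝕜[X]) • B.map C).det.comp (X + C t) =
      C (A + t • B).det * (1 + (X : 𝕜[X]) • ((A + t • B)⁻¹ * B).map C).det := by
    have h1 : (A.map C + (X : 𝕜[X]) • B.map C).det.comp (X + C t) =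
        ((A + t • B).map C + (X : 𝕜[X]) • B.map C).det := by
      rw [← coe_compRingHom_apply, RingHom.map_det]
      congr 1
      ext1 i j
      simp
      ring
    have h2 : (A + t • B).map C + (X : 𝕜[X]) • B.map C =
        (A + t • B).map C * (1 + (X : 𝕜[X]) • ((A + t • B)⁻¹ * B).map C) := by
      rw [mul_add, mul_one, mul_smul_comm, ← Matrix.map_mul, Matrix.mul_nonsing_inv_cancel_left _ _ h]
    rw [h1, h2, Matrix.det_mul]
    congr 1
    exact (RingHom.map_det (C : 𝕜 →+* 𝕜[X]) (A + t • B)).symm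
  have h3 := congrArg (fun p => (derivative p).eval 0) e
  simp only [derivative_comp, derivative_mul, derivative_C, eval_mul, eval_comp, eval_add] at h3
  rw [Matrix.derivative_det_one_add_X_smul] at h3
  simpa using h3

-- The difference of the two sides solves the same linear equation and vanishes at 0. Since D(0) =
-- 1, comparing coefficients of degree n expresses (n+1) times its next coefficient through earlier
-- ones, so in characteristic 0 all of them vanish.
open Polynomial in
theorem eq_C_mul_pow_of_derivative {𝕜 : Type*} [Field 𝕜] [CharZero 𝕜] {p D : 𝕜[X]} (m : ℕ)
    (hD : D.eval 0 = 1) (h : derivative p * D = m * derivative D * p) :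
    p = C (p.eval 0) * D ^ m := by
  rw [← sub_eq_zero]
  set r := p - C (p.eval 0) * D ^ m with hr
  have h1 : derivative r * D = m * derivative D * r := by
    rw [hr, derivative_sub, sub_mul, h, derivative_C_mul, derivative_pow]
    rcases m with _ | m
    · simp
    · rw [Nat.add_sub_cancel]
      simp only [map_natCast]
      ring
  have h0 : r.coeff 0 = 0 := by
    rw [coeff_zero_eq_eval_zero, hr]
    simp [hD]
  have hD0 : D.coeff 0 = 1 := by rw [coeff_zero_eq_eval_zero, hD]
  have key : ∀ n, ∀ i ≤ n, r.coeff i = 0 := by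
    intro n
    induction n with
    | zero =>
      intro i hi
      rw [Nat.le_zero.1 hi, h0]
    | succ n ih =>
      intro i hi
      rcases hi.lt_or_eq with hi | rfl
      · exact ih i (Nat.lt_succ_iff.1 hi)
      · have h2 := congrArg (fun q => q.coeff n) h1
        simp only [coeff_mul] at h2
        -- On the left only the coefficient of degree n + 1 is not yet known to vanish, and it meets
        -- D(0) = 1; the right side involves coefficients up to degree n only.
        rw [Finset.sum_eq_single (n, 0), Finset.sum_eq_zero, coeff_derivative, hD0, mul_one] at h2
        · exact (mul_eq_zero.1 h2).resolve_right (Nat.cast_add_one_ne_zero n)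
        · intro x hx
          rw [Finset.HasAntidiagonal.mem_antidiagonal] at hx
          rw [ih x.2 (by omega), mul_zero]
        · intro x hx hne
          rw [Finset.HasAntidiagonal.mem_antidiagonal] at hx
          have : x.1 + 1 ≤ n := by
            by_contra hc
            exact hne (Prod.ext (by change x.1 = n; omega) (by change x.2 = 0; omega))
          rw [coeff_derivative, ih _ this, zero_mul, zero_mul]
        · intro hx
          exact absurd (Finset.HasAntidiagonal.mem_antidiagonal.2 (by simp)) hx
  exact Polynomial.ext fun n => key n n le_rfl

variable (𝕜 : Type*) [Field 𝕜] {X : Type u} [DecidableEq X] [CharZero 𝕜]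
  {R : Type*} [CommRing R] [Algebra 𝕜 R] {φ : Space 𝕜 Empty →ₐ[𝕜] R} {m : ℕ}

-- A Laplacian acting on a power of a squared radius. The factor y, harmless to both operators,
-- carries the other variables; the value −2m of the circle plays the role of the dimension.
omit [CharZero 𝕜] in
theorem opD_st_pow_mul (a : X) {y : Space 𝕜 X} (hE : opE 𝕜 a a y = 0) (hD : opD 𝕜 a a y = 0)
    (k : ℕ) : opD 𝕜 a a (st 𝕜 a a ^ (k + 1) * y) =
      (2 * (k + 1) : 𝕜) • (el 𝕜 (circle X) * (st 𝕜 a a ^ k * y)) +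
        (4 * (k + 1) * k : 𝕜) • (st 𝕜 a a ^ k * y) := by
  have h1 : ∀ k : ℕ, opE 𝕜 a a (st 𝕜 a a ^ k * y) = (2 * k : 𝕜) • (st 𝕜 a a ^ k * y) := fun k => by
    rw [opE_mul, hE, opE_st_pow, dl_self, mul_zero, add_zero, mul_one, smul_mul_assoc]
  induction k with
  | zero =>
    have := h1 0
    rw [pow_zero, one_mul] at this
    rw [zero_add, pow_one, opD_st_mul, hD, pow_zero, one_mul, this]
    simp only [dl_self, mul_zero, zero_add, Nat.cast_zero, one_smul, zero_smul, add_zero]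
    module
  | succ k ih =>
    rw [pow_succ' _ (k + 1), mul_assoc, opD_st_mul, ih, h1, dl_self]
    simp only [one_smul, mul_add, mul_smul_comm]
    rw [show st 𝕜 a a * (el 𝕜 (circle X) * (st 𝕜 a a ^ k * y)) =
      el 𝕜 (circle X) * (st 𝕜 a a ^ (k + 1) * y) by ring,
      show st 𝕜 a a * (st 𝕜 a a ^ k * y) = st 𝕜 a a ^ (k + 1) * y by ring]
    push_cast
    module

-- With a circle equal to −2m, lowering the power from i + 1 to i costs 2(i+1)(−2m) + 4(i+1)i =
-- 4(i+1)(i−m).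
omit [CharZero 𝕜] in
theorem map_pairing_pow_mul (hφ : ∀ a ∈ idealOP 𝕜 m, φ a = 0) (a : X) {F y : Space 𝕜 X}
    (hF : F ∈ strutAlg 𝕜 X) (hE : opE 𝕜 a a y = 0) (hD : opD 𝕜 a a y = 0) (k : ℕ) :
    φ (pairing 𝕜 (F * st 𝕜 a a ^ k) (st 𝕜 a a ^ k * y)) =
      (∏ i ∈ Finset.range k, (4 * (i + 1) * (i - m) : 𝕜)) • φ (pairing 𝕜 F y) := by
  induction k with
  | zero => simp
  | succ k ih =>
    have hF' : F * st 𝕜 a a ^ k ∈ strutAlg 𝕜 X := mul_mem hF (pow_mem (st_mem 𝕜 a a) k)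
    rw [pow_succ, ← mul_assoc, pairing_mul_st, ← pow_succ, opD_st_pow_mul 𝕜 a hE hD, map_add,
      map_smul, map_smul, map_add, map_smul, map_smul, map_pairing_circle_mul 𝕜 hφ hF', ih,
      Finset.prod_range_succ]
    module

omit [CharZero 𝕜] [DecidableEq X] in
theorem opD_one (a b : X) : opD 𝕜 a b 1 = 0 := by
  rw [← el_empty, opD_el]
  refine (finsum_congr fun ℓ => ?_).trans finsum_zero
  exact ℓ.1.elim

omit [CharZero 𝕜] in
theorem opD_prod_eq_zero (a : X) (S : Finset X) (f : X → ℕ) (ha : a ∉ S) :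
    opD 𝕜 a a (∏ x ∈ S, st 𝕜 x x ^ f x) = 0 := by
  have h2 : ∀ c ≠ a, ∀ y : Space 𝕜 X, opD 𝕜 a a y = 0 → ∀ k,
      opD 𝕜 a a (st 𝕜 c c ^ k * y) = 0 := by
    intro c hc y hy k
    induction k with
    | zero => rw [pow_zero, one_mul, hy]
    | succ k ih =>
      rw [pow_succ', mul_assoc, opD_st_mul, ih, dl_of_ne 𝕜 hc]
      simp
  induction S using Finset.induction_on with
  | empty => rw [Finset.prod_empty, opD_one]
  | insert c S hc ih =>
    rw [Finset.mem_insert, not_or] at ha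
    rw [Finset.prod_insert hc]
    exact h2 c (Ne.symm ha.1) _ (ih ha.2) _

-- The marks are treated one at a time: the struts of different marks do not interact, so each
-- contributes the same product ∏ 4(i+1)(i−m) over i < m.
omit [CharZero 𝕜] in
theorem map_pairing_prod (hφ : ∀ a ∈ idealOP 𝕜 m, φ a = 0) (S : Finset X) :
    φ (pairing 𝕜 (∏ x ∈ S, st 𝕜 x x ^ m) (∏ x ∈ S, st 𝕜 x x ^ m)) =
      algebraMap 𝕜 R (((-4) ^ m * (m.factorial : 𝕜) ^ 2) ^ S.card) := by
  have hc : ∏ i ∈ Finset.range m, (4 * (i + 1) * (i - m) : 𝕜) = (-4) ^ m * (m.factorial : 𝕜) ^ 2 := by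
    have h1 : ∏ i ∈ Finset.range m, (i + 1 : 𝕜) = m.factorial := by
      rw [← Finset.prod_range_add_one_eq_factorial]
      push_cast
      rfl
    have h2 : ∏ i ∈ Finset.range m, (m - i : 𝕜) = m.factorial := by
      rw [← h1, ← Finset.prod_range_reflect]
      refine Finset.prod_congr rfl fun i hi => ?_
      rw [Finset.mem_range] at hi
      rw [show m - 1 - i = m - (i + 1) by omega, Nat.cast_sub hi]
      push_cast
      ring
    have h3 : ∏ i ∈ Finset.range m, (4 * (i + 1) * (i - m) : 𝕜) =
        ∏ i ∈ Finset.range m, (-4 * ((i + 1) * (m - i)) : 𝕜) :=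
      Finset.prod_congr rfl fun i _ => by ring
    rw [h3, Finset.prod_mul_distrib, Finset.prod_mul_distrib, h1, h2, Finset.prod_const,
      Finset.card_range, sq]
  induction S using Finset.induction_on with
  | empty => simp [eps_one]
  | insert a S ha ih =>
    rw [Finset.prod_insert ha]
    nth_rw 1 [mul_comm (st 𝕜 a a ^ m)]
    rw [map_pairing_pow_mul 𝕜 hφ a (prod_mem_strutAlg 𝕜 S fun _ => m)
        (opE_prod_eq_zero 𝕜 a a S (fun _ => m) ha) (opD_prod_eq_zero 𝕜 a S (fun _ => m) ha), ih, hc,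
      Finset.card_insert_of_notMem ha, pow_succ' _ S.card, map_mul, Algebra.smul_def]

variable [Fintype X]

theorem negForm_prod_of_ne (f : X → ℕ) (h : f ≠ fun _ => m) :
    negForm 𝕜 X φ m (∏ x, st 𝕜 x x ^ f x) = 0 := by
  obtain ⟨a, ha⟩ := Function.ne_iff.1 h
  have h1 := negForm_opE_self 𝕜 φ m a (∏ x, st 𝕜 x x ^ f x)
  rw [opE_diag_prod, map_smul, ← sub_eq_zero, ← sub_smul, smul_eq_zero, sub_eq_zero] at h1
  refine h1.resolve_left fun e => ha ?_
  exact_mod_cast mul_left_cancel₀ two_ne_zero e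

/-- In the multinomial expansion of (½ ∑ s_aa)^(m|X|) only the monomial with all exponents m has the
right number of legs of each mark. -/
theorem negForm_halfForm_one_pow (hφ : ∀ a ∈ idealOP 𝕜 m, φ a = 0) :
    negForm 𝕜 X φ m (halfForm 𝕜 1 ^ (m * Fintype.card X)) =
      algebraMap 𝕜 R ((m * Fintype.card X).factorial *
        ((-2) ^ m * m.factorial) ^ Fintype.card X) := by
  have e : halfForm 𝕜 (1 : Matrix X X 𝕜) = (1 / 2 : 𝕜) • ∑ a, st 𝕜 a a := by
    rw [halfForm_eq]
    congr 1
    refine Finset.sum_congr rfl fun a _ => ?_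
    rw [Finset.sum_eq_single a]
    · simp
    · intro b _ hb
      rw [Matrix.one_apply_ne hb.symm, zero_smul]
    · simp
  have hm : (fun _ : X => m) ∈ Finset.piAntidiag Finset.univ (m * Fintype.card X) := by
    rw [Finset.mem_piAntidiag]
    simp [mul_comm]
  rw [e, smul_pow, Finset.sum_pow_eq_sum_piAntidiag, map_smul, map_sum,
    Finset.sum_eq_single_of_mem _ hm]
  · have h1 : Nat.multinomial Finset.univ (fun _ : X => m) * m.factorial ^ Fintype.card X =
        (m * Fintype.card X).factorial := by
      have := Nat.multinomial_spec Finset.univ (fun _ : X => m)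
      rw [Finset.prod_const, Finset.sum_const, Finset.card_univ, smul_eq_mul, mul_comm (Fintype.card X)]
        at this
      rw [← this, mul_comm]
    have h2 : negForm 𝕜 X φ m (∏ x : X, st 𝕜 x x ^ m) = _ := map_pairing_prod 𝕜 hφ Finset.univ
    rw [← nsmul_eq_mul, map_nsmul, h2, ← Nat.cast_smul_eq_nsmul 𝕜, Algebra.smul_def,
      Algebra.smul_def, ← map_mul, ← map_mul, ← h1, Finset.card_univ]
    congr 1
    push_cast
    rw [pow_mul, mul_pow, mul_pow, ← pow_mul, ← pow_mul, ← pow_mul, ← pow_mul]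
    have h3 : (-4 : 𝕜) ^ (m * Fintype.card X) =
      2 ^ (m * Fintype.card X) * (-2) ^ (m * Fintype.card X) := by
      rw [← mul_pow]
      norm_num
    rw [h3, one_div, inv_pow]
    have h4 : (2 : 𝕜) ^ (m * Fintype.card X) ≠ 0 := pow_ne_zero _ two_ne_zero
    field_simp
    ring
  · intro f _ hf
    rw [← nsmul_eq_mul, map_nsmul, negForm_prod_of_ne 𝕜 f hf, smul_zero]

/-- The derivative of the normalization constant in the direction B. Integration by parts is applied
to the form of B, on which `opG` takes the value tr(Λ⁻¹B) times a circle, and the circle is −2m.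
Comparison with Jacobi's formula shows the logarithmic derivative of the m-th power of the
determinant. -/
theorem negForm_halfForm_pow_sub_one_mul (hφ : ∀ a ∈ idealOP 𝕜 m, φ a = 0) {Λ : Matrix X X 𝕜}
    (hΛ : Λ.IsSymm) (hu : IsUnit Λ) {B : Matrix X X 𝕜} (hB : B.IsSymm) :
    ((m * Fintype.card X : ℕ) : 𝕜) •
      negForm 𝕜 X φ m (halfForm 𝕜 Λ ^ (m * Fintype.card X - 1) * halfForm 𝕜 B) =
      (m * (Λ⁻¹ * B).trace : 𝕜) • negForm 𝕜 X φ m (halfForm 𝕜 Λ ^ (m * Fintype.card X)) := by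
  have e : opG 𝕜 Λ⁻¹ (halfForm 𝕜 B) = (Λ⁻¹ * B).trace • el 𝕜 (circle X) := by
    have hM : (Λ⁻¹).IsSymm := by
      rw [Matrix.IsSymm, Matrix.transpose_nonsing_inv, hΛ]
    have h1 : opG 𝕜 Λ⁻¹ (1 : Space 𝕜 X) = 0 := by simp [opG_apply, opD_one]
    have h2 : ∀ c d, opG 𝕜 Λ⁻¹ (st 𝕜 c d) = (2 * Λ⁻¹ c d) • el 𝕜 (circle X) := fun c d => by
      have := opG_st_mul 𝕜 hM c d 1
      simp only [h1, opE_one, smul_zero, Finset.sum_const_zero, add_zero, mul_one, mul_zero,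
        zero_add] at this
      exact this
    simp only [halfForm_eq, map_smul, map_sum, h2, smul_smul, ← Finset.sum_smul]
    congr 1
    rw [Matrix.trace, Finset.mul_sum]
    refine Finset.sum_congr rfl fun c _ => ?_
    rw [Matrix.diag_apply, Matrix.mul_apply, Finset.mul_sum]
    refine Finset.sum_congr rfl fun d _ => ?_
    rw [← hB.apply]
    ring
  -- The exponent m|X| − 1 is meaningful only for m|X| > 0; otherwise m = 0 or X is empty, and both
  -- sides vanish.
  rcases hN : m * Fintype.card X with _ | N
  · rcases Nat.mul_eq_zero.1 hN with h | h
    · simp [h]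
    · have := Fintype.card_eq_zero_iff.1 h
      simp [Matrix.trace]
  · have h1 := negForm_pow_mul_opG 𝕜 hφ hΛ hu N (halfForm 𝕜 B)
    rw [e, mul_smul_comm, mul_comm, map_smul, negForm_circle_mul 𝕜 hφ, hN] at h1
    rw [Nat.add_sub_cancel]
    have h2 : (-2 : 𝕜) ≠ 0 := by norm_num
    refine smul_right_injective R h2 ?_
    change (-2 : 𝕜) • _ = (-2 : 𝕜) • _
    have h3 : (-2 * (N + 1) * ((N + 1 : ℕ) - N) : 𝕜) = -2 * (N + 1 : ℕ) := by
      push_cast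
      ring
    rw [h3] at h1
    rw [smul_smul, ← h1]
    module

theorem negForm_halfForm_pow (hφ : ∀ a ∈ idealOP 𝕜 m, φ a = 0) {Λ : Matrix X X 𝕜}
    (hΛ : Λ.IsSymm) :
    negForm 𝕜 X φ m (halfForm 𝕜 Λ ^ (m * Fintype.card X)) =
      algebraMap 𝕜 R ((m * Fintype.card X).factorial *
        ((-2) ^ m * m.factorial) ^ Fintype.card X * Λ.det ^ m) := by
  rw [← sub_eq_zero]
  -- Linear functionals separate the points of the 𝕜-module, so the equation reduces to one between
  -- scalars, where polynomials in t can be used.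
  refine (Module.forall_dual_apply_eq_zero_iff 𝕜 _).1 fun f => ?_
  rw [map_sub, sub_eq_zero]
  set N := m * Fintype.card X with hN
  obtain ⟨q, hq, hq'⟩ := exists_polynomial_pow (f ∘ₗ negForm 𝕜 X φ m) (halfForm 𝕜 1)
    (halfForm 𝕜 (Λ - 1)) N
  set D := ((1 : Matrix X X 𝕜).map Polynomial.C +
    (Polynomial.X : Polynomial 𝕜) • (Λ - 1).map Polynomial.C).det with hD
  have hDt : ∀ t, D.eval t = (1 + t • (Λ - 1)).det := by
    intro t
    rw [hD, ← Polynomial.coe_evalRingHom, RingHom.map_det]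
    congr 1
    ext1 i j
    by_cases h : i = j <;> simp [h, mul_comm t]
  have hD0 : D.eval 0 = 1 := by rw [hDt, zero_smul, add_zero, Matrix.det_one]
  have hB : (Λ - 1).IsSymm := hΛ.sub Matrix.isSymm_one
  have ode : Polynomial.derivative q * D = m * Polynomial.derivative D * q := by
    -- Integration by parts needs an invertible matrix on the segment. This holds off the finitely
    -- many roots of D, and D ≠ 0 since D(0) = 1; infinitely many points suffice for a polynomial
    -- identity.
    refine Polynomial.eq_of_infinite_eval_eq _ _ ?_
    have hne : D ≠ 0 := fun e => by simp [e] at hD0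
    refine ((Polynomial.finite_setOfPred_isRoot hne).infinite_compl).mono fun t ht => ?_
    have ht : D.eval t ≠ 0 := ht
    rw [hDt] at ht
    have hu : IsUnit (1 + t • (Λ - 1)).det := isUnit_iff_ne_zero.2 ht
    have h1 := negForm_halfForm_pow_sub_one_mul 𝕜 hφ (Matrix.isSymm_one.add (hB.smul t))
      ((Matrix.isUnit_iff_isUnit_det _).2 hu) hB
    have h2 := congrArg f h1
    rw [map_smul, map_smul, smul_eq_mul, smul_eq_mul, halfForm_add_smul] at h2
    have h3 : Polynomial.eval t (Polynomial.derivative D) = _ := derivative_eval_det 1 (Λ - 1) t hu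
    change Polynomial.eval t _ = Polynomial.eval t _
    rw [Polynomial.eval_mul, Polynomial.eval_mul, Polynomial.eval_mul, h3, hDt, hq, hq',
      LinearMap.comp_apply, LinearMap.comp_apply, h2, Polynomial.eval_natCast]
    ring
  have h4 := congrArg (Polynomial.eval 1) (eq_C_mul_pow_of_derivative m hD0 ode)
  rw [Polynomial.eval_mul, Polynomial.eval_C, Polynomial.eval_pow, hq, hq, hDt,
    ← halfForm_add_smul, ← halfForm_add_smul, LinearMap.comp_apply, LinearMap.comp_apply, one_smul,
    zero_smul, add_zero, add_sub_cancel, negForm_halfForm_one_pow 𝕜 hφ] at h4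
  rw [h4, map_mul _ _ (Λ.det ^ m), mul_comm (algebraMap 𝕜 R _), ← Algebra.smul_def, map_smul,
    smul_eq_mul, mul_comm]

end JDiag

end

/-! ### Comparison of the two integrals, coefficient by coefficient. -/

noncomputable section

namespace JDiag

variable (𝕜 : Type*) [Field 𝕜] {X : Type u} [Fintype X]

/-- The kernel is homogeneous with m|X| struts, so the sum over k has a single term. -/
theorem coeff_strutPairing_negKernel (m d : ℕ) (G : PowerSeries (Space 𝕜 X)) :
    PowerSeries.coeff d (strutPairing 𝕜 (negKernel 𝕜 m) G) =
      (((m.factorial : 𝕜)⁻¹ * (1 / 2) ^ m) ^ Fintype.card X) •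
        pairing 𝕜 (diagStruts 𝕜 X m) (PowerSeries.coeff (d + m * Fintype.card X) G) := by
  have e : (∏ x : X, (m.factorial : 𝕜)⁻¹ • ((1 / 2 : 𝕜) • el 𝕜 (strut x x)) ^ m) =
      (((m.factorial : 𝕜)⁻¹ * (1 / 2) ^ m) ^ Fintype.card X) • diagStruts 𝕜 X m := by
    simp only [smul_pow, smul_smul]
    rw [Finset.prod_smul, Finset.prod_const, Finset.card_univ]
    rfl
  rw [strutPairing, PowerSeries.coeff_mk, finsum_eq_single _ (m * Fintype.card X)]
  · rw [negKernel, PowerSeries.coeff_monomial_same, e, map_smul, LinearMap.smul_apply]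
  · intro k hk
    rw [negKernel, PowerSeries.coeff_monomial, if_neg hk, map_zero, LinearMap.zero_apply]

variable [DecidableEq X] [CharZero 𝕜] {R : Type*} [CommRing R] [Algebra 𝕜 R] {φ : Space 𝕜 Empty →ₐ[𝕜] R} {m : ℕ}

theorem map_coeff_negative_integral (hφ : ∀ a ∈ idealOP 𝕜 m, φ a = 0) {Λ : Matrix X X 𝕜}
    (hΛ : Λ.IsSymm) (hu : IsUnit Λ) (P : PowerSeries (Space 𝕜 X)) (d : ℕ)
    (hfin : (Function.support fun k => pairing 𝕜 (PowerSeries.coeff k (gaussian 𝕜 (-Λ⁻¹)))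
      (PowerSeries.coeff (d + k) P)).Finite) :
    φ (PowerSeries.coeff d (strutPairing 𝕜 (negKernel 𝕜 m) (P * gaussian 𝕜 Λ))) =
      ((-1) ^ (m * Fintype.card X) * Λ.det ^ m : 𝕜) •
        φ (PowerSeries.coeff d (formalGaussianIntegral 𝕜 Λ P)) := by
  set N := m * Fintype.card X with hN
  set c : 𝕜 := ((m.factorial : 𝕜)⁻¹ * (1 / 2) ^ m) ^ Fintype.card X with hc
  have hN0 : (N.factorial : 𝕜) ≠ 0 := Nat.cast_ne_zero.2 N.factorial_ne_zero
  have hm0 : (m.factorial : 𝕜) ≠ 0 := Nat.cast_ne_zero.2 m.factorial_ne_zero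
  -- The normalization of the kernel cancels m! and turns each (−2)^m into (−1)^m, which leaves
  -- exactly the factor in the theorem.
  have hscal : c * (N.factorial : 𝕜)⁻¹ * (N.factorial * ((-2) ^ m * m.factorial) ^ Fintype.card X *
      Λ.det ^ m) = (-1) ^ N * Λ.det ^ m := by
    have h1 : c * ((-2) ^ m * m.factorial) ^ Fintype.card X = (-1) ^ N := by
      rw [hc, ← mul_pow, hN, pow_mul]
      congr 1
      rw [show (m.factorial : 𝕜)⁻¹ * (1 / 2) ^ m * ((-2) ^ m * m.factorial) =
        (m.factorial : 𝕜)⁻¹ * m.factorial * ((-2) * (1 / 2)) ^ m by rw [mul_pow]; ring,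
        inv_mul_cancel₀ hm0]
      norm_num
    rw [← h1]
    field_simp
  have hZ := negForm_halfForm_pow 𝕜 hφ hΛ
  rw [← hN] at hZ
  have term : ∀ k ≤ N, ∀ x, c • ((N - k).factorial : 𝕜)⁻¹ •
      negForm 𝕜 X φ m (halfForm 𝕜 Λ ^ (N - k) * x) =
      ((-1) ^ N * Λ.det ^ m : 𝕜) •
        φ (pairing 𝕜 (PowerSeries.coeff k (gaussian 𝕜 (-Λ⁻¹))) x) := by
    intro k hk x
    rw [negForm_pow_mul_eq 𝕜 hφ hΛ hu k (N - k) (by omega), ← hN, hZ, ← Algebra.smul_def, smul_smul,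
      smul_smul, hscal, gaussian, PowerSeries.coeff_mk]
  have term' : ∀ k, N < k → ∀ x, ((-1) ^ N * Λ.det ^ m : 𝕜) •
        φ (pairing 𝕜 (PowerSeries.coeff k (gaussian 𝕜 (-Λ⁻¹))) x) = 0 := by
    intro k hk x
    have h1 := negForm_mul_pairing_eq_zero 𝕜 hφ hΛ hu k hk x
    rw [← hN, hZ, ← Algebra.smul_def] at h1
    rw [gaussian, PowerSeries.coeff_mk, map_smul, LinearMap.smul_apply, map_smul, ← hscal, mul_smul,
      smul_comm _ (k.factorial : 𝕜)⁻¹, h1, smul_zero, smul_zero]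
  have hR : ((-1) ^ N * Λ.det ^ m : 𝕜) • φ (PowerSeries.coeff d (formalGaussianIntegral 𝕜 Λ P)) =
      ∑ k ∈ Finset.range (N + 1), ((-1) ^ N * Λ.det ^ m : 𝕜) •
        φ (pairing 𝕜 (PowerSeries.coeff k (gaussian 𝕜 (-Λ⁻¹))) (PowerSeries.coeff (d + k) P)) := by
    rw [formalGaussianIntegral, strutPairing, PowerSeries.coeff_mk,
      finsum_eq_sum_of_support_subset (s := hfin.toFinset ∪ Finset.range (N + 1)) _ (by
        intro x hx
        simp only [Finset.coe_union, Set.Finite.coe_toFinset]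
        exact Or.inl hx), map_sum, Finset.smul_sum]
    symm
    refine Finset.sum_subset Finset.subset_union_right fun k _ hk => ?_
    rw [Finset.mem_range, not_lt] at hk
    exact term' k (by omega) _
  rw [hR, coeff_strutPairing_negKernel, map_smul, ← hc, ← hN]
  change c • negForm 𝕜 X φ m _ = _
  rw [PowerSeries.coeff_mul, map_sum, Finset.smul_sum]
  have hL : ∀ p ∈ Finset.HasAntidiagonal.antidiagonal (d + N),
      c • negForm 𝕜 X φ m (PowerSeries.coeff p.1 P * PowerSeries.coeff p.2 (gaussian 𝕜 Λ)) =
      if p.2 ≤ N then ((-1) ^ N * Λ.det ^ m : 𝕜) •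
        φ (pairing 𝕜 (PowerSeries.coeff (N - p.2) (gaussian 𝕜 (-Λ⁻¹))) (PowerSeries.coeff p.1 P))
      else 0 := by
    rintro ⟨i, j⟩ _
    dsimp only
    rw [gaussian, PowerSeries.coeff_mk, mul_smul_comm, map_smul, mul_comm]
    split_ifs with hj
    · rw [← term (N - j) (by omega), show N - (N - j) = j by omega]
    · rw [negForm_pow_mul_eq_zero 𝕜 φ m j (opN_halfForm 𝕜 Λ) (by omega), smul_zero, smul_zero]
  rw [Finset.sum_congr rfl hL, ← Finset.sum_filter]
  -- The term with j struts from the Gaussian factor of G corresponds to the term with k = N − j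
  -- dual struts; both use the part of P of degree d + k.
  refine Finset.sum_bij' (fun p _ => N - p.2) (fun k _ => (d + k, N - k)) ?_ ?_ ?_ ?_ ?_
  · rintro ⟨i, j⟩ h
    rw [Finset.mem_filter, Finset.HasAntidiagonal.mem_antidiagonal] at h
    rw [Finset.mem_range]
    omega
  · intro k hk
    rw [Finset.mem_range] at hk
    rw [Finset.mem_filter, Finset.HasAntidiagonal.mem_antidiagonal]
    dsimp only
    omega
  · rintro ⟨i, j⟩ h
    rw [Finset.mem_filter, Finset.HasAntidiagonal.mem_antidiagonal] at h
    dsimp only at h ⊢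
    ext <;> dsimp only <;> omega
  · intro k hk
    rw [Finset.mem_range] at hk
    dsimp only
    omega
  · rintro ⟨i, j⟩ h
    rw [Finset.mem_filter, Finset.HasAntidiagonal.mem_antidiagonal] at h
    dsimp only at h ⊢
    rw [show d + (N - j) = i by omega]

end JDiag

end

/-! ### Components, subdivision points and the normal form of a diagram. -/

noncomputable section

namespace JDiag

variable {X : Type u}

/-! ### Parts of a diagram -/

/-- The set of half-edges `p` is a union of connected components. -/
def Cl (D : JDiag X) (p : D.H → Prop) : Prop :=
  (∀ h, p (D.σ h) ↔ p h) ∧ ∀ h, p (D.τ h) ↔ p h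

theorem Cl.of {D : JDiag X} {p : D.H → Prop} (h1 : ∀ h, p h → p (D.σ h))
    (h2 : ∀ h, p h → p (D.τ h)) : D.Cl p := by
  refine ⟨fun h => ⟨fun hp => ?_, h1 h⟩, fun h => ⟨fun hp => ?_, h2 h⟩⟩
  · rcases D.valence h with e | e
    · rw [← e]
      exact h1 _ hp
    · rw [← e]
      exact h1 _ (h1 _ hp)
  · rw [← D.τ_invol h]
    exact h2 _ hp

theorem Cl.compl {D : JDiag X} {p : D.H → Prop} (hp : D.Cl p) : D.Cl fun h => ¬ p h :=
  ⟨fun h => not_congr (hp.1 h), fun h => not_congr (hp.2 h)⟩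

theorem Cl.sameComp {D : JDiag X} {p : D.H → Prop} (hp : D.Cl p) {h k : D.H}
    (hk : D.SameComp h k) : p h ↔ p k := by
  induction hk with
  | rel x y hxy =>
    rcases hxy with rfl | rfl
    · exact (hp.1 x).symm
    · exact (hp.2 x).symm
  | refl x => exact Iff.rfl
  | symm x y _ ih => exact ih.symm
  | trans x y z _ _ ih ih' => exact ih.trans ih'

/-- The part of a diagram consisting of the half-edges `p`. -/
def restrict (D : JDiag X) (p : D.H → Prop) (hp : D.Cl p) : JDiag X where
  H := {h // p h}
  fin := inferInstance
  σ := D.σ.subtypePerm hp.1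
  τ := D.τ.subtypePerm hp.2
  mark := fun h => D.mark h.1
  τ_invol := fun h => Subtype.ext (D.τ_invol h.1)
  τ_ne := fun h e => D.τ_ne h.1 (congrArg Subtype.val e)
  valence := fun h => (D.valence h.1).imp (fun e => Subtype.ext e) (fun e => Subtype.ext e)
  mark_iff := fun h => (D.mark_iff h.1).trans
    ⟨fun e => Subtype.ext e, fun e => congrArg Subtype.val e⟩

open Classical in
/-- A diagram is the disjoint union of two complementary parts. -/
def restrictUnion (D : JDiag X) (p : D.H → Prop) (hp : D.Cl p) :
    Iso ((D.restrict p hp).union (D.restrict (fun h => ¬ p h) hp.compl)) D where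
  e := Equiv.sumCompl p
  σ_comm := by rintro (h | h) <;> rfl
  τ_comm := by rintro (h | h) <;> rfl
  mark_comm := by rintro (h | h) <;> rfl

theorem cls_restrict (D : JDiag X) (p : D.H → Prop) (hp : D.Cl p) :
    cls (D.restrict p hp) * cls (D.restrict (fun h => ¬ p h) hp.compl) = cls D :=
  cls_iso (restrictUnion D p hp)

theorem restrict_isTri {D : JDiag X} {p : D.H → Prop} {hp : D.Cl p} {h : {h // p h}} :
    (D.restrict p hp).IsTri h ↔ D.IsTri h.1 :=
  and_congr (not_congr Subtype.ext_iff) (not_congr Subtype.ext_iff)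

/-- A connected component that consists of one edge with a single subdivision point. -/
theorem cls_restrict_circle {D : JDiag X} {h : D.H} (hb : D.IsBi h) (hτ : D.τ h = D.σ h)
    (hp : D.Cl fun k => k = h ∨ k = D.σ h) :
    cls (D.restrict (fun k => k = h ∨ k = D.σ h) hp) = cls (circle X) := by
  have hτ' : D.τ (D.σ h) = h := by rw [← hτ, D.τ_invol]
  symm
  let e : Bool → {k // k = h ∨ k = D.σ h} := fun b => if b then ⟨h, Or.inl rfl⟩ else ⟨D.σ h, Or.inr rfl⟩
  have he : Function.Bijective e := by
    constructor
    · rintro (_ | _) (_ | _) h'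
      · rfl
      · exact absurd (congrArg Subtype.val h') hb.1
      · exact absurd (congrArg Subtype.val h').symm hb.1
      · rfl
    · rintro ⟨k, rfl | rfl⟩
      · exact ⟨true, rfl⟩
      · exact ⟨false, rfl⟩
  refine cls_iso ⟨Equiv.ofBijective e he, ?_, ?_, ?_⟩
  · rintro (_ | _)
    · exact Subtype.ext hb.2.symm
    · exact Subtype.ext rfl
  · rintro (_ | _)
    · exact Subtype.ext hτ'.symm
    · exact Subtype.ext hτ.symm
  · have : ∀ k : {k // k = h ∨ k = D.σ h}, D.mark k.1 = none := by
      rintro ⟨k, hk⟩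
      rw [← Option.not_isSome_iff_eq_none, D.mark_iff]
      rcases hk with rfl | rfl
      · exact hb.1
      · rw [hb.2]
        exact hb.1.symm
    exact fun k => this _

/-! ### Vertex counts -/

/-- The number of half-edges at trivalent vertices. -/
def triCard (D : JDiag X) : ℕ := Nat.card {h // D.IsTri h}

theorem degree_eq (D : JDiag X) : D.degree = (D.numLegs + D.triCard / 3) / 2 := rfl

theorem card_subtype_sum {α β : Type} [Finite α] [Finite β] (p : α ⊕ β → Prop) :
    Nat.card {x // p x} = Nat.card {a // p (Sum.inl a)} + Nat.card {b // p (Sum.inr b)} := by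
  rw [Nat.card_congr Equiv.subtypeSum, Nat.card_sum]

theorem Iso.isTri {D E : JDiag X} (i : Iso D E) (h : D.H) : E.IsTri (i.e h) ↔ D.IsTri h := by
  unfold IsTri
  rw [← i.σ_comm, ← i.σ_comm, i.e.injective.ne_iff, i.e.injective.ne_iff]

theorem Iso.isBi {D E : JDiag X} (i : Iso D E) (h : D.H) : E.IsBi (i.e h) ↔ D.IsBi h := by
  unfold IsBi
  rw [← i.σ_comm, ← i.σ_comm, i.e.injective.ne_iff, i.e.injective.eq_iff]

theorem Iso.isLeg {D E : JDiag X} (i : Iso D E) (h : D.H) : E.IsLeg (i.e h) ↔ D.IsLeg h := by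
  unfold IsLeg
  rw [i.mark_comm]

theorem Iso.triCard {D E : JDiag X} (i : Iso D E) : D.triCard = E.triCard :=
  Nat.card_congr (i.e.subtypeEquiv fun h => (i.isTri h).symm)

theorem Iso.numLegs {D E : JDiag X} (i : Iso D E) : D.numLegs = E.numLegs :=
  Nat.card_congr (i.e.subtypeEquiv fun h => (i.isLeg h).symm)

theorem union_isTri_inl {D E : JDiag X} {h : D.H} :
    (D.union E).IsTri (Sum.inl h) ↔ D.IsTri h :=
  and_congr (not_congr Sum.inl_injective.eq_iff) (not_congr Sum.inl_injective.eq_iff)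

theorem union_isTri_inr {D E : JDiag X} {h : E.H} :
    (D.union E).IsTri (Sum.inr h) ↔ E.IsTri h :=
  and_congr (not_congr Sum.inr_injective.eq_iff) (not_congr Sum.inr_injective.eq_iff)

theorem union_isBi_inl {D E : JDiag X} {h : D.H} :
    (D.union E).IsBi (Sum.inl h) ↔ D.IsBi h :=
  and_congr (not_congr Sum.inl_injective.eq_iff) Sum.inl_injective.eq_iff

theorem union_isBi_inr {D E : JDiag X} {h : E.H} :
    (D.union E).IsBi (Sum.inr h) ↔ E.IsBi h :=
  and_congr (not_congr Sum.inr_injective.eq_iff) Sum.inr_injective.eq_iff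

theorem union_triCard (D E : JDiag X) : (D.union E).triCard = D.triCard + E.triCard := by
  refine (card_subtype_sum (α := D.H) (β := E.H) _).trans ?_
  exact congrArg₂ (· + ·)
    (Nat.card_congr (Equiv.subtypeEquivRight fun h => union_isTri_inl))
    (Nat.card_congr (Equiv.subtypeEquivRight fun h => union_isTri_inr))

theorem union_numLegs (D E : JDiag X) : (D.union E).numLegs = D.numLegs + E.numLegs :=
  card_subtype_sum (α := D.H) (β := E.H) _

theorem subdiv_isTri_inl {D : JDiag X} {a h : D.H} :
    (D.subdiv a).IsTri (Sum.inl h) ↔ D.IsTri h :=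
  and_congr (not_congr Sum.inl_injective.eq_iff) (not_congr Sum.inl_injective.eq_iff)

theorem subdiv_isBi_inl {D : JDiag X} {a h : D.H} :
    (D.subdiv a).IsBi (Sum.inl h) ↔ D.IsBi h :=
  and_congr (not_congr Sum.inl_injective.eq_iff) Sum.inl_injective.eq_iff

theorem subdiv_isBi_inr {D : JDiag X} {a : D.H} (b : Bool) : (D.subdiv a).IsBi (Sum.inr b) :=
  ⟨fun e => by
    have := Sum.inr_injective e
    exact absurd this (by cases b <;> decide), congrArg Sum.inr (by cases b <;> rfl)⟩

theorem IsBi.not_isTri {D : JDiag X} {h : D.H} (hb : D.IsBi h) : ¬ D.IsTri h := fun ht => ht.2 hb.2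

theorem IsBi.not_isLeg {D : JDiag X} {h : D.H} (hb : D.IsBi h) : ¬ D.IsLeg h :=
  fun hl => hb.1 (isLeg_iff.1 hl)

theorem IsTri.not_isLeg {D : JDiag X} {h : D.H} (hb : D.IsTri h) : ¬ D.IsLeg h :=
  fun hl => hb.1 (isLeg_iff.1 hl)

theorem isLeg_or_isBi_or_isTri (D : JDiag X) (h : D.H) : D.IsLeg h ∨ D.IsBi h ∨ D.IsTri h := by
  by_cases h1 : D.σ h = h
  · exact Or.inl (isLeg_iff.2 h1)
  · by_cases h2 : D.σ (D.σ h) = h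
    · exact Or.inr (Or.inl ⟨h1, h2⟩)
    · exact Or.inr (Or.inr ⟨h1, h2⟩)

theorem subdiv_triCard (D : JDiag X) (a : D.H) : (D.subdiv a).triCard = D.triCard := by
  refine (card_subtype_sum (α := D.H) (β := Bool) _).trans ?_
  have : IsEmpty {b : Bool // (D.subdiv a).IsTri (Sum.inr b)} :=
    ⟨fun b => (subdiv_isBi_inr b.1).not_isTri b.2⟩
  rw [Nat.card_of_isEmpty (α := {b : Bool // (D.subdiv a).IsTri (Sum.inr b)})]
  exact Nat.card_congr (Equiv.subtypeEquivRight fun h => subdiv_isTri_inl)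

theorem subdiv_numLegs (D : JDiag X) (a : D.H) : (D.subdiv a).numLegs = D.numLegs := by
  refine (card_subtype_sum (α := D.H) (β := Bool) _).trans ?_
  have : IsEmpty {b : Bool // (D.subdiv a).IsLeg (Sum.inr b)} :=
    ⟨fun b => (subdiv_isBi_inr b.1).not_isLeg b.2⟩
  rw [Nat.card_of_isEmpty (α := {b : Bool // (D.subdiv a).IsLeg (Sum.inr b)})]
  exact Nat.card_congr (Equiv.subtypeEquivRight fun h => Iff.rfl)

theorem Step.triCard {D E : JDiag X} (s : Step D E) : D.triCard = E.triCard := by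
  cases s with
  | iso i => exact i.triCard
  | subdiv h => exact (subdiv_triCard D h).symm

theorem Step.numLegs {D E : JDiag X} (s : Step D E) : D.numLegs = E.numLegs := by
  cases s with
  | iso i => exact i.numLegs
  | subdiv h => exact (subdiv_numLegs D h).symm

theorem triCard_congr {D E : JDiag X} (h : cls D = cls E) : D.triCard = E.triCard :=
  congrArg (Quot.lift JDiag.triCard fun _ _ s => s.triCard) h

theorem numLegs_congr {D E : JDiag X} (h : cls D = cls E) : D.numLegs = E.numLegs :=
  congrArg (Quot.lift JDiag.numLegs fun _ _ s => s.numLegs) h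

theorem circle_isBi (h : (circle X).H) : (circle X).IsBi h := by
  rcases h with _ | _
  · exact ⟨Bool.noConfusion, rfl⟩
  · exact ⟨Bool.noConfusion, rfl⟩

theorem circle_triCard : (circle X).triCard = 0 := by
  have : IsEmpty {h // (circle X).IsTri h} := ⟨fun h => (circle_isBi h.1).not_isTri h.2⟩
  exact Nat.card_of_isEmpty

theorem circle_numLegs : (circle X).numLegs = 0 := numLegs_eq_zero.2 circle_legless

theorem exists_circles (n : ℕ) : ∃ C : JDiag X, cls C = cls (circle X) ^ n ∧ C.triCard = 0 ∧
    C.numLegs = 0 ∧ ∀ h, C.IsBi h := by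
  induction n with
  | zero =>
    have : IsEmpty {h // (empty X).IsTri h} := ⟨fun h => h.1.elim⟩
    exact ⟨empty X, rfl, Nat.card_of_isEmpty, numLegs_eq_zero.2 empty_legless, fun h => h.elim⟩
  | succ n ih =>
    obtain ⟨C, h1, h2, h3, h4⟩ := ih
    refine ⟨C.union (circle X), ?_, ?_, ?_, ?_⟩
    · rw [pow_succ, ← h1, cls_mul]
    · rw [union_triCard, h2, circle_triCard]
    · rw [union_numLegs, h3, circle_numLegs]
    · rintro (h | h)
      · exact union_isBi_inl.2 (h4 h)
      · exact union_isBi_inr.2 (circle_isBi h)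

/-! ### Removal of subdivision points -/

section Unsub

variable {D : JDiag X} {h : D.H} (hb : D.IsBi h) (hτ : D.τ h ≠ D.σ h)
include hb hτ

/-- Erasing the subdivision point at h joins its two neighbours by one edge. The hypothesis on τ
excludes the circle with a single subdivision point, which has no edge left after erasure. -/
theorem exists_subdiv : ∃ (E : JDiag X) (a : E.H), Nat.card E.H < Nat.card D.H ∧
    Nonempty (Iso (E.subdiv a) D) := by
  classical
  obtain ⟨hb1, hb2⟩ := hb
  set h' := D.σ h with hh'
  have n1 : D.τ h ≠ h := D.τ_ne h
  have n2 : D.τ h' ≠ h' := D.τ_ne h'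
  have n3 : D.τ h' ≠ h := fun e => hτ (by rw [← e, D.τ_invol])
  -- The new edge joins the outer ends of the two edges at the subdivision point. Subdividing it at
  -- the half-edge `τ h` restores the diagram.
  let τ1 : D.H → D.H := fun x => if x = D.τ h then D.τ h' else if x = D.τ h' then D.τ h else D.τ x
  have t1 : τ1 (D.τ h) = D.τ h' := if_pos rfl
  have t2 : τ1 (D.τ h') = D.τ h := by
    by_cases e : D.τ h' = D.τ h
    · rw [e, t1, e]
    · exact (if_neg e).trans (if_pos rfl)
  have t3 : ∀ x, x ≠ D.τ h → x ≠ D.τ h' → τ1 x = D.τ x := fun x e e' => (if_neg e).trans (if_neg e')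
  let p : D.H → Prop := fun x => x ≠ h ∧ x ≠ h'
  have p1 : p (D.τ h) := ⟨n1, hτ⟩
  have p2 : p (D.τ h') := ⟨n3, n2⟩
  have hpσ : ∀ x, p (D.σ x) ↔ p x := by
    intro x
    have e1 : D.σ x = h ↔ x = h' := by
      constructor
      · intro e
        exact D.σ.injective (e.trans hb2.symm)
      · intro e
        rw [e, hb2]
    have e2 : D.σ x = h' ↔ x = h := D.σ.injective.eq_iff
    change ¬ _ ∧ ¬ _ ↔ ¬ _ ∧ ¬ _
    rw [e1, e2, and_comm]
  have hpτ : ∀ x, p x → p (τ1 x) := by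
    intro x hx
    by_cases e : x = D.τ h
    · rw [e, t1]
      exact p2
    · by_cases e' : x = D.τ h'
      · rw [e', t2]
        exact p1
      · rw [t3 x e e']
        exact ⟨fun e2 => e (by rw [← e2, D.τ_invol]), fun e2 => e' (by rw [← e2, D.τ_invol])⟩
  have inv1 : ∀ x, p x → τ1 (τ1 x) = x := by
    intro x hx
    by_cases e : x = D.τ h
    · rw [e, t1, t2]
    · by_cases e' : x = D.τ h'
      · rw [e', t2, t1]
      · rw [t3 x e e', t3, D.τ_invol]
        · exact fun e2 => hx.1 (D.τ.injective e2)
        · exact fun e2 => hx.2 (D.τ.injective e2)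
  have hne : D.τ h ≠ D.τ h' := fun e => hb1 (D.τ.injective e).symm
  have ne1 : ∀ x, p x → τ1 x ≠ x := by
    intro x hx
    by_cases e : x = D.τ h
    · rw [e, t1]
      exact hne.symm
    · by_cases e' : x = D.τ h'
      · rw [e', t2]
        exact hne
      · rw [t3 x e e']
        exact D.τ_ne x
  let E : JDiag X :=
    { H := {x // p x}
      fin := inferInstance
      σ := D.σ.subtypePerm hpσ
      τ := Function.Involutive.toPerm (fun x => ⟨τ1 x.1, hpτ x.1 x.2⟩)
        fun x => Subtype.ext (inv1 x.1 x.2)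
      mark := fun x => D.mark x.1
      τ_invol := fun x => Subtype.ext (inv1 x.1 x.2)
      τ_ne := fun x e => ne1 x.1 x.2 (congrArg Subtype.val e)
      valence := fun x => (D.valence x.1).imp (fun e => Subtype.ext e) (fun e => Subtype.ext e)
      mark_iff := fun x => (D.mark_iff x.1).trans
        ⟨fun e => Subtype.ext e, fun e => congrArg Subtype.val e⟩ }
  let a : E.H := ⟨D.τ h, p1⟩
  have ha : E.τ a = (⟨D.τ h', p2⟩ : {x // p x}) := Subtype.ext t1
  let f : {x // p x} ⊕ Bool → D.H := Sum.elim Subtype.val (fun b => if b then h' else h)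
  have hf : Function.Bijective f := by
    constructor
    · rintro (x | _ | _) (y | _ | _) e
      · exact congrArg Sum.inl (Subtype.ext e)
      · exact absurd e x.2.1
      · exact absurd e x.2.2
      · exact absurd e.symm y.2.1
      · rfl
      · exact absurd e.symm hb1
      · exact absurd e.symm y.2.2
      · exact absurd e hb1
      · rfl
    · intro x
      by_cases e : x = h
      · exact ⟨Sum.inr false, e.symm⟩
      · by_cases e' : x = h'
        · exact ⟨Sum.inr true, e'.symm⟩
        · exact ⟨Sum.inl ⟨x, e, e'⟩, rfl⟩
  refine ⟨E, a, ?_, ⟨Equiv.ofBijective f hf, ?_, ?_, ?_⟩⟩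
  · have := Nat.card_congr (Equiv.ofBijective f hf)
    rw [Nat.card_sum] at this
    rw [← this]
    simp [E]
  · rintro (x | _ | _)
    · rfl
    · rfl
    · exact hb2.symm
  · rintro (x | _ | _)
    · change f ((E.subdiv a).τ (Sum.inl x)) = D.τ x.1
      by_cases e : x = a
      · subst e
        exact (congrArg f (subdiv_τ_inl_self E a)).trans (D.τ_invol h).symm
      · by_cases e' : x = E.τ a
        · rw [e', subdiv_τ_inl_τ E a]
          exact ((congrArg (fun z : {x // p x} => D.τ z.1) ha).trans (D.τ_invol h')).symm
        · rw [subdiv_τ_inl E a x e e']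
          exact t3 x.1 (fun e2 => e (Subtype.ext e2)) (fun e2 => e' (ha ▸ Subtype.ext e2))
    · exact congrArg f (subdiv_τ_false E a)
    · refine (congrArg f (subdiv_τ_true E a)).trans ?_
      exact congrArg Subtype.val ha
  · rintro (x | _ | _)
    · rfl
    · exact Option.not_isSome_iff_eq_none.1 (fun hs => hb1 ((D.mark_iff h).1 hs))
    · refine Option.not_isSome_iff_eq_none.1 (fun hs => ?_)
      have := (D.mark_iff h').1 hs
      rw [hb2] at this
      exact hb1 this.symm

end Unsub

/-- Every connected component has a trivalent vertex. -/
def NoStrut (D : JDiag X) : Prop := ∀ p, D.Cl p → ∀ h, p h → ∃ k, p k ∧ D.IsTri k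

theorem Strutless.noStrut {D : JDiag X} (hD : D.Strutless) : D.NoStrut := by
  intro p hp h hh
  obtain ⟨k, hk, ht⟩ := hD h
  exact ⟨k, (hp.sameComp hk).1 hh, ht⟩

theorem NoStrut.of_iso {D E : JDiag X} (i : Iso D E) (hE : E.NoStrut) : D.NoStrut := by
  intro p hp h hh
  have hq : E.Cl fun x => p (i.e.symm x) := by
    constructor
    · intro x
      obtain ⟨x, rfl⟩ := i.e.surjective x
      dsimp only
      rw [← i.σ_comm, i.e.symm_apply_apply, i.e.symm_apply_apply]
      exact hp.1 x
    · intro x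
      obtain ⟨x, rfl⟩ := i.e.surjective x
      dsimp only
      rw [← i.τ_comm, i.e.symm_apply_apply, i.e.symm_apply_apply]
      exact hp.2 x
  obtain ⟨k, hk, ht⟩ := hE _ hq (i.e h) (by rwa [i.e.symm_apply_apply])
  refine ⟨i.e.symm k, hk, (i.isTri _).1 ?_⟩
  rwa [i.e.apply_symm_apply]

/-- The set of half-edges of a subdivision that corresponds to a set of half-edges. -/
def subdivSet {D : JDiag X} (a : D.H) (p : D.H → Prop) : (D.subdiv a).H → Prop :=
  Sum.elim p fun _ => p a

theorem Cl.subdiv {D : JDiag X} (a : D.H) {p : D.H → Prop} (hp : D.Cl p) :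
    (D.subdiv a).Cl (subdivSet a p) := by
  have key : ∀ {x y : (D.subdiv a).H}, x = y → (subdivSet a p x ↔ subdivSet a p y) := fun e =>
    e ▸ Iff.rfl
  constructor
  · rintro (x | x)
    · exact hp.1 x
    · exact Iff.rfl
  · rintro (x | _ | _)
    · by_cases e : x = a
      · subst e
        exact (key (subdiv_τ_inl_self D x)).trans Iff.rfl
      · by_cases e' : x = D.τ a
        · subst e'
          exact (key (subdiv_τ_inl_τ D a)).trans (hp.2 a).symm
        · exact (key (subdiv_τ_inl D a x e e')).trans (hp.2 x)
    · exact (key (subdiv_τ_false D a)).trans Iff.rfl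
    · exact (key (subdiv_τ_true D a)).trans (hp.2 a)

theorem NoStrut.of_subdiv {D : JDiag X} {a : D.H} (hD : (D.subdiv a).NoStrut) : D.NoStrut := by
  intro p hp h hh
  obtain ⟨k | k, hk, ht⟩ := hD _ (hp.subdiv a) (Sum.inl h) hh
  · exact ⟨k, hk, subdiv_isTri_inl.1 ht⟩
  · exact absurd ht (subdiv_isBi_inr k).not_isTri

theorem NoStrut.restrict {D : JDiag X} (hD : D.NoStrut) {q : D.H → Prop} (hq : D.Cl q) :
    (D.restrict q hq).NoStrut := by
  intro p hp h hh
  have hp' : D.Cl fun x => ∃ hx : q x, p ⟨x, hx⟩ := by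
    refine Cl.of ?_ ?_
    · rintro x ⟨hx, hpx⟩
      exact ⟨(hq.1 x).2 hx, (hp.1 ⟨x, hx⟩).2 hpx⟩
    · rintro x ⟨hx, hpx⟩
      exact ⟨(hq.2 x).2 hx, (hp.2 ⟨x, hx⟩).2 hpx⟩
  obtain ⟨k, ⟨hk, hk'⟩, ht⟩ := hD _ hp' h.1 ⟨h.2, hh⟩
  exact ⟨⟨k, hk⟩, hk', restrict_isTri.2 ht⟩

/-- Every diagram consists of closed circles and a diagram without subdivision points. -/
theorem exists_normal_form (D : JDiag X) : ∃ (n : ℕ) (E : JDiag X),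
    cls D = cls (circle X) ^ n * cls E ∧ (∀ h, ¬ E.IsBi h) ∧ (D.NoStrut → E.NoStrut) := by
  induction hn : Nat.card D.H using Nat.strong_induction_on generalizing D with
  | _ N ih =>
    by_cases hD : ∀ h, ¬ D.IsBi h
    · exact ⟨0, D, by rw [pow_zero, one_mul], hD, id⟩
    · obtain ⟨h, hb⟩ := not_forall_not.1 hD
      -- A subdivision point with a loop edge is a whole closed circle and is split off; any other
      -- one is erased. Both lower the number of half-edges.
      by_cases hτ : D.τ h = D.σ h
      · have hp : D.Cl fun k => k = h ∨ k = D.σ h := by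
          refine Cl.of ?_ ?_
          · rintro x (rfl | rfl)
            · exact Or.inr rfl
            · exact Or.inl hb.2
          · rintro x (rfl | rfl)
            · exact Or.inr hτ
            · exact Or.inl (by rw [← hτ, D.τ_invol])
        obtain ⟨n, E, h1, h2, h3⟩ := ih _ (by
          rw [← hn]
          exact Finite.card_subtype_lt (p := fun k => ¬ (k = h ∨ k = D.σ h)) (x := h)
            (not_not.2 (Or.inl rfl)))
          (D.restrict _ hp.compl) rfl
        refine ⟨n + 1, E, ?_, h2, fun hs => h3 (hs.restrict hp.compl)⟩
        rw [← cls_restrict D _ hp, cls_restrict_circle hb hτ hp, h1, pow_succ', mul_assoc]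
      · obtain ⟨F, a, hc, ⟨i⟩⟩ := exists_subdiv hb hτ
        obtain ⟨n, E, h1, h2, h3⟩ := ih _ (by rwa [← hn]) F rfl
        refine ⟨n, E, ?_, h2, fun hs => h3 (NoStrut.of_iso i hs).of_subdiv⟩
        rw [← h1, ← cls_iso i, cls_subdiv]

theorem counts_normal_form {D E : JDiag X} {n : ℕ} (h : cls D = cls (circle X) ^ n * cls E) :
    D.triCard = E.triCard ∧ D.numLegs = E.numLegs := by
  obtain ⟨C, h1, h2, h3, -⟩ := exists_circles (X := X) n
  rw [← h1, cls_mul] at h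
  refine ⟨(triCard_congr h).trans ?_, (numLegs_congr h).trans ?_⟩
  · rw [union_triCard, h2, zero_add]
  · rw [union_numLegs, h3, zero_add]

/-- The edge at a leg of a diagram without struts. -/
theorem NoStrut.isTri_τ {D : JDiag X} (hD : D.NoStrut) (hb : ∀ h, ¬ D.IsBi h) {ℓ : D.H}
    (hl : D.IsLeg ℓ) : D.IsTri (D.τ ℓ) := by
  rcases D.isLeg_or_isBi_or_isTri (D.τ ℓ) with h | h | h
  · have hp : D.Cl fun k => k = ℓ ∨ k = D.τ ℓ := by
      refine Cl.of ?_ ?_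
      · rintro x (rfl | rfl)
        · exact Or.inl (isLeg_iff.1 hl)
        · exact Or.inr (isLeg_iff.1 h)
      · rintro x (rfl | rfl)
        · exact Or.inr rfl
        · exact Or.inl (D.τ_invol ℓ)
    obtain ⟨k, rfl | rfl, ht⟩ := hD _ hp ℓ (Or.inl rfl)
    · exact absurd hl ht.not_isLeg
    · exact ht
  · exact absurd h (hb _)
  · exact h

/-- In the normal form the edge at a leg ends at a trivalent vertex, and different legs give
different half-edges there. -/
theorem Strutless.numLegs_le {D : JDiag X} (hD : D.Strutless) : D.numLegs ≤ D.triCard := by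
  obtain ⟨n, E, h1, h2, h3⟩ := exists_normal_form D
  obtain ⟨e1, e2⟩ := counts_normal_form h1
  rw [e1, e2]
  have hE := h3 hD.noStrut
  refine Nat.card_le_card_of_injective
    (fun ℓ : {h // E.IsLeg h} => (⟨E.τ ℓ.1, hE.isTri_τ h2 ℓ.2⟩ : {h // E.IsTri h})) ?_
  intro ℓ ℓ' e
  exact Subtype.ext (E.τ.injective (congrArg Subtype.val e))

end JDiag

end

/-! ### The formal Gaussian integral is a finite sum of circle-free diagrams. -/

noncomputable section

namespace JDiag

variable {X : Type u}

/-! ### Closing a diagram -/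

theorem not_isLeg_σ {D : JDiag X} {h : D.H} (hl : ¬ D.IsLeg h) : ¬ D.IsLeg (D.σ h) := fun hc => hl (by
  rw [isLeg_iff] at hc ⊢
  exact D.σ.injective hc)

section Close

variable {D : JDiag X} {π : Equiv.Perm D.H} (hπ : D.IsMatching π)
include hπ

theorem close_σ_of_leg {h : D.H} (hl : D.IsLeg h) : (D.close π hπ).σ h = π h :=
  isLeg_iff.1 (hπ.leg hl)

theorem close_σ_of_not_leg {h : D.H} (hl : ¬ D.IsLeg h) : (D.close π hπ).σ h = D.σ h :=
  congrArg D.σ ((hπ.2 h).2 hl)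

theorem close_isTri {h : D.H} : (D.close π hπ).IsTri h ↔ D.IsTri h := by
  by_cases hl : D.IsLeg h
  · refine iff_of_false (fun ht => ht.2 ?_) fun ht => ht.not_isLeg hl
    rw [close_σ_of_leg hπ hl]
    exact (close_σ_of_leg hπ (hπ.leg hl)).trans (hπ.1 h)
  · unfold IsTri
    have e1 := close_σ_of_not_leg hπ hl
    have e2 := close_σ_of_not_leg hπ (not_isLeg_σ hl)
    rw [e1]
    refine and_congr Iff.rfl (not_congr ?_)
    exact (congrArg (· = h) e2).to_iff

theorem close_triCard : (D.close π hπ).triCard = D.triCard :=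
  Nat.card_congr (Equiv.subtypeEquivRight fun _ => close_isTri hπ)

end Close

theorem close_degree {D : JDiag X} {π : Equiv.Perm D.H} (hπ : D.IsMatching π) :
    (D.close π hπ).degree = D.triCard / 3 / 2 := by
  have : (D.close π hπ).numLegs = 0 := numLegs_eq_zero.2 fun h hl => Bool.noConfusion hl
  rw [degree_eq, this, zero_add, close_triCard hπ]

/-- Gluing never separates the components of D, and its trivalent vertices survive. A half-edge of
K, being a leg, is glued to D. So each component of the result contains a trivalent vertex. -/
theorem close_circleFree {K D : JDiag X} (hK : ∀ h, K.IsLeg h) (hD : D.Strutless)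
    {π : Equiv.Perm (K.H ⊕ D.H)} (hπ : (K.union D).IsMatching π) (hg : IsGluing K D π) :
    ((K.union D).close π hπ).CircleFree := by
  have h1 : ∀ {a b : D.H}, D.SameComp a b →
      ((K.union D).close π hπ).SameComp (Sum.inr a) (Sum.inr b) := by
    intro a b hab
    induction hab with
    | rel a b hab =>
      rcases hab with rfl | rfl
      -- Gluing changes σ at legs only, and there σ was trivial, so no connection inside D is lost.
      · by_cases hl : D.IsLeg a
        · rw [isLeg_iff.1 hl]
          exact .refl _
        · exact .rel _ _ (Or.inl (close_σ_of_not_leg (D := K.union D) hπ (h := Sum.inr a) hl).symm)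
      · exact .rel _ _ (Or.inr rfl)
    | refl a => exact .refl _
    | symm a b _ ih => exact .symm _ _ ih
    | trans a b c _ _ ih ih' => exact .trans _ _ _ ih ih'
  have h2 : ∀ x : D.H, ∃ k, ((K.union D).close π hπ).SameComp (Sum.inr x) k ∧
      ¬ ((K.union D).close π hπ).IsBi k := by
    intro x
    obtain ⟨k, hk, ht⟩ := hD x
    refine ⟨Sum.inr k, h1 hk, fun hb => hb.not_isTri ?_⟩
    exact (close_isTri (D := K.union D) hπ).2 (union_isTri_inr.2 ht)
  rintro (x | x)
  · have hl : (K.union D).IsLeg (Sum.inl x) := hK x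
    have hs := close_σ_of_leg (D := K.union D) hπ hl
    obtain ⟨-, h3⟩ := hg (Sum.inl x) hl
    rcases hy : π (Sum.inl x) with y | y
    · rw [hy] at h3
      exact absurd h3 (by simp)
    · obtain ⟨k, hk, hb⟩ := h2 y
      exact ⟨k, .trans _ _ _ (.rel _ _ (Or.inl (hs.trans hy).symm)) hk, hb⟩
  · exact h2 x

variable (𝕜 : Type*) [Field 𝕜]

/-- The span of the diagrams that consist of `k` struts. -/
def strutSpan (X : Type u) (k : ℕ) : Submodule 𝕜 (Space 𝕜 X) :=
  Submodule.span 𝕜 {x | ∃ K : JDiag X, (∀ h, K.IsLeg h) ∧ K.numLegs = 2 * k ∧ x = el 𝕜 K}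

theorem strut_isLeg (a b : X) (h : (strut a b).H) : (strut a b).IsLeg h := by
  rcases h with _ | _ <;> rfl

theorem strut_numLegs (a b : X) : (strut a b).numLegs = 2 := by
  have e : {x // (strut a b).IsLeg x} ≃ Bool := Equiv.subtypeUnivEquiv (strut_isLeg a b)
  rw [numLegs, Nat.card_congr e]
  simp

theorem mul_st_mem_strutSpan {k : ℕ} {x : Space 𝕜 X} (hx : x ∈ strutSpan 𝕜 X k) (a b : X) :
    x * st 𝕜 a b ∈ strutSpan 𝕜 X (k + 1) := by
  induction hx using Submodule.span_induction with
  | mem x hx =>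
    obtain ⟨K, h1, h2, rfl⟩ := hx
    rw [el_mul]
    refine Submodule.subset_span ⟨K.union (strut a b), ?_, ?_, rfl⟩
    · rintro (h | h)
      · exact h1 h
      · exact strut_isLeg a b h
    · rw [union_numLegs, h2, strut_numLegs]
      ring
  | zero =>
    rw [zero_mul]
    exact zero_mem _
  | add x y _ _ hx hy =>
    rw [add_mul]
    exact add_mem hx hy
  | smul c x _ hx =>
    rw [smul_mul_assoc]
    exact Submodule.smul_mem _ _ hx

variable [Fintype X]

theorem halfForm_pow_mem_strutSpan (M : Matrix X X 𝕜) (k : ℕ) :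
    halfForm 𝕜 M ^ k ∈ strutSpan 𝕜 X k := by
  induction k with
  | zero =>
    rw [pow_zero, ← el_empty]
    exact Submodule.subset_span ⟨empty X, fun h => h.elim, numLegs_eq_zero.2 empty_legless, rfl⟩
  | succ k ih =>
    rw [pow_succ]
    nth_rw 2 [halfForm_eq]
    rw [mul_smul_comm, Finset.mul_sum]
    refine Submodule.smul_mem _ _ (sum_mem fun a _ => ?_)
    rw [Finset.mul_sum]
    refine sum_mem fun b _ => ?_
    rw [mul_smul_comm]
    exact Submodule.smul_mem _ _ (mul_st_mem_strutSpan 𝕜 ih a b)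

theorem coeff_gaussian_mem (M : Matrix X X 𝕜) (k : ℕ) :
    PowerSeries.coeff k (gaussian 𝕜 M) ∈ strutSpan 𝕜 X k := by
  rw [gaussian, PowerSeries.coeff_mk]
  exact Submodule.smul_mem _ _ (halfForm_pow_mem_strutSpan 𝕜 M k)

theorem pairing_opN (x y : Space 𝕜 X) : pairing 𝕜 (opN 𝕜 x) y = pairing 𝕜 x (opN 𝕜 y) := by
  rw [opN_apply, opN_apply, map_sum, map_sum, LinearMap.sum_apply]
  exact Finset.sum_congr rfl fun a _ => pairing_opE 𝕜 a a x y

variable [CharZero 𝕜]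

theorem pairing_eq_zero_of_numLegs {K D : JDiag X} (h : K.numLegs ≠ D.numLegs) :
    pairing 𝕜 (el 𝕜 K) (el 𝕜 D) = 0 := by
  have h1 := pairing_opN 𝕜 (el 𝕜 K) (el 𝕜 D)
  rw [opN_el, opN_el, map_smul, map_smul, LinearMap.smul_apply, ← sub_eq_zero, ← sub_smul,
    smul_eq_zero, sub_eq_zero] at h1
  exact h1.resolve_left fun e => h (by exact_mod_cast e)

/-- The total number of legs is a self-adjoint grading, so k struts pair only with diagrams that
have 2k legs. -/
theorem pairing_strutSpan_eq_zero {k : ℕ} {x : Space 𝕜 X} (hx : x ∈ strutSpan 𝕜 X k) {D : JDiag X}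
    (h : D.numLegs ≠ 2 * k) : pairing 𝕜 x (el 𝕜 D) = 0 := by
  induction hx using Submodule.span_induction with
  | mem x hx =>
    obtain ⟨K, h1, h2, rfl⟩ := hx
    exact pairing_eq_zero_of_numLegs 𝕜 (by omega)
  | zero => rw [map_zero, LinearMap.zero_apply]
  | add x y _ _ hx hy => rw [map_add, LinearMap.add_apply, hx, hy, add_zero]
  | smul c x _ hx => rw [map_smul, LinearMap.smul_apply, hx, smul_zero]

/-- With 2k legs in degree d + k, at most 2d + 1 trivalent vertices are left, hence at most 6d + 5
half-edges to hold the legs. The bound allows for the rounding in `degree` and `numTri`. -/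
theorem pairing_strutSpan_piece_eq_zero {k d : ℕ} (hk : 3 * d + 3 ≤ k) {x y : Space 𝕜 X}
    (hx : x ∈ strutSpan 𝕜 X k) (hy : y ∈ piece 𝕜 Strutless (d + k)) : pairing 𝕜 x y = 0 := by
  induction hy using Submodule.span_induction with
  | mem y hy =>
    obtain ⟨D, h1, h2, rfl⟩ := hy
    refine pairing_strutSpan_eq_zero 𝕜 hx fun e => ?_
    have := h1.numLegs_le
    rw [degree_eq] at h2
    omega
  | zero => rw [map_zero]
  | add x y _ _ hx hy => rw [map_add, hx, hy, add_zero]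
  | smul c x _ hx => rw [map_smul, hx, smul_zero]

theorem pairing_strutSpan_piece_mem {k d : ℕ} {x y : Space 𝕜 X}
    (hx : x ∈ strutSpan 𝕜 X k) (hy : y ∈ piece 𝕜 Strutless (d + k)) :
    pairing 𝕜 x y ∈ manifoldPiece 𝕜 d := by
  induction hy using Submodule.span_induction with
  | mem y hy =>
    obtain ⟨D, h1, h2, rfl⟩ := hy
    by_cases hl : D.numLegs = 2 * k
    · induction hx using Submodule.span_induction with
      | mem x hx =>
        obtain ⟨K, h3, h4, rfl⟩ := hx
        rw [pairing_el]
        refine finsum_induction (· ∈ manifoldPiece 𝕜 d) (zero_mem _) (fun _ _ => add_mem) fun π => ?_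
        refine Submodule.subset_span ⟨_, close_circleFree h3 h1 π.2.1 π.2.2, ?_, rfl⟩
        have hK : K.triCard = 0 := by
          have : IsEmpty {h // K.IsTri h} := ⟨fun h => h.2.not_isLeg (h3 h.1)⟩
          exact Nat.card_of_isEmpty
        rw [close_degree, union_triCard, hK, zero_add]
        rw [degree_eq] at h2
        omega
      | zero =>
        rw [map_zero]
        exact zero_mem _
      | add x y _ _ hx hy =>
        rw [map_add]
        exact add_mem hx hy
      | smul c x _ hx =>
        rw [map_smul]
        exact Submodule.smul_mem _ _ hx
    · rw [pairing_strutSpan_eq_zero 𝕜 hx hl]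
      exact zero_mem _
  | zero =>
    rw [map_zero]
    exact zero_mem _
  | add x y _ _ hx hy =>
    rw [map_add]
    exact add_mem hx hy
  | smul c x _ hx =>
    rw [map_smul]
    exact Submodule.smul_mem _ _ hx

theorem support_pairing_gaussian_finite (M : Matrix X X 𝕜) {P : PowerSeries (Space 𝕜 X)}
    (hP : IsStrutlessSeries 𝕜 P) (d : ℕ) :
    (Function.support fun k => pairing 𝕜 (PowerSeries.coeff k (gaussian 𝕜 M))
      (PowerSeries.coeff (d + k) P)).Finite := by
  refine (Set.finite_lt_nat (3 * d + 3)).subset fun k hk => ?_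
  by_contra hc
  exact hk (pairing_strutSpan_piece_eq_zero 𝕜 (not_lt.1 hc) (coeff_gaussian_mem 𝕜 M k) (hP _))

theorem coeff_formalGaussianIntegral_mem [DecidableEq X] (Λ : Matrix X X 𝕜)
    {P : PowerSeries (Space 𝕜 X)} (hP : IsStrutlessSeries 𝕜 P) (d : ℕ) :
    PowerSeries.coeff d (formalGaussianIntegral 𝕜 Λ P) ∈ manifoldPiece 𝕜 d := by
  rw [formalGaussianIntegral, strutPairing, PowerSeries.coeff_mk]
  exact finsum_induction (· ∈ manifoldPiece 𝕜 d) (zero_mem _) (fun _ _ => add_mem) fun k =>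
    pairing_strutSpan_piece_mem 𝕜 (coeff_gaussian_mem 𝕜 _ k) (hP _)

end JDiag

end

/-! ### Counting and removing closed circles: the linear map `trunc`. -/

noncomputable section

namespace JDiag

variable {X : Type u}

/-! ### Closed circles -/

/-- The set of half-edges `p` is a union of closed circles. -/
def AllBi (D : JDiag X) (p : D.H → Prop) : Prop := D.Cl p ∧ ∀ h, p h → D.IsBi h

/-- The half-edge `h` belongs to a closed circle. -/
def Bad (D : JDiag X) (h : D.H) : Prop := ∃ p, D.AllBi p ∧ p h

/-- The number of closed circles: there are `2 ^ n` unions of `n` closed circles. -/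
def circ (D : JDiag X) : ℕ := Nat.log 2 (Nat.card {p // D.AllBi p})

theorem cl_bad (D : JDiag X) : D.Cl D.Bad :=
  Cl.of (fun h ⟨p, hp, hh⟩ => ⟨p, hp, (hp.1.1 h).2 hh⟩)
    fun h ⟨p, hp, hh⟩ => ⟨p, hp, (hp.1.2 h).2 hh⟩

theorem Bad.isBi {D : JDiag X} {h : D.H} : D.Bad h → D.IsBi h := fun ⟨_, hp, hh⟩ => hp.2 h hh

theorem allBi_bad (D : JDiag X) : D.AllBi D.Bad := ⟨D.cl_bad, fun _ => Bad.isBi⟩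

theorem allBi_empty (D : JDiag X) : D.AllBi fun _ => False :=
  ⟨⟨fun _ => Iff.rfl, fun _ => Iff.rfl⟩, fun _ => False.elim⟩

/-- The diagram without its closed circles. -/
def strip (D : JDiag X) : JDiag X := D.restrict (fun h => ¬ D.Bad h) D.cl_bad.compl

/-- The inverse of an isomorphism. -/
def Iso.symm {D E : JDiag X} (i : Iso D E) : Iso E D where
  e := i.e.symm
  σ_comm := fun h => by rw [Equiv.symm_apply_eq, i.σ_comm, Equiv.apply_symm_apply]
  τ_comm := fun h => by rw [Equiv.symm_apply_eq, i.τ_comm, Equiv.apply_symm_apply]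
  mark_comm := fun h => by rw [← i.mark_comm, Equiv.apply_symm_apply]

theorem AllBi.comap {D E : JDiag X} (i : Iso D E) {q : E.H → Prop} (hq : E.AllBi q) :
    D.AllBi fun h => q (i.e h) := by
  refine ⟨⟨fun h => ?_, fun h => ?_⟩, fun h hh => (i.isBi h).1 (hq.2 _ hh)⟩
  · dsimp only
    rw [i.σ_comm]
    exact hq.1.1 _
  · dsimp only
    rw [i.τ_comm]
    exact hq.1.2 _

theorem Iso.bad {D E : JDiag X} (i : Iso D E) (h : D.H) : E.Bad (i.e h) ↔ D.Bad h := by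
  constructor
  · rintro ⟨q, hq, hh⟩
    exact ⟨_, hq.comap i, hh⟩
  · rintro ⟨p, hp, hh⟩
    refine ⟨_, hp.comap i.symm, ?_⟩
    change p (i.e.symm (i.e h))
    rwa [i.e.symm_apply_apply]

theorem Iso.circ {D E : JDiag X} (i : Iso D E) : D.circ = E.circ := by
  refine congrArg (Nat.log 2) (Nat.card_congr ?_)
  exact
    { toFun := fun p => ⟨_, p.2.comap i.symm⟩
      invFun := fun q => ⟨_, q.2.comap i⟩
      left_inv := fun p => Subtype.ext (funext fun h => congrArg p.1 (i.e.symm_apply_apply h))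
      right_inv := fun q => Subtype.ext (funext fun h => congrArg q.1 (i.e.apply_symm_apply h)) }

theorem Iso.strip {D E : JDiag X} (i : Iso D E) : cls D.strip = cls E.strip := by
  let e : {h // ¬ D.Bad h} ≃ {h // ¬ E.Bad h} :=
    i.e.subtypeEquiv fun h => not_congr (i.bad h).symm
  exact cls_iso ⟨e, fun h => Subtype.ext (i.σ_comm h.1), fun h => Subtype.ext (i.τ_comm h.1),
    fun h => i.mark_comm h.1⟩

section Subdiv

variable {D : JDiag X} {a : D.H}

theorem AllBi.subdiv {p : D.H → Prop} (hp : D.AllBi p) : (D.subdiv a).AllBi (subdivSet a p) := by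
  refine ⟨hp.1.subdiv a, ?_⟩
  rintro (h | h) hh
  · exact subdiv_isBi_inl.2 (hp.2 h hh)
  · exact subdiv_isBi_inr h

/-- A new subdivision point lies in the same components as its edge. So unions of circles correspond
before and after subdivision, and their number is a homeomorphism invariant. -/
theorem AllBi.inr_iff {q : D.H ⊕ Bool → Prop} (hq : (D.subdiv a).AllBi q) (b : Bool) :
    q (Sum.inr b) ↔ q (Sum.inl a) := by
  have h1 : q (Sum.inr false) ↔ q (Sum.inl a) := by
    have := hq.1.2 (Sum.inl a)
    rwa [subdiv_τ_inl_self] at this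
  cases b
  · exact h1
  · exact (hq.1.1 (Sum.inr false)).trans h1

theorem AllBi.comap_inl {q : D.H ⊕ Bool → Prop} (hq : (D.subdiv a).AllBi q) :
    D.AllBi fun h => q (Sum.inl h) := by
  have h1 : q (Sum.inl (D.τ a)) ↔ q (Sum.inl a) := by
    have := hq.1.2 (Sum.inl (D.τ a))
    rw [subdiv_τ_inl_τ] at this
    exact this.symm.trans (hq.inr_iff true)
  refine ⟨⟨fun h => hq.1.1 (Sum.inl h), fun h => ?_⟩, fun h hh => subdiv_isBi_inl.1 (hq.2 _ hh)⟩
  by_cases e : h = a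
  · rw [e]
    exact h1
  · by_cases e' : h = D.τ a
    · rw [e', D.τ_invol]
      exact h1.symm
    · have := hq.1.2 (Sum.inl h)
      rwa [subdiv_τ_inl D a h e e'] at this

theorem AllBi.subdivSet_inl {q : D.H ⊕ Bool → Prop} (hq : (D.subdiv a).AllBi q) :
    subdivSet a (fun h => q (Sum.inl h)) = q := by
  funext z
  rcases z with h | b
  · rfl
  · exact propext (hq.inr_iff b).symm

theorem subdiv_circ : (D.subdiv a).circ = D.circ := by
  refine congrArg (Nat.log 2) (Nat.card_congr ?_)
  exact
    { toFun := fun q => ⟨_, AllBi.comap_inl q.2⟩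
      invFun := fun p => ⟨_, p.2.subdiv⟩
      left_inv := fun q => Subtype.ext (AllBi.subdivSet_inl q.2)
      right_inv := fun p => rfl }

theorem subdiv_bad_inl {h : D.H} : (D.subdiv a).Bad (Sum.inl h) ↔ D.Bad h := by
  constructor
  · rintro ⟨q, hq, hh⟩
    exact ⟨_, AllBi.comap_inl hq, hh⟩
  · rintro ⟨p, hp, hh⟩
    exact ⟨_, hp.subdiv, hh⟩

theorem subdiv_bad_inr {b : Bool} : (D.subdiv a).Bad (Sum.inr b) ↔ D.Bad a :=
  (AllBi.inr_iff (D.subdiv a).allBi_bad b).trans subdiv_bad_inl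

theorem subdiv_strip : cls (D.subdiv a).strip = cls D.strip := by
  -- A subdivision point on a circle is removed together with it; otherwise stripping commutes with
  -- the subdivision.
  by_cases ha : D.Bad a
  · have hτ : D.Bad (D.τ a) := (D.cl_bad.2 a).2 ha
    let f : {h // ¬ D.Bad h} → {z // ¬ (D.subdiv a).Bad z} :=
      fun h => ⟨Sum.inl h.1, fun hc => h.2 (subdiv_bad_inl.1 hc)⟩
    have hf : Function.Bijective f := by
      constructor
      · intro h k e
        exact Subtype.ext (Sum.inl_injective (congrArg Subtype.val e))
      · rintro ⟨h | b, hz⟩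
        · exact ⟨⟨h, fun hc => hz (subdiv_bad_inl.2 hc)⟩, rfl⟩
        · exact absurd (subdiv_bad_inr.2 ha) hz
    refine (cls_iso ⟨Equiv.ofBijective f hf, fun h => rfl, fun h => Subtype.ext ?_,
      fun h => rfl⟩).symm
    exact (subdiv_τ_inl D a h.1 (fun e => h.2 (e ▸ ha)) (fun e => h.2 (e ▸ hτ))).symm
  · let a' : D.strip.H := ⟨a, ha⟩
    let f : {h // ¬ D.Bad h} ⊕ Bool → {z // ¬ (D.subdiv a).Bad z} :=
      Sum.elim (fun h => ⟨Sum.inl h.1, fun hc => h.2 (subdiv_bad_inl.1 hc)⟩)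
        fun b => ⟨Sum.inr b, fun hc => ha (subdiv_bad_inr.1 hc)⟩
    have hf : Function.Bijective f := by
      constructor
      · rintro (h | b) (k | c) e
        · exact congrArg Sum.inl (Subtype.ext (Sum.inl_injective (congrArg Subtype.val e)))
        · exact absurd (congrArg Subtype.val e) Sum.inl_ne_inr
        · exact absurd (congrArg Subtype.val e) Sum.inr_ne_inl
        · exact congrArg Sum.inr (Sum.inr_injective (congrArg Subtype.val e))
      · rintro ⟨h | b, hz⟩
        · exact ⟨Sum.inl ⟨h, fun hc => hz (subdiv_bad_inl.2 hc)⟩, rfl⟩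
        · exact ⟨Sum.inr b, rfl⟩
    rw [← cls_subdiv D.strip a']
    refine (cls_iso ⟨Equiv.ofBijective f hf, ?_, ?_, ?_⟩).symm
    · rintro (h | b) <;> rfl
    · rintro (h | _ | _)
      · refine Subtype.ext ?_
        by_cases e : h = a'
        · subst e
          refine (congrArg (fun z => (f z).1) (subdiv_τ_inl_self D.strip a')).trans ?_
          exact (subdiv_τ_inl_self D a).symm
        · by_cases e' : h = D.strip.τ a'
          · subst e'
            refine (congrArg (fun z => (f z).1) (subdiv_τ_inl_τ D.strip a')).trans ?_
            exact (subdiv_τ_inl_τ D a).symm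
          · refine (congrArg (fun z => (f z).1) (subdiv_τ_inl D.strip a' h e e')).trans ?_
            exact (subdiv_τ_inl D a h.1 (fun e2 => e (Subtype.ext e2))
              (fun e2 => e' (Subtype.ext e2))).symm
      · refine Subtype.ext ((congrArg (fun z => (f z).1) (subdiv_τ_false D.strip a')).trans ?_)
        exact (subdiv_τ_false D a).symm
      · refine Subtype.ext ((congrArg (fun z => (f z).1) (subdiv_τ_true D.strip a')).trans ?_)
        exact (subdiv_τ_true D a).symm
    · rintro (h | b) <;> rfl

end Subdiv

theorem Step.circ {D E : JDiag X} (s : Step D E) : D.circ = E.circ := by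
  cases s with
  | iso i => exact i.circ
  | subdiv h => exact subdiv_circ.symm

theorem Step.strip {D E : JDiag X} (s : Step D E) : cls D.strip = cls E.strip := by
  cases s with
  | iso i => exact i.strip
  | subdiv h => exact subdiv_strip.symm

theorem Step.degree {D E : JDiag X} (s : Step D E) : D.degree = E.degree := by
  rw [degree_eq, degree_eq, s.triCard, s.numLegs]

section Union

variable {C D : JDiag X}

theorem union_allBi {q : C.H ⊕ D.H → Prop} : (C.union D).AllBi q ↔
    (C.AllBi fun h => q (Sum.inl h)) ∧ D.AllBi fun h => q (Sum.inr h) := by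
  constructor
  · intro hq
    exact ⟨⟨⟨fun h => hq.1.1 (Sum.inl h), fun h => hq.1.2 (Sum.inl h)⟩,
      fun h hh => union_isBi_inl.1 (hq.2 _ hh)⟩,
      ⟨⟨fun h => hq.1.1 (Sum.inr h), fun h => hq.1.2 (Sum.inr h)⟩,
      fun h hh => union_isBi_inr.1 (hq.2 _ hh)⟩⟩
  · rintro ⟨h1, h2⟩
    refine ⟨⟨?_, ?_⟩, ?_⟩
    · rintro (h | h)
      · exact h1.1.1 h
      · exact h2.1.1 h
    · rintro (h | h)
      · exact h1.1.2 h
      · exact h2.1.2 h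
    · rintro (h | h) hh
      · exact union_isBi_inl.2 (h1.2 h hh)
      · exact union_isBi_inr.2 (h2.2 h hh)

theorem union_bad_inl {h : C.H} : (C.union D).Bad (Sum.inl h) ↔ C.Bad h := by
  constructor
  · rintro ⟨q, hq, hh⟩
    exact ⟨_, (union_allBi.1 hq).1, hh⟩
  · rintro ⟨p, hp, hh⟩
    exact ⟨Sum.elim p fun _ => False, union_allBi.2 ⟨hp, D.allBi_empty⟩, hh⟩

theorem union_bad_inr {h : D.H} : (C.union D).Bad (Sum.inr h) ↔ D.Bad h := by
  constructor
  · rintro ⟨q, hq, hh⟩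
    exact ⟨_, (union_allBi.1 hq).2, hh⟩
  · rintro ⟨p, hp, hh⟩
    exact ⟨Sum.elim (fun _ => False) p, union_allBi.2 ⟨C.allBi_empty, hp⟩, hh⟩

/-- Counting unions of circles is multiplicative, so its binary logarithm adds one for each circle;
no enumeration of components is needed. -/
theorem card_union_allBi : Nat.card {q // (C.union D).AllBi q} =
    Nat.card {p // C.AllBi p} * Nat.card {p // D.AllBi p} := by
  rw [← Nat.card_prod]
  refine Nat.card_congr ?_
  exact
    { toFun := fun q => ⟨⟨_, (union_allBi.1 q.2).1⟩, ⟨_, (union_allBi.1 q.2).2⟩⟩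
      invFun := fun p => ⟨Sum.elim p.1.1 p.2.1, union_allBi.2 ⟨p.1.2, p.2.2⟩⟩
      left_inv := fun q => Subtype.ext (funext fun z => by rcases z with z | z <;> rfl)
      right_inv := fun p => rfl }

end Union

theorem card_allBi_circle : Nat.card {p // (circle X).AllBi p} = 2 := by
  have h1 : ∀ p : Bool → Prop, (circle X).AllBi p → (p true ↔ p false) := fun p hp => hp.1.1 false
  have h2 : (circle X).AllBi fun _ => True :=
    ⟨⟨fun _ => Iff.rfl, fun _ => Iff.rfl⟩, fun h _ => circle_isBi h⟩
  let f : Bool → {p // (circle X).AllBi p} := fun b =>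
    if b then ⟨_, h2⟩ else ⟨_, (circle X).allBi_empty⟩
  have hf : Function.Bijective f := by
    constructor
    · rintro (_ | _) (_ | _) e
      · rfl
      · exact (congrFun (congrArg Subtype.val e) true).mpr trivial |>.elim
      · exact (congrFun (congrArg Subtype.val e) true).mp trivial |>.elim
      · rfl
    · rintro ⟨p, hp⟩
      by_cases ht : p true
      · refine ⟨true, Subtype.ext (funext fun b => ?_)⟩
        rcases b with _ | _
        · exact (eq_true ((h1 p hp).1 ht)).symm
        · exact (eq_true ht).symm
      · refine ⟨false, Subtype.ext (funext fun b => ?_)⟩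
        rcases b with _ | _
        · exact (eq_false (fun hc => ht ((h1 p hp).2 hc))).symm
        · exact (eq_false ht).symm
  rw [← Nat.card_congr (Equiv.ofBijective f hf)]
  simp

theorem circle_union_circ (D : JDiag X) : ((circle X).union D).circ = D.circ + 1 := by
  have : Nonempty {p // D.AllBi p} := ⟨⟨_, D.allBi_empty⟩⟩
  rw [circ, card_union_allBi, card_allBi_circle, mul_comm,
    Nat.log_mul_base one_lt_two Nat.card_pos.ne', circ]

theorem circle_union_strip (D : JDiag X) : cls ((circle X).union D).strip = cls D.strip := by
  have hc : ∀ h, (circle X).Bad h := fun h =>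
    ⟨fun _ => True, ⟨⟨fun _ => Iff.rfl, fun _ => Iff.rfl⟩, fun h _ => circle_isBi h⟩, trivial⟩
  let f : {h // ¬ D.Bad h} → {z // ¬ ((circle X).union D).Bad z} :=
    fun h => ⟨Sum.inr h.1, fun hc => h.2 (union_bad_inr.1 hc)⟩
  have hf : Function.Bijective f := by
    constructor
    · intro h k e
      exact Subtype.ext (Sum.inr_injective (congrArg Subtype.val e))
    · rintro ⟨h | h, hz⟩
      · exact absurd (union_bad_inl.2 (hc h)) hz
      · exact ⟨⟨h, fun hc => hz (union_bad_inr.2 hc)⟩, rfl⟩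
  exact (cls_iso ⟨Equiv.ofBijective f hf, fun h => rfl, fun h => rfl, fun h => rfl⟩).symm

theorem circle_union_degree (D : JDiag X) : ((circle X).union D).degree = D.degree := by
  rw [degree_eq, degree_eq, union_numLegs, union_triCard, circle_numLegs, circle_triCard, zero_add,
    zero_add]

theorem CircleFree.not_bad {D : JDiag X} (hD : D.CircleFree) (h : D.H) : ¬ D.Bad h := by
  rintro ⟨p, hp, hh⟩
  obtain ⟨k, hk, hb⟩ := hD h
  exact hb (hp.2 k ((hp.1.sameComp hk).1 hh))

theorem CircleFree.circ_eq {D : JDiag X} (hD : D.CircleFree) : D.circ = 0 := by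
  have u : ∀ p : {p // D.AllBi p}, p = ⟨_, D.allBi_empty⟩ := fun p =>
    Subtype.ext (funext fun h => eq_false fun hh => hD.not_bad h ⟨p.1, p.2, hh⟩)
  have : Unique {p // D.AllBi p} := ⟨⟨⟨_, D.allBi_empty⟩⟩, u⟩
  rw [circ, Nat.card_unique]
  simp

theorem CircleFree.strip_eq {D : JDiag X} (hD : D.CircleFree) : cls D.strip = cls D :=
  cls_iso ⟨Equiv.subtypeUnivEquiv hD.not_bad, fun _ => rfl, fun _ => rfl, fun _ => rfl⟩

section Rearrange

variable {D : JDiag X} {ρ : Equiv.Perm D.H} {hρ : ∀ h, D.mark (ρ h) = D.mark h}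

theorem rearrange_σ (h : D.H) : (D.rearrange ρ hρ).σ (ρ h) = ρ (D.σ h) :=
  congrArg (fun x => ρ (D.σ x)) (ρ.symm_apply_apply h)

theorem rearrange_σ_eq (h : D.H) : (D.rearrange ρ hρ).σ (ρ h) = ρ h ↔ D.σ h = h := by
  refine Iff.trans ?_ ρ.injective.eq_iff
  rw [rearrange_σ]
  exact Iff.rfl

theorem rearrange_σ_σ_eq (h : D.H) :
    (D.rearrange ρ hρ).σ ((D.rearrange ρ hρ).σ (ρ h)) = ρ h ↔ D.σ (D.σ h) = h := by
  refine Iff.trans ?_ ρ.injective.eq_iff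
  rw [rearrange_σ, rearrange_σ]
  exact Iff.rfl

theorem rearrange_triCard : (D.rearrange ρ hρ).triCard = D.triCard :=
  (Nat.card_congr (Equiv.subtypeEquiv ρ fun h =>
    (and_congr (not_congr (rearrange_σ_eq h)) (not_congr (rearrange_σ_σ_eq h))).symm)).symm

theorem rearrange_degree : (D.rearrange ρ hρ).degree = D.degree := by
  rw [degree_eq, degree_eq, rearrange_triCard]
  rfl

theorem rearrange_isBi {h : D.H} : (D.rearrange ρ hρ).IsBi h ↔ D.IsBi (ρ⁻¹ h) := by
  obtain ⟨h, rfl⟩ := ρ.surjective h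
  rw [show ρ⁻¹ (ρ h) = h from ρ.symm_apply_apply h]
  exact and_congr (not_congr (rearrange_σ_eq h)) (rearrange_σ_σ_eq h)

variable (hfix : ∀ h, D.IsBi h → ρ h = h)
include hfix

/-- A rearrangement that fixes all half-edges at subdivision points does not touch closed circles.
The moves of `AS` and `IHX` are of this kind, since they move half-edges at trivalent vertices only.
-/
theorem rearrange_allBi {p : D.H → Prop} : (D.rearrange ρ hρ).AllBi p ↔ D.AllBi p := by
  constructor
  · intro hp
    have h1 : ∀ h, p h → ρ h = h := fun h hh => by
      have := hfix _ (rearrange_isBi.1 (hp.2 h hh))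
      have e : ρ (ρ⁻¹ h) = h := ρ.apply_symm_apply h
      rw [e] at this
      nth_rw 1 [this]
      exact e
    have h1' : ∀ h, p h → ρ⁻¹ h = h := fun h hh => by
      rw [Equiv.Perm.inv_eq_iff_eq, h1 h hh]
    refine ⟨Cl.of (fun h hh => ?_) (fun h hh => (hp.1.2 h).2 hh), fun h hh => ?_⟩
    · have h2 : p (ρ (D.σ (ρ⁻¹ h))) := (hp.1.1 h).2 hh
      rw [h1' h hh] at h2
      have h3 := h1 _ h2
      rw [ρ.injective h3] at h2
      exact h2
    · have := rearrange_isBi.1 (hp.2 h hh)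
      rwa [h1' h hh] at this
  · intro hp
    have h1 : ∀ h, p h → ρ h = h := fun h hh => hfix h (hp.2 h hh)
    have h1' : ∀ h, p h → ρ⁻¹ h = h := fun h hh => by
      rw [Equiv.Perm.inv_eq_iff_eq, h1 h hh]
    refine ⟨Cl.of (fun h hh => ?_) (fun h hh => (hp.1.2 h).2 hh), fun h hh => ?_⟩
    · change p (ρ (D.σ (ρ⁻¹ h)))
      have h2 := (hp.1.1 h).2 hh
      rw [h1' h hh, h1 _ h2]
      exact h2
    · refine rearrange_isBi.2 ?_
      rw [h1' h hh]
      exact hp.2 h hh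

theorem rearrange_bad {h : D.H} : (D.rearrange ρ hρ).Bad h ↔ D.Bad h :=
  exists_congr fun _ => and_congr (rearrange_allBi hfix) Iff.rfl

theorem rearrange_circ : (D.rearrange ρ hρ).circ = D.circ :=
  congrArg (Nat.log 2)
    (Nat.card_congr (Equiv.subtypeEquivRight fun _ => rearrange_allBi hfix))

theorem rearrange_strip (ρ' : Equiv.Perm D.strip.H)
    (hρ' : ∀ h, D.strip.mark (ρ' h) = D.strip.mark h)
    (h' : ∀ h : {h // ¬ D.Bad h}, Subtype.val (p := fun h => ¬ D.Bad h) (ρ' h) = ρ h.1) :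
    cls (D.rearrange ρ hρ).strip = cls (D.strip.rearrange ρ' hρ') := by
  let e : {h // ¬ (D.rearrange ρ hρ).Bad h} ≃ {h // ¬ D.Bad h} :=
    Equiv.subtypeEquivRight fun h => not_congr (rearrange_bad hfix)
  have hinv : ∀ h : {h // ¬ D.Bad h}, Subtype.val (p := fun h => ¬ D.Bad h) (ρ'⁻¹ h) = ρ⁻¹ h.1 := by
    intro h
    obtain ⟨h, rfl⟩ := ρ'.surjective h
    have e1 : ρ'⁻¹ (ρ' h) = h := ρ'.symm_apply_apply h
    rw [e1]
    refine Eq.symm ((Equiv.Perm.inv_eq_iff_eq).2 ?_)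
    exact h' h
  refine cls_iso ⟨e, fun h => Subtype.ext ?_, fun h => rfl, fun h => rfl⟩
  refine Eq.symm ((h' _).trans (congrArg ρ ?_))
  exact congrArg D.σ (hinv (e h))

end Rearrange

theorem pswap_of_isBi {D : JDiag X} {a b : D.H} (ha : D.IsTri a) (hb : D.IsTri b) {h : D.H}
    (hh : D.IsBi h) : pswap a b h = h :=
  pswap_of_ne (fun e => hh.not_isTri (e ▸ ha)) (fun e => hh.not_isTri (e ▸ hb))

theorem ihxPerm_of_isBi {D : JDiag X} {a : D.H} (ha : D.IsIHXEdge a) {h : D.H} (hh : D.IsBi h) :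
    D.ihxPerm a h = h := by
  unfold ihxPerm
  rw [Equiv.Perm.mul_apply, pswap_of_isBi ha.tri.map.map ha.tri'.map hh,
    pswap_of_isBi ha.tri.map ha.tri.map.map hh]

theorem IsTri.not_bad {D : JDiag X} {h : D.H} (ht : D.IsTri h) : ¬ D.Bad h :=
  fun hb => hb.isBi.not_isTri ht

variable (𝕜 : Type*) [Field 𝕜]

theorem el_congr {D E : JDiag X} (h : cls D = cls E) : el 𝕜 D = el 𝕜 E := by
  unfold el
  rw [h]

theorem strip_flip (D : JDiag X) (h : D.H) (ht : D.IsTri h) :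
    el 𝕜 D.strip + el 𝕜 (D.flip h ht).strip = 0 := by
  let h' : D.strip.H := ⟨h, ht.not_bad⟩
  have ht' : D.strip.IsTri h' := restrict_isTri.2 ht
  have e : cls (D.flip h ht).strip = cls (D.strip.flip h' ht') :=
    rearrange_strip (fun x hx => pswap_of_isBi ht.map ht.map.map hx) _ _ fun x =>
      pswap_map (f := Subtype.val (p := fun h => ¬ D.Bad h)) Subtype.val_injective _ _ _
  rw [el_congr 𝕜 e]
  exact el_flip 𝕜 D.strip h' ht'

theorem strip_ihxPerm (D : JDiag X) (h : {h // ¬ D.Bad h}) (x : {h // ¬ D.Bad h}) :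
    Subtype.val (p := fun h => ¬ D.Bad h) (D.strip.ihxPerm h x) = D.ihxPerm h.1 x.1 := by
  have key := fun a b x : {h // ¬ D.Bad h} =>
    pswap_map (f := Subtype.val (p := fun h => ¬ D.Bad h)) Subtype.val_injective a b x
  exact (key _ _ _).trans (congrArg _ (key _ _ _))

theorem strip_ihx (D : JDiag X) (h : D.H) (hh : D.IsIHXEdge h) :
    el 𝕜 D.strip + el 𝕜 (D.ihx₁ h hh).strip + el 𝕜 (D.ihx₂ h hh).strip = 0 := by
  let h' : D.strip.H := ⟨h, hh.tri.not_bad⟩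
  have hh' : D.strip.IsIHXEdge h' :=
    ⟨restrict_isTri.2 hh.tri, restrict_isTri.2 hh.tri', fun e => hh.ne₁ (congrArg Subtype.val e),
      fun e => hh.ne₂ (congrArg Subtype.val e)⟩
  have e1 : cls (D.ihx₁ h hh).strip = cls (D.strip.ihx₁ h' hh') :=
    rearrange_strip (fun x hx => ihxPerm_of_isBi hh hx) _ _ fun x => strip_ihxPerm D _ x
  have e2 : cls (D.ihx₂ h hh).strip = cls (D.strip.ihx₂ h' hh') :=
    rearrange_strip (fun x hx => by
      rw [Equiv.Perm.mul_apply, ihxPerm_of_isBi hh hx, ihxPerm_of_isBi hh hx]) _ _ fun x =>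
      (strip_ihxPerm D _ _).trans (congrArg _ (strip_ihxPerm D _ x))
  rw [el_congr 𝕜 e1, el_congr 𝕜 e2]
  exact el_ihx 𝕜 D.strip h' hh'

/-- Truncation in degrees above `m` and replacement of circles by `-2m`. -/
def truncFun (m : ℕ) (D : JDiag X) : Space 𝕜 X :=
  if D.degree ≤ m then (-2 * m : 𝕜) ^ D.circ • el 𝕜 D.strip else 0

theorem truncFun_of_le {m : ℕ} {D : JDiag X} (h : D.degree ≤ m) :
    truncFun 𝕜 m D = (-2 * m : 𝕜) ^ D.circ • el 𝕜 D.strip := if_pos h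

theorem truncFun_of_not_le {m : ℕ} {D : JDiag X} (h : ¬ D.degree ≤ m) :
    truncFun 𝕜 m D = 0 := if_neg h

/-- `truncFun` on homeomorphism classes. -/
def truncCls (m : ℕ) : Cls X → Space 𝕜 X :=
  Quot.lift (truncFun 𝕜 m) fun D E s => by
    unfold truncFun
    rw [s.degree, s.circ, el_congr 𝕜 s.strip]

/-- The terms of a relator have equal degrees and equally many circles, and their stripped diagrams
form a relator of the same kind. -/
theorem truncCls_relator (m : ℕ) (r : MonoidAlgebra 𝕜 (Cls X)) (hr : IsRelator 𝕜 r) :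
    extend 𝕜 (truncCls 𝕜 m) r = 0 := by
  cases hr with
  | as D h ht =>
    rw [map_add, extend_single, extend_single, one_smul, one_smul]
    change truncFun 𝕜 m D + truncFun 𝕜 m (D.flip h ht) = 0
    have e1 : (D.flip h ht).degree = D.degree := rearrange_degree
    have e2 : (D.flip h ht).circ = D.circ :=
      rearrange_circ fun x hx => pswap_of_isBi ht.map ht.map.map hx
    unfold truncFun
    rw [e1, e2]
    split_ifs
    · rw [← smul_add, strip_flip, smul_zero]
    · exact add_zero 0
  | ihx D h hh =>
    rw [map_add, map_add, extend_single, extend_single, extend_single, one_smul, one_smul, one_smul]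
    change truncFun 𝕜 m D + truncFun 𝕜 m (D.ihx₁ h hh) + truncFun 𝕜 m (D.ihx₂ h hh) = 0
    have e1 : (D.ihx₁ h hh).degree = D.degree := rearrange_degree
    have e2 : (D.ihx₁ h hh).circ = D.circ := rearrange_circ fun x hx => ihxPerm_of_isBi hh hx
    have e3 : (D.ihx₂ h hh).degree = D.degree := rearrange_degree
    have e4 : (D.ihx₂ h hh).circ = D.circ := rearrange_circ fun x hx => by
      rw [Equiv.Perm.mul_apply, ihxPerm_of_isBi hh hx, ihxPerm_of_isBi hh hx]
    unfold truncFun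
    rw [e1, e2, e3, e4]
    split_ifs
    · rw [← smul_add, ← smul_add, strip_ihx, smul_zero]
    · simp

/-- Truncation in degrees above `m` and replacement of circles by `-2m`. -/
def trunc (X : Type u) (m : ℕ) : Space 𝕜 X →ₗ[𝕜] Space 𝕜 X :=
  descend 𝕜 (truncCls 𝕜 m) (truncCls_relator 𝕜 m)

theorem trunc_el (m : ℕ) (D : JDiag X) : trunc 𝕜 X m (el 𝕜 D) = truncFun 𝕜 m D :=
  descend_el 𝕜 _ (truncCls_relator 𝕜 m) D

theorem trunc_circle_mul (m : ℕ) (x : Space 𝕜 X) :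
    trunc 𝕜 X m (el 𝕜 (circle X) * x) = (-2 * m : 𝕜) • trunc 𝕜 X m x := by
  induction x using space_induction with
  | h0 => simp
  | hadd x y hx hy => rw [mul_add, map_add, hx, hy, map_add, smul_add]
  | hsmul c x hx => rw [mul_smul_comm, map_smul, hx, map_smul, smul_comm]
  | hel D =>
    rw [el_mul, trunc_el, trunc_el]
    unfold truncFun
    rw [circle_union_degree, circle_union_circ, el_congr 𝕜 (circle_union_strip D)]
    split_ifs
    · rw [smul_smul, pow_succ']
    · rw [smul_zero]

theorem trunc_of_circleFree {m : ℕ} {D : JDiag X} (hD : D.CircleFree) (h : D.degree ≤ m) :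
    trunc 𝕜 X m (el 𝕜 D) = el 𝕜 D := by
  rw [trunc_el, truncFun_of_le 𝕜 h, hD.circ_eq, pow_zero, one_smul, el_congr 𝕜 hD.strip_eq]

end JDiag

end

/-! ### `trunc` kills the relations O_m and P_{m+1}, and the conclusion. -/

noncomputable section

namespace JDiag

variable {X : Type u}

/-! ### Struts and forks -/

theorem cl_strut {D : JDiag X} {ℓ : D.H} (h1 : D.IsLeg ℓ) (h2 : D.IsLeg (D.τ ℓ)) :
    D.Cl fun k => k = ℓ ∨ k = D.τ ℓ := by
  refine Cl.of ?_ ?_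
  · rintro x (rfl | rfl)
    · exact Or.inl (isLeg_iff.1 h1)
    · exact Or.inr (isLeg_iff.1 h2)
  · rintro x (rfl | rfl)
    · exact Or.inr rfl
    · exact Or.inl (D.τ_invol ℓ)

theorem cls_restrict_strut {D : JDiag X} {ℓ : D.H} {a b : X} (h1 : D.mark ℓ = some a)
    (h2 : D.mark (D.τ ℓ) = some b) (hp : D.Cl fun k => k = ℓ ∨ k = D.τ ℓ) :
    cls (D.restrict (fun k => k = ℓ ∨ k = D.τ ℓ) hp) = cls (strut a b) := by
  have l1 : D.IsLeg ℓ := Option.isSome_iff_exists.2 ⟨a, h1⟩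
  have l2 : D.IsLeg (D.τ ℓ) := Option.isSome_iff_exists.2 ⟨b, h2⟩
  symm
  let e : Bool → {k // k = ℓ ∨ k = D.τ ℓ} :=
    fun b => if b then ⟨D.τ ℓ, Or.inr rfl⟩ else ⟨ℓ, Or.inl rfl⟩
  have he : Function.Bijective e := by
    constructor
    · rintro (_ | _) (_ | _) h'
      · rfl
      · exact absurd (congrArg Subtype.val h').symm (D.τ_ne ℓ)
      · exact absurd (congrArg Subtype.val h') (D.τ_ne ℓ)
      · rfl
    · rintro ⟨k, rfl | rfl⟩
      · exact ⟨false, rfl⟩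
      · exact ⟨true, rfl⟩
  refine cls_iso ⟨Equiv.ofBijective e he, ?_, ?_, ?_⟩
  · rintro (_ | _)
    · exact Subtype.ext (isLeg_iff.1 l1).symm
    · exact Subtype.ext (isLeg_iff.1 l2).symm
  · rintro (_ | _)
    · exact Subtype.ext rfl
    · exact Subtype.ext (D.τ_invol ℓ).symm
  · rintro (_ | _)
    · exact h1
    · exact h2

variable (𝕜 : Type*) [Field 𝕜]

theorem el_eq_circle_pow_mul {D E : JDiag X} {n : ℕ}
    (h : cls D = cls (circle X) ^ n * cls E) : el 𝕜 D = el 𝕜 (circle X) ^ n * el 𝕜 E := by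
  unfold el
  rw [h, ← map_pow, ← map_mul, MonoidAlgebra.single_pow, one_pow, MonoidAlgebra.single_mul_single,
    one_mul]

theorem exists_el_eq_st_mul {D : JDiag X} {ℓ : D.H} {a b : X} (h1 : D.mark ℓ = some a)
    (h2 : D.mark (D.τ ℓ) = some b) : ∃ E : JDiag X, el 𝕜 D = st 𝕜 a b * el 𝕜 E := by
  have hp := cl_strut (D := D) (Option.isSome_iff_exists.2 ⟨a, h1⟩)
    (Option.isSome_iff_exists.2 ⟨b, h2⟩)
  refine ⟨D.restrict _ hp.compl, ?_⟩
  rw [st, ← el_congr 𝕜 (cls_restrict_strut h1 h2 hp), el_mul]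
  exact el_congr 𝕜 (cls_restrict D _ hp).symm

/-- A diagram with two equally marked legs at the same vertex is zero by antisymmetry. -/
theorem el_eq_zero_of_fork [CharZero 𝕜] {D : JDiag X} {ℓ ℓ' : D.H} (h1 : D.IsLeg ℓ)
    (hm : D.mark ℓ' = D.mark ℓ) (ht : D.IsTri (D.τ ℓ)) (h2 : D.τ ℓ' = D.σ (D.τ ℓ)) :
    el 𝕜 D = 0 := by
  have h1' : D.IsLeg ℓ' := by
    unfold IsLeg
    rw [hm]
    exact h1
  set t := D.τ ℓ with hℓ
  have h3 : D.σ (D.σ (D.σ t)) = t := (D.valence t).resolve_left ht.2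
  have tt : D.τ t = ℓ := D.τ_invol ℓ
  have tt' : D.τ (D.σ t) = ℓ' := by rw [← h2, D.τ_invol]
  have htc : D.IsTri (D.σ (D.σ t)) := ht.map.map
  -- ρ exchanges the two half-edges at the vertex and q the two legs. Together they form an
  -- isomorphism from D to D with that vertex reversed, so D = −D.
  let ρ : Equiv.Perm D.H := pswap t (D.σ t)
  let q : Equiv.Perm D.H := pswap ℓ ℓ'
  have hρ : ∀ h, D.IsLeg h → ρ h = h := fun h hl =>
    pswap_of_ne (fun e => ht.not_leg (e ▸ hl)) fun e => ht.map.not_leg (e ▸ hl)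
  have hqσ : ∀ h, q (D.σ h) = D.σ (q h) := fun h => by
    have := pswap_map D.σ.injective ℓ ℓ' h
    rw [isLeg_iff.1 h1, isLeg_iff.1 h1'] at this
    exact this.symm
  have hρq : ∀ h, ρ (q h) = q (ρ h) := fun h => by
    have := pswap_map ρ.injective ℓ ℓ' h
    rw [hρ _ h1, hρ _ h1'] at this
    exact this
  have hqτ : ∀ h, D.τ (q h) = ρ (D.τ h) := fun h => by
    have := pswap_map D.τ.injective ℓ ℓ' h
    rw [h2] at this
    exact this
  have hρτ : ∀ h, D.τ (ρ h) = q (D.τ h) := fun h => by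
    have := pswap_map D.τ.injective t (D.σ t) h
    rw [tt, tt'] at this
    exact this
  have hρm : ∀ h, D.mark (ρ h) = D.mark h := D.mark_pswap ht.mark_eq ht.map.mark_eq
  have hqm : ∀ h, D.mark (q h) = D.mark h := fun h => by
    classical
    change D.mark (pswap ℓ ℓ' h) = _
    rw [pswap_eq, Equiv.swap_apply_def]
    split_ifs with e1 e2
    · rw [e1, hm]
    · rw [e2, hm]
    · rfl
  have e : el 𝕜 (D.flip _ htc) = el 𝕜 D := by
    -- The flip is taken at the third half-edge of the vertex, because a flip exchanges the two
    -- half-edges that follow the given one.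
    have e1 : el 𝕜 (D.flip _ htc) = el 𝕜 (D.rearrange ρ hρm) := by
      refine congrArg (el 𝕜) (rearrange_congr _ ?_ _ _)
      rw [h3]
    rw [e1]
    refine (el_iso 𝕜 (E := D.rearrange ρ hρm)
      ⟨q.trans ρ, fun h => ?_, fun h => ?_, fun h => ?_⟩).symm
    · change ρ (q (D.σ h)) = ρ (D.σ (ρ.symm (ρ (q h))))
      rw [ρ.symm_apply_apply, hqσ]
    · change ρ (q (D.τ h)) = D.τ (ρ (q h))
      rw [hρτ, hqτ, hρq]
    · exact (hρm _).trans (hqm h)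
  have h := el_flip 𝕜 D _ htc
  rw [e, ← two_smul 𝕜] at h
  exact (smul_eq_zero.1 h).resolve_left two_ne_zero

/-- Two legs at each vertex are excluded, so every leg has its own trivalent vertex. -/
theorem three_mul_numLegs_le {D : JDiag X} (ht : ∀ ℓ, D.IsLeg ℓ → D.IsTri (D.τ ℓ))
    (hf : ∀ ℓ ℓ', D.IsLeg ℓ → D.IsLeg ℓ' → ℓ ≠ ℓ' → D.τ ℓ' ≠ D.σ (D.τ ℓ)) :
    3 * D.numLegs ≤ D.triCard := by
  have hf1 : ∀ ℓ ℓ', D.IsLeg ℓ → D.IsLeg ℓ' → D.τ ℓ' ≠ D.σ (D.τ ℓ) := fun ℓ ℓ' h h' e => by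
    by_cases hne : ℓ = ℓ'
    · subst hne
      exact (ht ℓ h).1 e.symm
    · exact hf ℓ ℓ' h h' hne e
  have hf2 : ∀ ℓ ℓ', D.IsLeg ℓ → D.IsLeg ℓ' → D.τ ℓ' ≠ D.σ (D.σ (D.τ ℓ)) := fun ℓ ℓ' h h' e => by
    refine hf1 ℓ' ℓ h' h ?_
    rw [e]
    exact ((D.valence (D.τ ℓ)).resolve_left (ht ℓ h).2).symm
  let f : Fin 3 × {h // D.IsLeg h} → {h // D.IsTri h} := fun p =>
    match p.1 with
    | 0 => ⟨D.τ p.2.1, ht _ p.2.2⟩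
    | 1 => ⟨D.σ (D.τ p.2.1), (ht _ p.2.2).map⟩
    | 2 => ⟨D.σ (D.σ (D.τ p.2.1)), (ht _ p.2.2).map.map⟩
  have hinj : Function.Injective f := by
    rintro ⟨i, ℓ, hl⟩ ⟨j, ℓ', hl'⟩ e
    have e := congrArg Subtype.val e
    have key : D.τ ℓ = D.τ ℓ' → (⟨ℓ, hl⟩ : {h // D.IsLeg h}) = ⟨ℓ', hl'⟩ := fun e =>
      Subtype.ext (D.τ.injective e)
    fin_cases i <;> fin_cases j
    · exact Prod.ext rfl (key e)
    · exact absurd e (hf1 _ _ hl' hl)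
    · exact absurd e (hf2 _ _ hl' hl)
    · exact absurd e.symm (hf1 _ _ hl hl')
    · exact Prod.ext rfl (key (D.σ.injective e))
    · exact absurd (D.σ.injective e) (hf1 _ _ hl' hl)
    · exact absurd e.symm (hf2 _ _ hl hl')
    · exact absurd (D.σ.injective e).symm (hf1 _ _ hl hl')
    · exact Prod.ext rfl (key (D.σ.injective (D.σ.injective e)))
  have h := Nat.card_le_card_of_injective f hinj
  rw [Nat.card_prod, Nat.card_fin] at h
  exact h

variable [DecidableEq X]

/-- A strut in the second argument is either closed by one strut of the first, giving a circle, or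
is part of a chain through two of them. For k = m the factor is circle + 2m, which is zero by O_m.
-/
theorem pairing_pow_succ_st_mul (a : X) (k : ℕ) (y : Space 𝕜 X) :
    pairing 𝕜 (st 𝕜 a a ^ (k + 1)) (st 𝕜 a a * y) =
      (2 * (k + 1) : 𝕜) • (el 𝕜 (circle Empty) * pairing 𝕜 (st 𝕜 a a ^ k) y +
        (2 * k : 𝕜) • pairing 𝕜 (st 𝕜 a a ^ k) y) := by
  induction k generalizing y with
  | zero =>
    have h0 : pairing 𝕜 1 (st 𝕜 a a) = 0 := eps_of_leg 𝕜 (strut_isLeg a a false)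
    have h1 : pairing 𝕜 1 (opE 𝕜 a a y) = 0 := by
      rw [← pairing_opE, opE_one, map_zero, LinearMap.zero_apply]
    have h2 : pairing 𝕜 1 (el 𝕜 (circle X) * y) = el 𝕜 (circle Empty) * pairing 𝕜 1 y := by
      rw [eps_mul, eps_circle]
    rw [pow_succ, pairing_mul_st, opD_st_mul, dl_self, pow_zero, map_add, map_add, eps_mul, h0, zero_mul]
    simp only [map_add, map_smul, h1, h2]
    push_cast
    module
  | succ k ih =>
    have h1 : pairing 𝕜 (st 𝕜 a a ^ (k + 1)) (opE 𝕜 a a y) =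
        (2 * (k + 1 : ℕ) : 𝕜) • pairing 𝕜 (st 𝕜 a a ^ (k + 1)) y := by
      rw [← pairing_opE, opE_st_pow, dl_self, mul_one, map_smul, LinearMap.smul_apply]
    have h2 : pairing 𝕜 (st 𝕜 a a ^ k) (opD 𝕜 a a y) = pairing 𝕜 (st 𝕜 a a ^ (k + 1)) y := by
      rw [pow_succ, pairing_mul_st]
    have h3 : pairing 𝕜 (st 𝕜 a a ^ (k + 1)) (el 𝕜 (circle X) * y) =
        el 𝕜 (circle Empty) * pairing 𝕜 (st 𝕜 a a ^ (k + 1)) y := by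
      rw [pairing_legless_mul 𝕜 (pow_mem (st_mem 𝕜 a a) _) circle_legless, eps_circle]
    rw [pow_succ, pairing_mul_st, opD_st_mul, dl_self]
    simp only [map_add, map_smul, h1, h3, ih, h2]
    push_cast
    module

/-! ### Truncation kills the relations -/

variable [CharZero 𝕜]

/-- The heart of injectivity. A strut in K gives the factor circle + 2m, and two legs at one vertex
give 0 by antisymmetry. Otherwise each of the 2m + 2 legs has its own trivalent vertex, and the
closed diagram has degree at least m + 1. -/
theorem trunc_pairing_of_not_isBi (m : ℕ) {K : JDiag X} {a : X} (hK : ∀ h, ¬ K.IsBi h)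
    (ha : ∀ ℓ, K.IsLeg ℓ → K.mark ℓ = some a) :
    trunc 𝕜 Empty m (pairing 𝕜 (st 𝕜 a a ^ (m + 1)) (el 𝕜 K)) = 0 := by
  by_cases hs : ∃ ℓ, K.IsLeg ℓ ∧ K.IsLeg (K.τ ℓ)
  · obtain ⟨ℓ, h1, h2⟩ := hs
    obtain ⟨E, hE⟩ := exists_el_eq_st_mul 𝕜 (ha _ h1) (ha _ h2)
    rw [hE, pairing_pow_succ_st_mul, map_smul, map_add, map_smul, trunc_circle_mul, ← add_smul]
    simp
  have ht : ∀ ℓ, K.IsLeg ℓ → K.IsTri (K.τ ℓ) := fun ℓ hl =>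
    ((K.isLeg_or_isBi_or_isTri (K.τ ℓ)).resolve_left fun h => hs ⟨ℓ, hl, h⟩).resolve_left (hK _)
  by_cases hf : ∃ ℓ ℓ', K.IsLeg ℓ ∧ K.IsLeg ℓ' ∧ K.τ ℓ' = K.σ (K.τ ℓ)
  · obtain ⟨ℓ, ℓ', h1, h2, h3⟩ := hf
    rw [el_eq_zero_of_fork 𝕜 h1 ((ha _ h2).trans (ha _ h1).symm) (ht _ h1) h3, map_zero, map_zero]
  by_cases hn : K.numLegs = 2 * (m + 1)
  · have h3 := three_mul_numLegs_le ht fun ℓ ℓ' h1 h2 _ e => hf ⟨ℓ, ℓ', h1, h2, e⟩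
    rw [pairing_pow_st 𝕜 a _ K ha hn, map_smul, closeSum, map_finsum']
    refine (congrArg _ ((finsum_congr fun π => ?_).trans finsum_zero)).trans (smul_zero _)
    rw [trunc_el]
    refine truncFun_of_not_le 𝕜 ?_
    rw [close_degree π.2.1]
    omega
  · rw [pairing_pow_st_eq_zero 𝕜 a a, map_zero]
    rw [← numLegs_eq_card_lg ha, dl_self, mul_one]
    exact fun e => hn (by exact_mod_cast e)

theorem trunc_pairing_pow_st (m : ℕ) (K : JDiag Unit) :
    trunc 𝕜 Empty m (pairing 𝕜 (st 𝕜 () () ^ (m + 1)) (el 𝕜 K)) = 0 := by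
  obtain ⟨n, E, h1, h2, -⟩ := exists_normal_form K
  rw [el_eq_circle_pow_mul 𝕜 h1]
  clear h1
  induction n with
  | zero =>
    rw [pow_zero, one_mul]
    exact trunc_pairing_of_not_isBi 𝕜 m h2 fun ℓ hl => (Option.isSome_iff_exists.1 hl).choose_spec
  | succ n ih =>
    rw [pow_succ' (el 𝕜 (circle Unit)), mul_assoc, pairing_legless_mul 𝕜 (pow_mem (st_mem 𝕜 _ _) _) circle_legless,
      eps_circle, trunc_circle_mul, ih, smul_zero]

/-- An ideal contains all multiples of its generators. A closed diagram as multiplier is absorbed by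
taking its disjoint union with K, which is again a diagram with stubs. -/
theorem trunc_mul_closeSum (m : ℕ) {K : JDiag Unit} (hK : K.numLegs = 2 * m + 2)
    (y : Space 𝕜 Empty) : trunc 𝕜 Empty m (y * closeSum 𝕜 K (fun _ => True)) = 0 := by
  induction y using space_induction with
  | h0 => rw [zero_mul, map_zero]
  | hadd x y hx hy => rw [add_mul, map_add, hx, hy, add_zero]
  | hsmul c x hx => rw [smul_mul_assoc, map_smul, hx, smul_zero]
  | hel D =>
    have hD : D.toUnit.Legless := fun h hl =>
      (Option.isSome_iff_exists.1 (toUnit_isLeg.1 hl)).choose.elim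
    have e1 : pairing 𝕜 1 (el 𝕜 D.toUnit) = el 𝕜 D := by
      rw [eps_legless 𝕜 hD]
      exact el_isoOf 𝕜 (Equiv.refl D.H) (fun _ => rfl) (fun _ => rfl) fun _ => Subsingleton.elim _ _
    have h1 := trunc_pairing_pow_st 𝕜 m (D.toUnit.union K)
    rw [← el_mul, pairing_legless_mul 𝕜 (pow_mem (st_mem 𝕜 _ _) _) hD, e1,
      pairing_pow_st 𝕜 () (m + 1) K (fun ℓ hl => (Option.isSome_iff_exists.1 hl).choose_spec)
        (by omega), mul_smul_comm, map_smul] at h1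
    refine (smul_eq_zero.1 h1).resolve_left (Nat.cast_ne_zero.2 ?_)
    positivity

theorem trunc_eq_zero_of_mem {m : ℕ} {x : Space 𝕜 Empty} (hx : x ∈ idealOP 𝕜 m) :
    trunc 𝕜 Empty m x = 0 := by
  have key : ∀ y, trunc 𝕜 Empty m (y * x) = 0 := by
    induction hx using Submodule.span_induction with
    | mem x hx =>
      intro y
      rcases hx with rfl | ⟨K, hK, rfl⟩
      · have e : y * (el 𝕜 (circle Empty) + 2 * (m : Space 𝕜 Empty)) =
            el 𝕜 (circle Empty) * y + (2 * m : 𝕜) • y := by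
          have e0 : (2 * m : 𝕜) • y = algebraMap 𝕜 (Space 𝕜 Empty) (2 * m) * y :=
            Algebra.smul_def (2 * m : 𝕜) y
          rw [e0, map_mul, map_natCast, map_ofNat]
          ring
        rw [e, map_add, map_smul, trunc_circle_mul, ← add_smul]
        simp
      · exact trunc_mul_closeSum 𝕜 m hK y
    | zero => intro y; rw [mul_zero, map_zero]
    | add x z _ _ hx hz => intro y; rw [mul_add, map_add, hx, hz, add_zero]
    | smul b x _ hx => intro y; rw [smul_eq_mul, ← mul_assoc, hx]
  rw [← one_mul x]
  exact key 1

omit [CharZero 𝕜] in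
theorem trunc_of_mem_manifoldLE {m : ℕ} {x : Space 𝕜 Empty} (hx : x ∈ manifoldLE 𝕜 m) :
    trunc 𝕜 Empty m x = x := by
  induction hx using Submodule.span_induction with
  | mem x hx =>
    obtain ⟨D, h1, h2, rfl⟩ := hx
    exact trunc_of_circleFree 𝕜 h1 h2
  | zero => rw [map_zero]
  | add x y _ _ hx hy => rw [map_add, hx, hy]
  | smul c x _ hx => rw [map_smul, hx]

omit [CharZero 𝕜] in
-- In the normal form the circles split off as factors, which are −2m under φ, and the remaining
-- diagram has the same degree. A closed diagram without subdivision points has no circles.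
theorem exists_mem_manifoldLE {R : Type*} [CommRing R] [Algebra 𝕜 R] {φ : Space 𝕜 Empty →ₐ[𝕜] R}
    {m : ℕ} (hφ : ∀ a ∈ idealOP 𝕜 m, φ a = 0) {x : Space 𝕜 Empty} (hx : x ∈ closedLE 𝕜 m) :
    ∃ z ∈ manifoldLE 𝕜 m, φ z = φ x := by
  induction hx using Submodule.span_induction with
  | mem x hx =>
    obtain ⟨D, hd, rfl⟩ := hx
    obtain ⟨n, E, h1, h2, -⟩ := exists_normal_form D
    have hc := counts_normal_form h1
    refine ⟨(-2 * m : 𝕜) ^ n • el 𝕜 E, Submodule.smul_mem _ _ (Submodule.subset_span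
      ⟨E, fun h => ⟨h, .refl h, h2 h⟩, ?_, rfl⟩), ?_⟩
    · rw [degree_eq] at hd ⊢
      rwa [← hc.1, ← hc.2]
    · rw [el_eq_circle_pow_mul 𝕜 h1, map_mul, map_pow, map_circle 𝕜 hφ, map_smul, Algebra.smul_def, map_pow]
  | zero => exact ⟨0, zero_mem _, rfl⟩
  | add x y _ _ hx hy =>
    obtain ⟨x', hx', ex⟩ := hx
    obtain ⟨y', hy', ey⟩ := hy
    exact ⟨x' + y', add_mem hx' hy', by rw [map_add, map_add, ex, ey]⟩
  | smul c x _ hx =>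
    obtain ⟨x', hx', ex⟩ := hx
    exact ⟨c • x', Submodule.smul_mem _ _ hx', by rw [map_smul, map_smul, ex]⟩

theorem bijOn_manifoldLE (m : ℕ) :
    Set.BijOn (Ideal.Quotient.mk (idealOP 𝕜 m)) (manifoldLE 𝕜 m)
      (Ideal.Quotient.mk (idealOP 𝕜 m) '' closedLE 𝕜 m) := by
  refine ⟨fun x hx => ⟨x, ?_, rfl⟩, fun x hx y hy e => ?_, ?_⟩
  · refine Submodule.span_mono ?_ hx
    rintro a ⟨D, _, h2, h3⟩
    exact ⟨D, h2, h3⟩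
  -- `trunc` vanishes on the ideal and is the identity on the circle-free part, so it separates the
  -- images.
  · have h := trunc_eq_zero_of_mem 𝕜 (Ideal.Quotient.eq.1 e)
    rw [map_sub, trunc_of_mem_manifoldLE 𝕜 hx, trunc_of_mem_manifoldLE 𝕜 hy] at h
    exact sub_eq_zero.1 h
  · rintro _ ⟨x, hx, rfl⟩
    obtain ⟨z, hz, e⟩ := exists_mem_manifoldLE 𝕜 (R := Space 𝕜 Empty ⧸ idealOP 𝕜 m)
      (φ := Ideal.Quotient.mkₐ 𝕜 (idealOP 𝕜 m)) (fun a ha => Ideal.Quotient.eq_zero_iff_mem.2 ha) hx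
    exact ⟨z, hz, e⟩

theorem coeff_negIntegral {X : Type u} [Fintype X] [DecidableEq X] (m : ℕ) {Λ : Matrix X X 𝕜}
    {P G : PowerSeries (Space 𝕜 X)} (hG : IsPerturbedGaussian 𝕜 Λ P G) (d : ℕ) :
    PowerSeries.coeff d (negIntegral 𝕜 m G) =
      ((-1) ^ (m * Fintype.card X) * Λ.det ^ m : 𝕜) •
        Ideal.Quotient.mk (idealOP 𝕜 m)
          (PowerSeries.coeff d (formalGaussianIntegral 𝕜 Λ P)) := by
  rw [hG.eq_mul, negIntegral, PowerSeries.coeff_map]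
  exact map_coeff_negative_integral 𝕜 (R := Space 𝕜 Empty ⧸ idealOP 𝕜 m)
    (φ := Ideal.Quotient.mkₐ 𝕜 (idealOP 𝕜 m)) (fun a ha => Ideal.Quotient.eq_zero_iff_mem.2 ha) hG.symm hG.nondegenerate P d
    (support_pairing_gaussian_finite 𝕜 _ hG.strutless d)

end JDiag

end

theorem proposition2 {𝕜 : Type*} [Field 𝕜] [CharZero 𝕜] {X : Type*} [Fintype X] [DecidableEq X]
    (m : ℕ) (Λ : Matrix X X 𝕜) (P G : PowerSeries (JDiag.Space 𝕜 X))
    (hG : JDiag.IsPerturbedGaussian 𝕜 Λ P G) :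
    Set.BijOn (Ideal.Quotient.mk (JDiag.idealOP 𝕜 m)) (JDiag.manifoldLE 𝕜 m)
      (Ideal.Quotient.mk (JDiag.idealOP 𝕜 m) '' JDiag.closedLE 𝕜 m) ∧
    (∀ d, PowerSeries.coeff d (JDiag.formalGaussianIntegral 𝕜 Λ P) ∈ JDiag.manifoldPiece 𝕜 d) ∧
    ∀ d ≤ m, PowerSeries.coeff d (JDiag.negIntegral 𝕜 m G) =
      ((-1) ^ (m * Fintype.card X) * Λ.det ^ m : 𝕜) •
        Ideal.Quotient.mk (JDiag.idealOP 𝕜 m)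
          (PowerSeries.coeff d (JDiag.formalGaussianIntegral 𝕜 Λ P)) := by
  exact ⟨JDiag.bijOn_manifoldLE 𝕜 m,
    JDiag.coeff_formalGaussianIntegral_mem 𝕜 Λ hG.strutless,
    fun d _ => JDiag.coeff_negIntegral 𝕜 m hG d⟩
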